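/- Let $(\theta_j)_{j\ge1}$, $(\kappa_j)_{j\ge1}$ be sequences of non-negative reals, with $(\kappa_j)$ non-arithmetic (no integer $j_0>1$ divides every $j$ with $\kappa_j\ne0$) and $\kappa_j>0$ for some $j\ge2$. Put $$g_\theta(z)=\sum_{j\ge1}\frac{\theta_j}{j}z^j,\qquad g_\kappa(z)=\sum_{j\ge1}\frac{\kappa_j}{j}z^j,\qquad G_N(z)=g_\theta(z)+N g_\kappa(z),$$ $$H_N=\frac1{N!}\sum_{\sigma\in S_N}\prod_{j=1}^N(\theta_j+N\kappa_j)^{C_j(\sigma)},$$ where $C_j(\sigma)$ is the number of cycles of length $j$ of $\sigma$. For a function $g$ write $g^{\{n\}}(z)=z^n\,\frac{d^n g}{dz^n}(z)$ and $g^{\{n\}}(R)=\lim_{r\uparrow R}g^{\{n\}}(r)$ (for $g_\theta,g_\kappa$ this is $+\infty$ if the limit diverges); let $[z^N]F(z)$ be the $N$-th Taylor coefficient of $F$ at $0$. For $R,\eta>0$ and $\varphi\in(0,\pi/2)$ let $$\varDelta_0=\{z\in\mathbb C:\ |z|<|R(1+\eta e^{i\varphi})|,\ z\ne R,\ |\arg(z-R)|>\varphi\}.$$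 Assume that $g_\kappa$ has radius of convergence $R\in(0,\infty)$ and extends holomorphically to $\varDelta_0$, that $g_\theta$ extends holomorphically to $\varDelta_0$ and is regular (analytic) at $R$, and that $g_\kappa^{\{1\}}(R)<1$. Assume further that there is a non-integer $s>1$ such that $g_\kappa^{\{n\}}(R)<\infty$ for all integers $0\le n<s$ and $g_\kappa^{\{n\}}(R)=\infty$ for all integers $n>s$, and that, for some real $a_s\ne0$ and some $\delta>0$, as $z\to R$, $z\in\varDelta_0$, $$g_\kappa(z)=\sum_{0\le n<s}\frac{(-1)^n g_\kappa^{\{n\}}(R)}{n!}(1-z/R)^n+a_s(1-z/R)^s+O\bigl(|1-z/R|^{s+\delta}\bigr).$$ **(A)** Let $f\colon\varDelta_0\to\mathbb C$ be holomorphic and such that, for some $\beta>0$, $c_\beta>0$ and $\delta'>0$, as $z\to R$, $z\in\varDelta_0$, $$f(z)=1+\sum_{1\le n<\beta}\frac{(-1)^n f^{\{n\}}(R)}{n!}(1-z/R)^n+c_\beta(1-z/R)^\beta+O\bigl(|1-z/R|^{\beta+\delta'}\bigr).$$ Write $d(v)=1-v\,g_\kappa^{\{1\}}(R)$. Then, for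 any $0<v_1<1<v_2<1/g_\kappa^{\{1\}}(R)$, as $N\to\infty$: (i) If $\beta>s-1$, then, uniformly in $v\in[v_1,v_2]$, $$[z^N]\bigl[f(z)e^{vG_N(z)}\bigr]\sim\frac{e^{vG_N(R)}\,v\,a_s\,\{N d(v)\}^{-s}}{R^N\,\Gamma(-s)\,d(v)}.$$ (ii) If $\beta$ is non-integer and $\beta<s-1$, then, uniformly in $v\in[v_1,v_2]$, $$[z^N]\bigl[f(z)e^{vG_N(z)}\bigr]\sim\frac{e^{vG_N(R)}\,c_\beta\,\{N d(v)\}^{-\beta-1}}{R^N\,\Gamma(-\beta)}.$$ (iii) If $\beta=s-1$, put $B(v)=\dfrac{c_\beta}{\Gamma(1-s)}+\dfrac{v\,a_s}{\Gamma(-s)\,d(v)}$. Then, with $o(1)$ uniform in $v\in[v_1,v_2]$, $$[z^N]\bigl[f(z)e^{vG_N(z)}\bigr]=\frac{e^{vG_N(R)}\,\{N d(v)\}^{-s}}{R^N}\,\bigl(B(v)+o(1)\bigr).$$ Consequently $$[z^N]\bigl[f(z)e^{vG_N(z)}\bigr]\sim\frac{e^{vG_N(R)}\,\{N d(v)\}^{-s}}{R^N}\,B(v)$$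 uniformly on every compact subset of $[v_1,v_2]$ on which $B$ has no zero. **(B)** In particular, $$H_N\sim\frac{e^{G_N(R)}\,a_s\,\{N(1-g_\kappa^{\{1\}}(R))\}^{-s}}{R^N\,\Gamma(-s)\,(1-g_\kappa^{\{1\}}(R))},\qquad N\to\infty.$$ -/

import Mathlib

open Filter Topology Asymptotics

noncomputable section

namespace SurrogateSpatial

/-- The `j`-th coefficient `a_j / j` of the generating function `g_a(z) = ∑_{j ≥ 1} (a_j / j) z^j`.
For `j = 0` this is `0`, whatever the unused entry `a 0` is. -/
def genCoeff (a : ℕ → ℝ) (j : ℕ) : ℝ := a j / j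

/-- The generating function `g_a(r) = ∑_{j ≥ 1} (a_j / j) r^j` at real arguments. -/
def genFun (a : ℕ → ℝ) (r : ℝ) : ℝ := ∑' j : ℕ, genCoeff a j * r ^ j

/-- The modified derivative `g^{n}(z) = z^n (d/dz)^n g(z)` (over `ℝ` or `ℂ`). -/
def modDeriv {𝕜 : Type*} [NontriviallyNormedField 𝕜] (n : ℕ) (g : 𝕜 → 𝕜) (z : 𝕜) : 𝕜 :=
  z ^ n * iteratedDeriv n g z

/-- `g_a^{n}(R) = lim_{r ↑ R} g_a^{n}(r) ∈ [0, ∞]`, taken in the extended reals.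
(For `a_j ≥ 0` and a series converging on `[0, R)` the function under the limit is monotone,
so that the limit exists, and it is `⊤` exactly when the limit diverges in `ℝ`.) -/
def boundaryDeriv (a : ℕ → ℝ) (n : ℕ) (R : ℝ) : EReal :=
  limUnder (𝓝[<] R) (fun r : ℝ => ((modDeriv n (genFun a) r : ℝ) : EReal))

/-- `f^{n}(R) = lim_{r ↑ R} f^{n}(r)` for a complex function `f`. -/
def boundaryDerivC (f : ℂ → ℂ) (n : ℕ) (R : ℝ) : ℂ :=
  limUnder (𝓝[<] R) (fun r : ℝ => modDeriv n f (r : ℂ))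

/-- The domain `Δ₀(R, η, φ)`: the disk of radius `|R (1 + η e^{iφ})|` without the closed sector
`|arg (z - R)| ≤ φ` with vertex `R`. -/
def Delta0 (R η φ : ℝ) : Set ℂ :=
  {z : ℂ | ‖z‖ < ‖(R : ℂ) * (1 + η * Complex.exp (φ * Complex.I))‖ ∧ z ≠ (R : ℂ) ∧
    φ < |Complex.arg (z - R)|}

/-- The sequence `(κ_j)_{j ≥ 1}` is non-arithmetic and non-degenerate. -/
def NonArithmetic (κ : ℕ → ℝ) : Prop :=
  (¬ ∃ j₀ : ℕ, 1 < j₀ ∧ ∀ j : ℕ, 1 ≤ j → κ j ≠ 0 → j₀ ∣ j) ∧ ∃ j : ℕ, 2 ≤ j ∧ 0 < κ j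

/-- The Taylor coefficient `[z^N] F(z)` at the origin. -/
def coeffAt (N : ℕ) (F : ℂ → ℂ) : ℂ := iteratedDeriv N F 0 / (Nat.factorial N : ℂ)

/-- The number `C_j(σ)` of cycles of length `j` of the permutation `σ` (fixed points are cycles of
length `1`). -/
def cycleCount {N : ℕ} (σ : Equiv.Perm (Fin N)) (j : ℕ) : ℕ := σ.partition.parts.count j

/-- `H_N = (1 / N!) ∑_{σ ∈ S_N} ∏_{j=1}^N (θ_j + N κ_j)^{C_j(σ)}`. -/
def H (θ κ : ℕ → ℝ) (N : ℕ) : ℝ :=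
  (∑ σ : Equiv.Perm (Fin N), ∏ j ∈ Finset.Icc 1 N, (θ j + N * κ j) ^ cycleCount σ j) /
    (Nat.factorial N : ℝ)

/-- `G_N(R) = g_θ(R) + N g_κ(R)`. -/
def GBoundary (θ κ : ℕ → ℝ) (R : ℝ) (N : ℕ) : ℝ :=
  (boundaryDeriv θ 0 R).toReal + N * (boundaryDeriv κ 0 R).toReal

/-- `A_N(v) ∼ B_N(v)` as `N → ∞`, uniformly in `v ∈ K`. -/
def UnifEquiv (K : Set ℝ) (A : ℕ → ℝ → ℂ) (B : ℕ → ℝ → ℝ) : Prop :=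
  ∀ ε : ℝ, 0 < ε → ∀ᶠ N : ℕ in atTop, ∀ v ∈ K, ‖A N v - (B N v : ℂ)‖ ≤ ε * |B N v|

end SurrogateSpatial

end

/-!
Substituting `z = R e^ζ` turns the Cauchy integral for `[z^N] (f e^{v G_N})` into `R^{-N}` times an
integral over a vertical segment, which is deformed to two rays leaving `ζ = 0` to the right, closed
up by pieces on which the integrand is exponentially small: non-negativity and non-arithmeticity of
`κ` make `Re g_κ` strictly smaller than `g_κ(R)` elsewhere on the circle. Next to `0` the phase
`v g_κ - ζ` is, to first order, `v g_κ(R) - (1 - v g_κ^{1}(R)) ζ`, with non-zero slope. Replacing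
`f` and `g_κ` by the polynomial parts of their expansions gives an integrand that is holomorphic at
`0`, so its integral over the rays is negligible; on the scale `1 / N` the difference of the two
integrands is dominated by the singular terms, whose integrals are Hankel's integrals for `1 / Γ`.
For `H_N`, sorting permutations by cycle type identifies `H_N` with `[z^N] e^{G_N}`.
-/

namespace SurrogateSpatial

open MeasureTheory

section SegmentIntegral

/-- The integral of `F` along the oriented segment from `a` to `b`. The contours of the
saddle-point argument are polygonal, so no other path integral is needed. -/
noncomputable def segmentIntegral (F : ℂ → ℂ) (a b : ℂ) : ℂ :=
  ∫ t in (0 : ℝ)..1, F (a + t * (b - a)) * (b - a)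

variable {F : ℂ → ℂ} {a b c : ℂ}

theorem isCompact_segment (a b : ℂ) : IsCompact (segment ℝ a b) := by
  rw [segment_eq_image']
  exact isCompact_Icc.image (by fun_prop)

theorem add_mul_sub_mem_segment (a b : ℂ) {t : ℝ} (ht : t ∈ Set.Icc (0 : ℝ) 1) :
    a + t * (b - a) ∈ segment ℝ a b := by
  rw [segment_eq_image']
  exact ⟨t, ht, by simp⟩

@[simp]
theorem segmentIntegral_self (F : ℂ → ℂ) (a : ℂ) : segmentIntegral F a a = 0 := by
  simp [segmentIntegral]

theorem segmentIntegral_comp_add_right (F : ℂ → ℂ) (a b w : ℂ) :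
    segmentIntegral (fun z ↦ F (z + w)) a b = segmentIntegral F (a + w) (b + w) := by
  simp only [segmentIntegral, add_sub_add_right_eq_sub]
  congr with t
  ring_nf

theorem norm_segmentIntegral_le {M : ℝ} (h : ∀ z ∈ segment ℝ a b, ‖F z‖ ≤ M) :
    ‖segmentIntegral F a b‖ ≤ M * ‖b - a‖ := by
  have hpoint : ∀ t ∈ Set.uIoc (0 : ℝ) 1, ‖F (a + t * (b - a)) * (b - a)‖ ≤ M * ‖b - a‖ := by
    intro t ht
    rw [Set.uIoc_of_le zero_le_one] at ht
    rw [norm_mul]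
    gcongr
    exact h _ (add_mul_sub_mem_segment a b (Set.Ioc_subset_Icc_self ht))
  simpa [segmentIntegral] using intervalIntegral.norm_integral_le_of_norm_le_const hpoint

theorem segmentIntegral_eq_sub_of_hasDerivAt {Φ : ℂ → ℂ} (hF : ContinuousOn F (segment ℝ a b))
    (hΦ : ∀ z ∈ segment ℝ a b, HasDerivAt Φ (F z) z) : segmentIntegral F a b = Φ b - Φ a := by
  have hmaps : Set.MapsTo (fun t : ℝ ↦ a + t * (b - a)) (Set.uIcc (0 : ℝ) 1) (segment ℝ a b) := by
    rw [Set.uIcc_of_le zero_le_one]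
    exact fun t ht ↦ add_mul_sub_mem_segment a b ht
  have hderiv : ∀ t ∈ Set.uIcc (0 : ℝ) 1,
      HasDerivAt (fun t : ℝ ↦ Φ (a + t * (b - a))) (F (a + t * (b - a)) * (b - a)) t := by
    intro t ht
    have hline : HasDerivAt (fun t : ℝ ↦ a + (t : ℂ) * (b - a)) (b - a) t := by
      simpa using ((Complex.ofRealCLM.hasDerivAt (x := t)).mul_const (b - a)).const_add a
    exact (hΦ _ (hmaps ht)).comp t hline
  have hcont : ContinuousOn (fun t : ℝ ↦ F (a + t * (b - a)) * (b - a)) (Set.uIcc (0 : ℝ) 1) :=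
    (hF.comp (by fun_prop) hmaps).mul continuousOn_const
  rw [segmentIntegral, intervalIntegral.integral_eq_sub_of_hasDerivAt hderiv
    hcont.intervalIntegrable]
  simp

theorem segmentIntegral_add_of_convex {U : Set ℂ} (hU : Convex ℝ U) (hUo : IsOpen U)
    (hF : DifferentiableOn ℂ F U) (ha : a ∈ U) (hb : b ∈ U) (hc : c ∈ U) :
    segmentIntegral F a b + segmentIntegral F b c = segmentIntegral F a c := by
  obtain ⟨Φ, hΦ⟩ := hU.exists_forall_hasDerivWithinAt hF
  have hsub : ∀ {x y : ℂ}, x ∈ U → y ∈ U → segmentIntegral F x y = Φ y - Φ x := fun hx hy ↦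
    segmentIntegral_eq_sub_of_hasDerivAt (hF.continuousOn.mono (hU.segment_subset hx hy))
      fun z hz ↦ have hzU := hU.segment_subset hx hy hz
        (hΦ z hzU).hasDerivAt (hUo.mem_nhds hzU)
  rw [hsub ha hb, hsub hb hc, hsub ha hc]
  ring

theorem intervalIntegrable_segment {S : Set ℂ} {M : ℝ} (hF : ContinuousOn F S)
    (hmem : ∀ z ∈ segment ℝ a b, z ≠ a → z ∈ S) (hM : ∀ z ∈ segment ℝ a b, z ≠ a → ‖F z‖ ≤ M) :
    IntervalIntegrable (fun t : ℝ ↦ F (a + t * (b - a)) * (b - a)) volume 0 1 := by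
  rcases eq_or_ne a b with rfl | hab
  · simp
  have hne : ∀ t : ℝ, 0 < t → a + t * (b - a) ≠ a := fun t ht ↦ by
    simpa [sub_eq_zero, hab.symm] using ht.ne'
  rw [intervalIntegrable_iff_integrableOn_Ioc_of_le zero_le_one]
  refine IntegrableOn.of_bound (by simp) ?_ (M * ‖b - a‖) ?_
  · have hcont : ContinuousOn (fun t : ℝ ↦ F (a + t * (b - a))) (Set.Ioc 0 1) :=
      hF.comp (by fun_prop) fun t ht ↦
        hmem _ (add_mul_sub_mem_segment a b ⟨ht.1.le, ht.2⟩) (hne t ht.1)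
    exact (hcont.aestronglyMeasurable measurableSet_Ioc).mul_const _
  · refine (ae_restrict_iff' measurableSet_Ioc).2 (ae_of_all _ fun t ht ↦ ?_)
    rw [norm_mul]
    gcongr
    exact hM _ (add_mul_sub_mem_segment a b ⟨ht.1.le, ht.2⟩) (hne t ht.1)

theorem segmentIntegral_sub {A : ℂ → ℂ} {S : Set ℂ} {M : ℝ}
    (hF : ContinuousOn F S) (hA : ContinuousOn A (segment ℝ a b))
    (hmem : ∀ z ∈ segment ℝ a b, z ≠ a → z ∈ S) (hM : ∀ z ∈ segment ℝ a b, z ≠ a → ‖F z‖ ≤ M) :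
    segmentIntegral F a b - segmentIntegral A a b = segmentIntegral (F - A) a b := by
  obtain ⟨M', hM'⟩ := (isCompact_segment a b).exists_bound_of_continuousOn hA
  simp only [segmentIntegral, Pi.sub_apply, sub_mul,
    ← intervalIntegral.integral_sub (intervalIntegrable_segment hF hmem hM)
      (intervalIntegrable_segment hA (fun _ hz _ ↦ hz) fun z hz _ ↦ hM' z hz)]

theorem tendsto_segmentIntegral_sub_ofReal {D : Set ℂ} (hD : IsOpen D) (hF : ContinuousOn F D)
    {ε₀ M : ℝ} (hε₀ : 0 < ε₀) (hmem : ∀ z ∈ segment ℝ a b, z ≠ a → z ∈ D)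
    (hmem' : ∀ ε ∈ Set.Ioo 0 ε₀, ∀ z ∈ segment ℝ a b, z - (ε : ℝ) ∈ D)
    (hM : ∀ ε ∈ Set.Ioo 0 ε₀, ∀ z ∈ segment ℝ a b, ‖F (z - (ε : ℝ))‖ ≤ M) :
    Tendsto (fun ε : ℝ ↦ segmentIntegral F (a - ε) (b - ε)) (𝓝[>] 0)
      (𝓝 (segmentIntegral F a b)) := by
  rcases eq_or_ne a b with rfl | hab
  · simp
  have hshift : ∀ ε : ℝ, segmentIntegral F (a - ε) (b - ε)
      = ∫ t in (0 : ℝ)..1, F (a + t * (b - a) - (ε : ℝ)) * (b - a) := fun ε ↦ by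
    simp only [segmentIntegral, sub_sub_sub_cancel_right, sub_add_eq_add_sub]
  simp only [hshift]
  have hsmall : ∀ᶠ ε : ℝ in 𝓝[>] 0, ε ∈ Set.Ioo 0 ε₀ := Ioo_mem_nhdsGT hε₀
  have hseg : ∀ t ∈ Set.uIoc (0 : ℝ) 1, a + t * (b - a) ∈ segment ℝ a b := fun t ht ↦ by
    rw [Set.uIoc_of_le zero_le_one] at ht
    exact add_mul_sub_mem_segment a b ⟨ht.1.le, ht.2⟩
  refine intervalIntegral.tendsto_integral_filter_of_dominated_convergence
    (fun _ ↦ M * ‖b - a‖) ?_ ?_ (by simp) ?_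
  · filter_upwards [hsmall] with ε hε
    refine ContinuousOn.aestronglyMeasurable (.mul (hF.comp (by fun_prop) fun t ht ↦ ?_)
      continuousOn_const) measurableSet_uIoc
    exact hmem' ε hε _ (hseg t ht)
  · filter_upwards [hsmall] with ε hε
    refine ae_of_all _ fun t ht ↦ ?_
    rw [norm_mul]
    gcongr
    exact hM ε hε _ (hseg t ht)
  · refine ae_of_all _ fun t ht ↦ ?_
    have ht0 : t ≠ 0 := by
      rw [Set.uIoc_of_le zero_le_one] at ht
      exact ht.1.ne'
    have hz : a + t * (b - a) ∈ D :=
      hmem _ (hseg t ht) (by simpa [sub_eq_zero, hab.symm] using ht0)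
    have hline : Tendsto (fun ε : ℝ ↦ a + t * (b - a) - (ε : ℂ)) (𝓝[>] 0)
        (𝓝 (a + t * (b - a))) := by
      have : Continuous fun ε : ℝ ↦ a + t * (b - a) - (ε : ℂ) := by fun_prop
      simpa using (this.tendsto 0).mono_left nhdsWithin_le_nhds
    exact ((hF.continuousAt (hD.mem_nhds hz)).tendsto.comp hline).mul_const _

theorem tendsto_segmentIntegral_sub_ofReal_of_segment_subset {D : Set ℂ} (hD : IsOpen D)
    (hF : ContinuousOn F D) (hmem : segment ℝ a b ⊆ D) :
    Tendsto (fun ε : ℝ ↦ segmentIntegral F (a - ε) (b - ε)) (𝓝[>] 0)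
      (𝓝 (segmentIntegral F a b)) := by
  have hK := isCompact_segment a b
  obtain ⟨ε₀, hε₀, hsub⟩ := hK.exists_cthickening_subset_open hD hmem
  have hmem' : ∀ ε ∈ Set.Ioo 0 ε₀, ∀ z ∈ segment ℝ a b,
      z - (ε : ℝ) ∈ Metric.cthickening ε₀ (segment ℝ a b) := by
    intro ε hε z hz
    refine Metric.mem_cthickening_of_dist_le _ z _ _ hz ?_
    simpa [dist_eq_norm, abs_of_pos hε.1] using hε.2.le
  obtain ⟨M, hM⟩ := hK.cthickening.exists_bound_of_continuousOn (hF.mono hsub)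
  exact tendsto_segmentIntegral_sub_ofReal hD hF hε₀ (fun z hz _ ↦ hmem hz)
    (fun ε hε z hz ↦ hsub (hmem' ε hε z hz)) (fun ε hε z hz ↦ hM _ (hmem' ε hε z hz))

end SegmentIntegral

section ContourDeformation

variable {F : ℂ → ℂ} {w : ℂ} {U V W : Set ℂ} {p q t u : ℂ}

theorem segmentIntegral_period_eq (hper : Function.Periodic F w)
    (hU : Convex ℝ U) (hUo : IsOpen U) (hFU : DifferentiableOn ℂ F U)
    (hV : Convex ℝ V) (hVo : IsOpen V) (hFV : DifferentiableOn ℂ F V)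
    (hW : Convex ℝ W) (hWo : IsOpen W) (hFW : DifferentiableOn ℂ F W) {o : ℂ}
    (hpU : ∀ z ∈ ({o, p, u, t} : Set ℂ), z ∈ U) (hqV : ∀ z ∈ ({o, q, u - w, t - w} : Set ℂ), z ∈ V)
    (hoW : ∀ z ∈ ({o, t, o + w} : Set ℂ), z ∈ W) :
    segmentIntegral F o (o + w) = segmentIntegral F o p + segmentIntegral F p u -
      (segmentIntegral F o q + segmentIntegral F q (u - w)) := by
  simp only [Set.mem_insert_iff, Set.mem_singleton_iff, forall_eq_or_imp, forall_eq] at hpU hqV hoW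
  obtain ⟨oU, pU, uU, tU⟩ := hpU
  obtain ⟨oV, qV, uV, tV⟩ := hqV
  obtain ⟨oW, tW, owW⟩ := hoW
  have hshift : ∀ a b, segmentIntegral F (a - w) (b - w) = segmentIntegral F a b := fun a b ↦ by
    simpa [hper _] using (segmentIntegral_comp_add_right F (a - w) (b - w) w)
  have upper₁ := segmentIntegral_add_of_convex hU hUo hFU oU pU uU
  have upper₂ := segmentIntegral_add_of_convex hU hUo hFU oU uU tU
  have lower₁ := segmentIntegral_add_of_convex hV hVo hFV oV qV uV
  have lower₂ := segmentIntegral_add_of_convex hV hVo hFV oV uV tV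
  have lower₃ := segmentIntegral_add_of_convex hV hVo hFV oV tV oV
  have left := segmentIntegral_add_of_convex hW hWo hFW oW tW owW
  have hfar := hshift u t
  have hnear := hshift t (o + w)
  rw [add_sub_cancel_right] at hnear
  rw [segmentIntegral_self] at lower₃
  linear_combination -left - upper₁ - upper₂ + lower₁ + lower₂ + lower₃ - hfar - hnear

/-- The vertex of the contour may be pushed to a boundary point of the domain of holomorphy, as
long as `F` stays bounded along the shifted legs. -/
theorem eq_segmentIntegral_legs {D : Set ℂ} (hD : IsOpen D) (hF : DifferentiableOn ℂ F D)
    (hper : Function.Periodic F w)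
    (hU : Convex ℝ U) (hUo : IsOpen U) (hUD : U ⊆ D)
    (hV : Convex ℝ V) (hVo : IsOpen V) (hVD : V ⊆ D)
    (hW : Convex ℝ W) (hWo : IsOpen W) (hWD : W ⊆ D)
    {ε₀ M : ℝ} {o C : ℂ} (hε₀ : 0 < ε₀)
    (hpU : ∀ ε ∈ Set.Ioo 0 ε₀, ∀ z ∈ ({o, p, u, t} : Set ℂ), z - (ε : ℝ) ∈ U)
    (hqV : ∀ ε ∈ Set.Ioo 0 ε₀, ∀ z ∈ ({o, q, u - w, t - w} : Set ℂ), z - (ε : ℝ) ∈ V)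
    (hoW : ∀ ε ∈ Set.Ioo 0 ε₀, ∀ z ∈ ({o, t, o + w} : Set ℂ), z - (ε : ℝ) ∈ W)
    (hp : ∀ z ∈ segment ℝ o p, z ≠ o → z ∈ D) (hq : ∀ z ∈ segment ℝ o q, z ≠ o → z ∈ D)
    (hpM : ∀ ε ∈ Set.Ioo 0 ε₀, ∀ z ∈ segment ℝ o p, ‖F (z - (ε : ℝ))‖ ≤ M)
    (hqM : ∀ ε ∈ Set.Ioo 0 ε₀, ∀ z ∈ segment ℝ o q, ‖F (z - (ε : ℝ))‖ ≤ M)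
    (hpu : segment ℝ p u ⊆ D) (hqu : segment ℝ q (u - w) ⊆ D)
    (hC : ∀ ε ∈ Set.Ioo 0 ε₀, segmentIntegral F (o - (ε : ℝ)) (o - (ε : ℝ) + w) = C) :
    C = segmentIntegral F o p + segmentIntegral F p u -
      (segmentIntegral F o q + segmentIntegral F q (u - w)) := by
  have hleg : ∀ {r : ℂ} {S : Set ℂ}, Convex ℝ S → S ⊆ D →
      (∀ ε ∈ Set.Ioo 0 ε₀, o - (ε : ℝ) ∈ S ∧ r - (ε : ℝ) ∈ S) →
      (∀ z ∈ segment ℝ o r, z ≠ o → z ∈ D) →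
      (∀ ε ∈ Set.Ioo 0 ε₀, ∀ z ∈ segment ℝ o r, ‖F (z - (ε : ℝ))‖ ≤ M) →
      Tendsto (fun ε : ℝ ↦ segmentIntegral F (o - ε) (r - ε)) (𝓝[>] 0)
        (𝓝 (segmentIntegral F o r)) := by
    intro r S hS hSD hends hmem hM
    refine tendsto_segmentIntegral_sub_ofReal hD hF.continuousOn hε₀ hmem (fun ε hε z hz ↦ ?_) hM
    have hz' : z - (ε : ℝ) ∈ segment ℝ (o - (ε : ℝ)) (r - (ε : ℝ)) := by
      simpa only [sub_eq_neg_add] using (mem_segment_translate ℝ (-((ε : ℝ) : ℂ))).2 hz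
    exact hSD (hS.segment_subset (hends ε hε).1 (hends ε hε).2 hz')
  have hlim := ((hleg hU hUD (fun ε hε ↦ ⟨hpU ε hε o (by simp), hpU ε hε p (by simp)⟩) hp hpM).add
      (tendsto_segmentIntegral_sub_ofReal_of_segment_subset hD hF.continuousOn hpu)).sub
    ((hleg hV hVD (fun ε hε ↦ ⟨hqV ε hε o (by simp), hqV ε hε q (by simp)⟩) hq hqM).add
      (tendsto_segmentIntegral_sub_ofReal_of_segment_subset hD hF.continuousOn hqu))
  refine tendsto_nhds_unique (tendsto_const_nhds (f := 𝓝[>] (0 : ℝ))) (hlim.congr' ?_)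
  filter_upwards [Ioo_mem_nhdsGT hε₀] with ε hε
  have hclosed := segmentIntegral_period_eq (p := p - (ε : ℝ)) (q := q - (ε : ℝ))
    (u := u - (ε : ℝ)) (t := t - (ε : ℝ)) (o := o - (ε : ℝ)) hper
    hU hUo (hF.mono hUD) hV hVo (hF.mono hVD) hW hWo (hF.mono hWD)
    (by simpa using hpU ε hε) (by simpa [sub_right_comm] using hqV ε hε)
    (by simpa [sub_add_eq_add_sub] using hoW ε hε)
  rw [← hC ε hε, hclosed, sub_right_comm u w]

theorem coeffAt_eq_circleIntegral {R r : ℝ} (hr : 0 < r) (hrR : r < R)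
    (hF : DifferentiableOn ℂ F (Metric.ball 0 R)) (N : ℕ) :
    2 * Real.pi * Complex.I * coeffAt N F = ∮ z in C(0, r), (1 / z ^ (N + 1)) * F z := by
  have hdiff : DiffContOnCl ℂ F (Metric.ball 0 r) :=
    (hF.mono (by rw [closure_ball _ hr.ne']; exact Metric.closedBall_subset_ball hrR)).diffContOnCl
  have h := hdiff.circleIntegral_one_div_sub_center_pow_smul hr N
  simp only [sub_zero, smul_eq_mul] at h
  rw [h, coeffAt]
  ring

theorem segmentIntegral_mul_exp_eq_coeffAt {R : ℝ} (hR : 0 < R)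
    (hF : DifferentiableOn ℂ F (Metric.ball 0 R)) (N : ℕ) {ε : ℝ} (hε : 0 < ε) :
    segmentIntegral (fun ζ ↦ F (R * Complex.exp ζ) * Complex.exp (-(N * ζ)))
      (-ε) (-ε + 2 * Real.pi * Complex.I) =
    2 * Real.pi * Complex.I * (R : ℂ) ^ N * coeffAt N F := by
  have hRC : (R : ℂ) ≠ 0 := by exact_mod_cast hR.ne'
  have hrR : R * Real.exp (-ε) < R := mul_lt_of_lt_one_right hR (by simpa using hε)
  have hcauchy := coeffAt_eq_circleIntegral (by positivity) hrR hF N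
  have hcircle : ∀ x : ℝ,
      circleMap 0 (R * Real.exp (-ε)) x = R * Complex.exp (-ε + x * Complex.I) :=
    fun x ↦ by simp [circleMap, Complex.exp_add, mul_assoc]
  rw [mul_right_comm _ ((R : ℂ) ^ N), hcauchy, circleIntegral,
    ← intervalIntegral.integral_mul_const]
  have hsubst := intervalIntegral.smul_integral_comp_mul_left (a := 0) (b := 1)
    (fun x : ℝ ↦ deriv (circleMap 0 (R * Real.exp (-ε))) x • (1 / circleMap 0 (R * Real.exp (-ε)) x
      ^ (N + 1) * F (circleMap 0 (R * Real.exp (-ε)) x)) * (R : ℂ) ^ N) (2 * Real.pi)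
  rw [mul_zero, mul_one] at hsubst
  rw [← hsubst, segmentIntegral, ← intervalIntegral.integral_smul]
  congr with x
  have hx : (-ε : ℂ) + x * (-ε + 2 * Real.pi * Complex.I - -ε) =
      -ε + ((2 * Real.pi * x : ℝ) : ℂ) * Complex.I := by push_cast; ring
  have hexp := Complex.exp_ne_zero (-ε + ((2 * Real.pi * x : ℝ) : ℂ) * Complex.I)
  rw [hx, deriv_circleMap, hcircle, Complex.exp_neg, Complex.exp_nat_mul]
  simp only [smul_eq_mul, Complex.real_smul, mul_pow, pow_succ]
  push_cast at hexp ⊢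
  field_simp
  ring

end ContourDeformation

section HankelRay

theorem continuousOn_rpow_mul_exp (s : ℝ) (r : ℂ) :
    ContinuousOn (fun t : ℝ ↦ ((t ^ s : ℝ) : ℂ) * Complex.exp (-(r * t))) (Set.Ioi 0) := by
  refine ContinuousOn.mul ?_ (by fun_prop)
  exact Complex.continuous_ofReal.comp_continuousOn
    (continuousOn_id.rpow_const fun t ht ↦ Or.inl (ne_of_gt ht))

theorem integrableOn_rpow_mul_exp {s κ : ℝ} (hs : -1 < s) (hκ : 0 < κ) :
    IntegrableOn (fun t : ℝ ↦ t ^ s * Real.exp (-(κ * t))) (Set.Ioi 0) := by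
  simpa using integrableOn_rpow_mul_exp_neg_mul_rpow (p := 1) hs one_pos hκ

/-- The measure `t ^ s dt` on the half-line. Its moment generating function is a Gamma integral, so
the analyticity of the latter in its complex rate comes from the theory of `complexMGF`. -/
noncomputable def rpowMeasure (s : ℝ) : Measure ℝ :=
  (volume.restrict (Set.Ioi 0)).withDensity fun t ↦ ENNReal.ofReal (t ^ s)

theorem complexMGF_rpowMeasure_neg (s : ℝ) (r : ℂ) :
    ProbabilityTheory.complexMGF id (rpowMeasure s) (-r) =
      ∫ t in Set.Ioi (0 : ℝ), ((t ^ s : ℝ) : ℂ) * Complex.exp (-(r * t)) := by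
  rw [ProbabilityTheory.complexMGF, rpowMeasure,
    integral_withDensity_eq_integral_toReal_smul (by fun_prop) (by simp)]
  refine setIntegral_congr_fun measurableSet_Ioi fun t ht ↦ ?_
  simp [ENNReal.toReal_ofReal (Real.rpow_nonneg (le_of_lt ht) s)]

theorem neg_mem_integrableExpSet_rpowMeasure {s κ : ℝ} (hs : -1 < s) (hκ : 0 < κ) :
    -κ ∈ ProbabilityTheory.integrableExpSet id (rpowMeasure s) := by
  rw [ProbabilityTheory.integrableExpSet, Set.mem_ofPred_eq, rpowMeasure,
    integrable_withDensity_iff_integrable_smul' (by fun_prop) (by simp)]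
  refine (integrableOn_rpow_mul_exp hs hκ).congr_fun (fun t ht ↦ ?_) measurableSet_Ioi
  simp [ENNReal.toReal_ofReal (Real.rpow_nonneg (le_of_lt ht) s)]

theorem analyticOnNhd_integral_rpow_mul_exp {s : ℝ} (hs : -1 < s) :
    AnalyticOnNhd ℂ
      (fun r : ℂ ↦ ∫ t in Set.Ioi (0 : ℝ), ((t ^ s : ℝ) : ℂ) * Complex.exp (-(r * t)))
      {r : ℂ | 0 < r.re} := by
  have hsub : Set.Iio 0 ⊆ interior (ProbabilityTheory.integrableExpSet id (rpowMeasure s)) :=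
    interior_maximal (fun x hx ↦ by
      simpa using neg_mem_integrableExpSet_rpowMeasure hs (neg_pos.2 hx)) isOpen_Iio
  intro r hr
  have hmgf := ProbabilityTheory.analyticAt_complexMGF (z := -r) (hsub (by simpa using hr))
  simpa only [Function.comp_def, complexMGF_rpowMeasure_neg] using
    hmgf.comp (analyticAt_id.neg (x := r))

theorem integral_rpow_mul_exp_ofReal {s x : ℝ} (hs : -1 < s) (hx : 0 < x) :
    ∫ t in Set.Ioi (0 : ℝ), ((t ^ s : ℝ) : ℂ) * Complex.exp (-((x : ℂ) * t)) =
      (x : ℂ) ^ (-((s : ℂ) + 1)) * Real.Gamma (s + 1) := by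
  have h := Complex.integral_cpow_mul_exp_neg_mul_Ioi (a := (s : ℂ) + 1) (r := x)
    (by simpa using by linarith) hx
  have harg : Complex.arg x ≠ Real.pi := by
    rw [Complex.arg_ofReal_of_nonneg hx.le]
    exact Real.pi_ne_zero.symm
  rw [add_sub_cancel_right, one_div, Complex.inv_cpow _ _ harg, ← Complex.cpow_neg] at h
  rw [← Complex.Gamma_ofReal, Complex.ofReal_add, Complex.ofReal_one, ← h]
  refine setIntegral_congr_fun measurableSet_Ioi fun t ht ↦ ?_
  simp only [Complex.ofReal_cpow (le_of_lt ht)]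

theorem integral_rpow_mul_exp {s : ℝ} (hs : -1 < s) {r : ℂ} (hr : 0 < r.re) :
    ∫ t in Set.Ioi (0 : ℝ), ((t ^ s : ℝ) : ℂ) * Complex.exp (-(r * t)) =
      r ^ (-((s : ℂ) + 1)) * Real.Gamma (s + 1) := by
  have hconv : Convex ℝ {r : ℂ | 0 < r.re} := (convex_Ioi (0 : ℝ)).linear_preimage Complex.reLm
  have hpow : AnalyticOnNhd ℂ (fun r : ℂ ↦ r ^ (-((s : ℂ) + 1)) * Real.Gamma (s + 1))
      {r : ℂ | 0 < r.re} := fun r hr ↦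
    (analyticAt_id.cpow analyticAt_const (Or.inl hr)).mul analyticAt_const
  have hlim : Tendsto (fun x : ℝ ↦ (x : ℂ)) (𝓝[>] 1) (𝓝[≠] (1 : ℂ)) := by
    refine tendsto_nhdsWithin_iff.2 ⟨?_, ?_⟩
    · simpa using (Complex.continuous_ofReal.tendsto 1).mono_left nhdsWithin_le_nhds
    · filter_upwards [self_mem_nhdsWithin] with x hx
      simpa using (Set.mem_Ioi.1 hx).ne'
  have hfreq : ∃ᶠ r : ℂ in 𝓝[≠] (1 : ℂ),
      ∫ t in Set.Ioi (0 : ℝ), ((t ^ s : ℝ) : ℂ) * Complex.exp (-(r * t)) =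
        r ^ (-((s : ℂ) + 1)) * Real.Gamma (s + 1) := by
    refine hlim.frequently (Eventually.frequently ?_)
    filter_upwards [self_mem_nhdsWithin] with x hx
    exact integral_rpow_mul_exp_ofReal hs (zero_lt_one.trans hx)
  exact (analyticOnNhd_integral_rpow_mul_exp hs).eqOn_of_preconnected_of_frequently_eq hpow
    hconv.isPreconnected (by simp) hfreq hr

/-- The contribution of the ray with direction `e` to Hankel's loop integral of
`(-ζ) ^ s * exp (-d ζ)`. -/
noncomputable def rayIntegral (s d : ℝ) (e : ℂ) : ℂ :=
  ∫ t in Set.Ioi (0 : ℝ), e * ((-e) ^ (s : ℂ) * ((t ^ s : ℝ) : ℂ)) * Complex.exp (-((d * e) * t))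

theorem exp_mul_I_cpow {x : ℝ} (hx : x ∈ Set.Ioc (-Real.pi) Real.pi) (y : ℂ) :
    Complex.exp (x * Complex.I) ^ y = Complex.exp (x * Complex.I * y) := by
  rw [Complex.cpow_def_of_ne_zero (Complex.exp_ne_zero _),
    Complex.log_exp (by simpa using hx.1) (by simpa using hx.2)]

theorem ofReal_mul_cpow {d : ℝ} (hd : 0 < d) {z : ℂ} (hz : z ≠ 0) (y : ℂ) :
    ((d : ℂ) * z) ^ y = (d : ℂ) ^ y * z ^ y := by
  have hd' : (d : ℂ) ≠ 0 := by exact_mod_cast hd.ne'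
  rw [Complex.cpow_def_of_ne_zero (mul_ne_zero hd' hz), Complex.cpow_def_of_ne_zero hd',
    Complex.cpow_def_of_ne_zero hz, Complex.log_ofReal_mul hd hz, Complex.ofReal_log hd.le,
    add_mul, Complex.exp_add]

theorem rayIntegral_exp {s d ψ ω : ℝ} (hs : -1 < s) (hd : 0 < d) (hψ : |ψ| < Real.pi / 2)
    (hω : ω ∈ Set.Ioc (-Real.pi) Real.pi)
    (hψω : -Complex.exp (ψ * Complex.I) = Complex.exp (ω * Complex.I)) :
    rayIntegral s d (Complex.exp (ψ * Complex.I)) =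
      Complex.exp (s * (ω - ψ) * Complex.I) * ((d ^ (-s - 1) : ℝ) : ℂ) * Real.Gamma (s + 1) := by
  have hcos : 0 < Real.cos ψ := Real.cos_pos_of_mem_Ioo (abs_lt.1 hψ)
  have hre : 0 < ((d : ℂ) * Complex.exp (ψ * Complex.I)).re := by
    rw [Complex.re_ofReal_mul, Complex.exp_ofReal_mul_I_re]
    positivity
  have hψ' : ψ ∈ Set.Ioc (-Real.pi) Real.pi := by
    obtain ⟨h₁, h₂⟩ := abs_lt.1 hψ
    constructor <;> linarith [Real.pi_pos]
  have hphase : Complex.exp (s * (ω - ψ) * Complex.I) = Complex.exp (ψ * Complex.I) *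
      Complex.exp (ω * Complex.I * s) * Complex.exp (ψ * Complex.I * -((s : ℂ) + 1)) := by
    rw [← Complex.exp_add, ← Complex.exp_add]
    ring_nf
  simp only [rayIntegral, ← mul_assoc (Complex.exp (ψ * Complex.I)), mul_assoc _ (Complex.ofReal _)]
  rw [integral_const_mul, integral_rpow_mul_exp hs hre, hψω, exp_mul_I_cpow hω,
    ofReal_mul_cpow hd (Complex.exp_ne_zero _), exp_mul_I_cpow hψ', hphase,
    Complex.ofReal_cpow hd.le]
  push_cast
  ring_nf

theorem inv_Gamma_neg {s : ℝ} (hs : -1 < s) :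
    (Real.Gamma (-s))⁻¹ = -Real.sin (Real.pi * s) * Real.Gamma (s + 1) / Real.pi := by
  have hreflect := Real.Gamma_mul_Gamma_one_sub (-s)
  have hpos : Real.Gamma (s + 1) ≠ 0 := (Real.Gamma_pos_of_pos (by linarith)).ne'
  rw [sub_neg_eq_add, add_comm 1 s, mul_neg, Real.sin_neg] at hreflect
  rw [(eq_div_iff hpos).2 hreflect]
  rcases eq_or_ne (Real.sin (Real.pi * s)) 0 with hsin | hsin
  · simp [hsin]
  · field_simp

/-- Hankel's formula for `1 / Γ`. At the poles of `Γ` both sides vanish, since `Γ` is `0` there in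
Mathlib. -/
theorem rayIntegral_sub {s d ψ : ℝ} (hs : -1 < s) (hd : 0 < d) (hψ0 : 0 < ψ)
    (hψ : ψ < Real.pi / 2) :
    rayIntegral s d (Complex.exp (ψ * Complex.I)) -
      rayIntegral s d (Complex.exp ((-ψ : ℝ) * Complex.I)) =
      2 * Real.pi * Complex.I * ((d ^ (-s - 1) / Real.Gamma (-s) : ℝ) : ℂ) := by
  have hpi := Real.pi_pos
  have hupper : -Complex.exp (ψ * Complex.I) = Complex.exp ((ψ - Real.pi : ℝ) * Complex.I) := by
    push_cast
    rw [sub_mul, Complex.exp_sub, Complex.exp_pi_mul_I, div_neg, div_one]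
  have hlower : -Complex.exp ((-ψ : ℝ) * Complex.I) =
      Complex.exp ((-ψ + Real.pi : ℝ) * Complex.I) := by
    push_cast
    rw [add_mul, Complex.exp_add, Complex.exp_pi_mul_I, mul_neg_one]
  have hsin : Complex.exp (s * ((ψ - Real.pi : ℝ) - ψ) * Complex.I) -
      Complex.exp (s * ((-ψ + Real.pi : ℝ) - (-ψ : ℝ)) * Complex.I) =
      -2 * Complex.I * Complex.sin (Real.pi * s) := by
    rw [Complex.sin]
    push_cast
    ring_nf
    rw [Complex.I_sq]
    ring
  rw [rayIntegral_exp hs hd (by rwa [abs_of_pos hψ0]) ⟨by linarith, by linarith⟩ hupper,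
    rayIntegral_exp hs hd (by rwa [abs_neg, abs_of_pos hψ0]) ⟨by linarith, by linarith⟩ hlower,
    ← sub_mul, ← sub_mul, hsin, div_eq_mul_inv, inv_Gamma_neg hs]
  have hpi' : (Real.pi : ℂ) ≠ 0 := by exact_mod_cast hpi.ne'
  push_cast
  field_simp

end HankelRay

section Kernel

variable {f p T G Q : ℂ → ℂ} {b ζ : ℂ} {N : ℕ} {v v₂ M : ℝ}

/-- The integrand `f e^{v (T - T(0))} e^{N (v (G - b) - ζ)}` of the coefficient integral in the
coordinate `z = R e^ζ`, normalised at the singular point `ζ = 0`. -/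
noncomputable def kern (f T G : ℂ → ℂ) (b : ℂ) (N : ℕ) (v : ℝ) (ζ : ℂ) : ℂ :=
  f ζ * Complex.exp (v * (T ζ - T 0)) * Complex.exp (N * (v * (G ζ - b) - ζ))

theorem kern_sub (f p T G Q : ℂ → ℂ) (b : ℂ) (N : ℕ) (v : ℝ) (ζ : ℂ) :
    kern f T G b N v ζ - kern p T Q b N v ζ =
      Complex.exp (v * (T ζ - T 0)) * Complex.exp (N * (v * (Q ζ - b) - ζ)) *
        ((f ζ - p ζ) * Complex.exp (N * (v * (G ζ - Q ζ))) +
          p ζ * (Complex.exp (N * (v * (G ζ - Q ζ))) - 1)) := by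
  have hsplit : Complex.exp (N * (v * (G ζ - b) - ζ)) =
      Complex.exp (N * (v * (Q ζ - b) - ζ)) * Complex.exp (N * (v * (G ζ - Q ζ))) := by
    rw [← Complex.exp_add]
    ring_nf
  rw [kern, kern, hsplit]
  ring

theorem kern_periodic {w : ℂ} (hf : Function.Periodic f w) (hT : Function.Periodic T w)
    (hG : Function.Periodic G w) (hw : Complex.exp w = 1) (b : ℂ) (N : ℕ) (v : ℝ) :
    Function.Periodic (kern f T G b N v) w := by
  intro ζ
  have hexp : Complex.exp (N * (v * (G ζ - b) - (ζ + w))) =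
      Complex.exp (N * (v * (G ζ - b) - ζ)) := by
    rw [show (N : ℂ) * (v * (G ζ - b) - (ζ + w)) = N * (v * (G ζ - b) - ζ) - N * w by ring,
      Complex.exp_sub, Complex.exp_nat_mul w, hw, one_pow, div_one]
  simp only [kern, hf ζ, hT ζ, hG ζ, hexp]

theorem differentiableOn_kern {D : Set ℂ} (hf : DifferentiableOn ℂ f D)
    (hT : DifferentiableOn ℂ T D) (hG : DifferentiableOn ℂ G D) (b : ℂ) (N : ℕ) (v : ℝ) :
    DifferentiableOn ℂ (kern f T G b N v) D :=
  (hf.mul ((hT.sub_const _).const_mul _).cexp).mul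
    ((((hG.sub_const _).const_mul _).sub differentiableOn_id).const_mul _).cexp

theorem norm_exp_ofReal_mul_le (hv : v ∈ Set.Icc 0 v₂) {w : ℂ} (hw : ‖w‖ ≤ M) :
    ‖Complex.exp (v * w)‖ ≤ Real.exp (v₂ * M) := by
  refine (Complex.norm_exp_le_exp_norm _).trans (Real.exp_le_exp.2 ?_)
  rw [norm_mul, Complex.norm_real, Real.norm_of_nonneg hv.1]
  exact mul_le_mul hv.2 hw (norm_nonneg _) (hv.1.trans hv.2)

theorem norm_kern_le {B c : ℝ} (hv : v ∈ Set.Icc 0 v₂) (hf : ‖f ζ‖ ≤ B) (hT : ‖T ζ - T 0‖ ≤ M)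
    (hc : (v * (G ζ - b) - ζ).re ≤ c) :
    ‖kern f T G b N v ζ‖ ≤ B * Real.exp (v₂ * M) * Real.exp (N * c) := by
  have hre : (N * (v * (G ζ - b) - ζ)).re = N * (v * (G ζ - b) - ζ).re := by
    rw [← Complex.ofReal_natCast, Complex.re_ofReal_mul]
  have hexp : ‖Complex.exp (N * (v * (G ζ - b) - ζ))‖ ≤ Real.exp (N * c) := by
    rw [Complex.norm_exp, hre]
    gcongr
  rw [kern, norm_mul, norm_mul]
  exact mul_le_mul (mul_le_mul hf (norm_exp_ofReal_mul_le hv hT) (norm_nonneg _)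
    ((norm_nonneg _).trans hf)) hexp (norm_nonneg _)
    (mul_nonneg ((norm_nonneg _).trans hf) (Real.exp_pos _).le)

theorem norm_exp_sub_one_le_norm_mul_exp (z : ℂ) :
    ‖Complex.exp z - 1‖ ≤ ‖z‖ * Real.exp ‖z‖ := by
  simpa using Complex.norm_exp_sub_sum_le_norm_mul_exp z 1

theorem norm_kern_sub_le (hv : v ∈ Set.Icc 0 v₂) (hT : ‖T ζ - T 0‖ ≤ M) :
    ‖kern f T G b N v ζ - kern p T Q b N v ζ‖ ≤
      Real.exp (v₂ * M) * (‖f ζ - p ζ‖ + ‖p ζ‖ * (N * (v₂ * ‖G ζ - Q ζ‖))) *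
        Real.exp (N * ((v * (Q ζ - b) - ζ).re + v * ‖G ζ - Q ζ‖)) := by
  set E := (N : ℂ) * (v * (G ζ - Q ζ)) with hE
  have hnE : ‖E‖ = N * (v * ‖G ζ - Q ζ‖) := by
    rw [hE, norm_mul, norm_mul, Complex.norm_natCast, Complex.norm_real, Real.norm_of_nonneg hv.1]
  have hexpE : ‖Complex.exp E‖ ≤ Real.exp ‖E‖ := Complex.norm_exp_le_exp_norm _
  have hexpE_sub : ‖Complex.exp E - 1‖ ≤ N * (v₂ * ‖G ζ - Q ζ‖) * Real.exp ‖E‖ := by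
    refine (norm_exp_sub_one_le_norm_mul_exp E).trans ?_
    rw [hnE]
    gcongr
    exact hv.2
  have hbracket : ‖(f ζ - p ζ) * Complex.exp E + p ζ * (Complex.exp E - 1)‖ ≤
      (‖f ζ - p ζ‖ + ‖p ζ‖ * (N * (v₂ * ‖G ζ - Q ζ‖))) * Real.exp ‖E‖ := by
    refine (norm_add_le _ _).trans ?_
    rw [norm_mul, norm_mul, add_mul, mul_assoc ‖p ζ‖]
    gcongr
  have hre : (N * (v * (Q ζ - b) - ζ)).re = N * (v * (Q ζ - b) - ζ).re := by
    rw [← Complex.ofReal_natCast, Complex.re_ofReal_mul]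
  rw [kern_sub, norm_mul, norm_mul, Complex.norm_exp (N * _), hre]
  calc _ ≤ Real.exp (v₂ * M) * Real.exp (N * (v * (Q ζ - b) - ζ).re) *
        ((‖f ζ - p ζ‖ + ‖p ζ‖ * (N * (v₂ * ‖G ζ - Q ζ‖))) * Real.exp ‖E‖) := by
        gcongr
        exact norm_exp_ofReal_mul_le hv hT
    _ = _ := by
        rw [hnE, mul_add (N : ℝ) _ (v * _), Real.exp_add]
        ring

end Kernel

section Rescaling

variable {ι : Type*} {l : Filter ι} {N : ι → ℕ} {v : ι → ℝ} {vs q : ℝ}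

theorem tendsto_rpow_mul_of_norm_le_exp {X : ι → ℂ} {C κ : ℝ} (hN : Tendsto N l atTop)
    (hκ : 0 < κ) (hX : ∀ᶠ i in l, ‖X i‖ ≤ C * Real.exp (-(κ * N i))) (q : ℝ) :
    Tendsto (fun i ↦ (((N i : ℝ) ^ q : ℝ) : ℂ) * X i) l (𝓝 0) := by
  have hdecay := ((tendsto_rpow_mul_exp_neg_mul_atTop_nhds_zero q κ hκ).comp
    (tendsto_natCast_atTop_atTop.comp hN)).const_mul C
  rw [mul_zero] at hdecay
  refine squeeze_zero_norm' ?_ hdecay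
  filter_upwards [hX] with i hi
  rw [norm_mul, Complex.norm_real, Real.norm_of_nonneg (by positivity)]
  calc (N i : ℝ) ^ q * ‖X i‖ ≤ (N i : ℝ) ^ q * (C * Real.exp (-(κ * N i))) := by gcongr
    _ = _ := by simp only [Function.comp_apply]; ring_nf

theorem tendsto_div_natCast_nhdsGT (hN : Tendsto N l atTop) {t : ℝ} (ht : 0 < t) :
    Tendsto (fun i ↦ t / (N i : ℝ)) l (𝓝[>] 0) := by
  refine tendsto_nhdsWithin_iff.2 ⟨?_, ?_⟩
  · exact (tendsto_natCast_atTop_atTop.comp hN).const_div_atTop t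
  · filter_upwards [hN.eventually_gt_atTop 0] with i hi
    have : (0 : ℝ) < N i := by exact_mod_cast hi
    exact div_pos ht this

theorem tendsto_rpow_mul_of_tendsto_div {g : ℝ → ℂ} {r : ℝ} {A : ℂ} (hN : Tendsto N l atTop)
    (hg : Tendsto (fun t : ℝ ↦ g t / ((t ^ r : ℝ) : ℂ)) (𝓝[>] 0) (𝓝 A)) {t : ℝ} (ht : 0 < t) :
    Tendsto (fun i ↦ (((N i : ℝ) ^ r : ℝ) : ℂ) * g (t / N i)) l (𝓝 (A * ((t ^ r : ℝ) : ℂ))) := by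
  refine ((hg.comp (tendsto_div_natCast_nhdsGT hN ht)).mul_const ((t ^ r : ℝ) : ℂ)).congr' ?_
  filter_upwards [hN.eventually_gt_atTop 0] with i hi
  have hNi : (0 : ℝ) < N i := by exact_mod_cast hi
  have hNr : (((N i : ℝ) ^ r : ℝ) : ℂ) ≠ 0 := by exact_mod_cast (Real.rpow_pos_of_pos hNi r).ne'
  have htr : ((t ^ r : ℝ) : ℂ) ≠ 0 := by exact_mod_cast (Real.rpow_pos_of_pos ht r).ne'
  simp only [Function.comp_apply, Real.div_rpow ht.le hNi.le, Complex.ofReal_div]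
  field_simp

theorem tendsto_natCast_mul_sub {Q : ℂ → ℂ} {b : ℂ} (hN : Tendsto N l atTop)
    (hQ : HasDerivAt Q b 0) (w : ℂ) :
    Tendsto (fun i ↦ (N i : ℂ) * (Q (w / N i) - Q 0)) l (𝓝 (b * w)) := by
  have hNinf : Tendsto (fun i ↦ ‖(N i : ℂ)‖) l atTop := by
    simpa [Function.comp_def] using tendsto_natCast_atTop_atTop.comp hN
  simpa [mul_comm w, div_eq_inv_mul] using hQ.hasFDerivAt.lim w hNinf

theorem rpow_sub_one_mul_natCast {n : ℕ} (hn : 0 < n) (q : ℝ) :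
    (((n : ℝ) ^ (q - 1) : ℝ) : ℂ) * n = (((n : ℝ) ^ q : ℝ) : ℂ) := by
  have hn' : (0 : ℝ) < n := by exact_mod_cast hn
  rw [← Complex.ofReal_natCast, ← Complex.ofReal_mul, Real.rpow_sub_one hn'.ne']
  field_simp

theorem tendsto_natCast_mul_of_tendsto_rpow_mul {X : ι → ℂ} {A : ℂ} (hN : Tendsto N l atTop)
    (hq : 1 < q) (hX : Tendsto (fun i ↦ (((N i : ℝ) ^ q : ℝ) : ℂ) * X i) l (𝓝 A)) :
    Tendsto (fun i ↦ (N i : ℂ) * X i) l (𝓝 0) := by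
  have hdecay : Tendsto (fun i ↦ (((N i : ℝ) ^ (-(q - 1)) : ℝ) : ℂ)) l (𝓝 0) := by
    have := (tendsto_rpow_neg_atTop (sub_pos.2 hq)).comp (tendsto_natCast_atTop_atTop.comp hN)
    simpa [Function.comp_def] using (Complex.continuous_ofReal.tendsto 0).comp this
  have hprod := hdecay.mul hX
  rw [zero_mul] at hprod
  refine hprod.congr' ?_
  filter_upwards [hN.eventually_gt_atTop 0] with i hi
  have hNi : (0 : ℝ) < N i := by exact_mod_cast hi
  rw [← mul_assoc, ← Complex.ofReal_mul, ← Real.rpow_add hNi]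
  simp

theorem tendsto_mul_exp_sub_one {A w : ι → ℂ} {a : ℂ} (hw : Tendsto w l (𝓝 0))
    (hA : Tendsto (fun i ↦ A i * w i) l (𝓝 a)) :
    Tendsto (fun i ↦ A i * (Complex.exp (w i) - 1)) l (𝓝 a) := by
  have hslope := (continuousAt_dslope_same.2
    (Complex.differentiableAt_exp (x := 0))).tendsto.comp hw
  rw [dslope_same, Complex.deriv_exp, Complex.exp_zero] at hslope
  have hprod := hA.mul hslope
  rw [mul_one] at hprod
  refine hprod.congr fun i ↦ ?_
  have h := sub_smul_dslope Complex.exp 0 (w i)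
  rw [sub_zero, smul_eq_mul, Complex.exp_zero] at h
  rw [Function.comp_apply, ← h, mul_assoc]

theorem tendsto_rpow_mul_kern_sub {f p T G Q : ℂ → ℂ} {b p₀ z B C A : ℂ} {ζ : ι → ℂ}
    (hN : Tendsto N l atTop) (hv : Tendsto v l (𝓝 vs)) (hq : 1 < q)
    (hz : Tendsto (fun i ↦ (N i : ℂ) * ζ i) l (𝓝 z))
    (hp : Tendsto (fun i ↦ p (ζ i)) l (𝓝 p₀)) (hT : Tendsto (fun i ↦ T (ζ i)) l (𝓝 (T 0)))
    (hQ : Tendsto (fun i ↦ (N i : ℂ) * (Q (ζ i) - b)) l (𝓝 B))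
    (hfp : Tendsto (fun i ↦ (((N i : ℝ) ^ (q - 1) : ℝ) : ℂ) * (f (ζ i) - p (ζ i))) l (𝓝 C))
    (hGQ : Tendsto (fun i ↦ (((N i : ℝ) ^ q : ℝ) : ℂ) * (G (ζ i) - Q (ζ i))) l (𝓝 A)) :
    Tendsto (fun i ↦ (((N i : ℝ) ^ (q - 1) : ℝ) : ℂ) *
        (kern f T G b (N i) (v i) (ζ i) - kern p T Q b (N i) (v i) (ζ i))) l
      (𝓝 (Complex.exp (vs * B - z) * (C + p₀ * (vs * A)))) := by
  have hvC : Tendsto (fun i ↦ (v i : ℂ)) l (𝓝 vs) :=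
    (Complex.continuous_ofReal.tendsto vs).comp hv
  have hexpT : Tendsto (fun i ↦ Complex.exp (v i * (T (ζ i) - T 0))) l (𝓝 1) := by
    simpa using (hvC.mul (hT.sub_const (T 0))).cexp
  have hexpQ : Tendsto (fun i ↦ Complex.exp (N i * (v i * (Q (ζ i) - b) - ζ i))) l
      (𝓝 (Complex.exp (vs * B - z))) :=
    ((hvC.mul hQ).sub hz).cexp.congr fun i ↦ by ring_nf
  have hsmall : Tendsto (fun i ↦ (N i : ℂ) * (v i * (G (ζ i) - Q (ζ i)))) l (𝓝 0) := by
    have h := hvC.mul (tendsto_natCast_mul_of_tendsto_rpow_mul hN hq hGQ)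
    rw [mul_zero] at h
    exact h.congr fun i ↦ by ring
  have hexpE : Tendsto (fun i ↦ Complex.exp (N i * (v i * (G (ζ i) - Q (ζ i))))) l (𝓝 1) := by
    simpa using hsmall.cexp
  have hexpE_sub : Tendsto (fun i ↦ (((N i : ℝ) ^ (q - 1) : ℝ) : ℂ) *
      (Complex.exp (N i * (v i * (G (ζ i) - Q (ζ i)))) - 1)) l (𝓝 (vs * A)) := by
    refine tendsto_mul_exp_sub_one hsmall ((hvC.mul hGQ).congr' ?_)
    filter_upwards [hN.eventually_gt_atTop 0] with i hi
    linear_combination -(v i * (G (ζ i) - Q (ζ i))) * rpow_sub_one_mul_natCast hi q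
  have hprod := (hexpT.mul hexpQ).mul ((hfp.mul hexpE).add (hp.mul hexpE_sub))
  rw [one_mul, mul_one] at hprod
  refine hprod.congr fun i ↦ ?_
  rw [kern_sub]
  ring

end Rescaling

section RescaledSegment

theorem rpow_mul_segmentIntegral (h : ℂ → ℂ) (e : ℂ) {L : ℝ} (hL : 0 < L) (q : ℝ) {N : ℕ}
    (hN : 0 < N) :
    (((N : ℝ) ^ q : ℝ) : ℂ) * segmentIntegral h 0 (L * e) =
      ∫ t in Set.Ioi (0 : ℝ), (Set.Ioc 0 (L * N)).indicator
        (fun t : ℝ ↦ (((N : ℝ) ^ (q - 1) : ℝ) : ℂ) * h (((t / N : ℝ) : ℂ) * e) * e) t := by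
  have hsubst := intervalIntegral.smul_integral_comp_mul_left (a := 0) (b := 1)
    (fun t : ℝ ↦ (((N : ℝ) ^ (q - 1) : ℝ) : ℂ) * h (((t / N : ℝ) : ℂ) * e) * e) (L * N)
  rw [mul_zero, mul_one, intervalIntegral.integral_of_le (by positivity : 0 ≤ L * N)] at hsubst
  rw [setIntegral_indicator measurableSet_Ioc, Set.inter_eq_self_of_subset_right
    Set.Ioc_subset_Ioi_self, ← hsubst, segmentIntegral, ← intervalIntegral.integral_const_mul,
    ← intervalIntegral.integral_smul]
  congr 1
  ext t
  have hpoint : (0 : ℂ) + t * (L * e - 0) = ((L * N * t / N : ℝ) : ℂ) * e := by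
    rw [show L * N * t / N = L * t by field_simp [hN.ne']]
    push_cast
    ring
  rw [hpoint, Complex.real_smul, ← rpow_sub_one_mul_natCast hN q]
  push_cast
  ring

variable {ι : Type*} {l : Filter ι} {N : ι → ℕ} {L q : ℝ} {e : ℂ} {h : ι → ℂ → ℂ} {H : ℝ → ℂ}
  {bound : ℝ → ℝ}

theorem tendsto_rpow_mul_segmentIntegral [l.IsCountablyGenerated] (hN : Tendsto N l atTop)
    (hL : 0 < L) (hcont : ∀ᶠ i in l, ContinuousOn (fun t : ℝ ↦ h i (t * e)) (Set.Ioc 0 L))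
    (hbound : ∀ᶠ i in l, ∀ x ∈ Set.Ioc 0 L,
      ‖(((N i : ℝ) ^ (q - 1) : ℝ) : ℂ) * h i (x * e) * e‖ ≤ bound (N i * x))
    (hint : IntegrableOn bound (Set.Ioi 0)) (hnonneg : ∀ t, 0 < t → 0 ≤ bound t)
    (hlim : ∀ t : ℝ, 0 < t → Tendsto
      (fun i ↦ (((N i : ℝ) ^ (q - 1) : ℝ) : ℂ) * h i (((t / N i : ℝ) : ℂ) * e) * e) l
      (𝓝 (H t))) :
    Tendsto (fun i ↦ (((N i : ℝ) ^ q : ℝ) : ℂ) * segmentIntegral (h i) 0 (L * e)) l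
      (𝓝 (∫ t in Set.Ioi (0 : ℝ), H t)) := by
  have hrescaled : ∀ᶠ i in l, ∀ t, t ∈ Set.Ioc 0 (L * N i) →
      t / (N i : ℝ) ∈ Set.Ioc 0 L ∧ (N i : ℝ) * (t / N i) = t := by
    filter_upwards [hN.eventually_gt_atTop 0] with i hi t ht
    have hNi : (0 : ℝ) < N i := by exact_mod_cast hi
    exact ⟨⟨div_pos ht.1 hNi, (div_le_iff₀ hNi).2 ht.2⟩, mul_div_cancel₀ _ hNi.ne'⟩
  refine (tendsto_integral_filter_of_dominated_convergence (μ := volume.restrict (Set.Ioi 0))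
    (F := fun i ↦ (Set.Ioc 0 (L * N i)).indicator fun t : ℝ ↦
      (((N i : ℝ) ^ (q - 1) : ℝ) : ℂ) * h i (((t / N i : ℝ) : ℂ) * e) * e)
    bound ?_ ?_ hint ?_).congr' ?_
  · filter_upwards [hcont, hrescaled] with i hci hri
    have hmaps : Set.MapsTo (fun t : ℝ ↦ t / (N i : ℝ)) (Set.Ioc 0 (L * N i)) (Set.Ioc 0 L) :=
      fun t ht ↦ (hri t ht).1
    have hcomp := ((continuousOn_const (c := (((N i : ℝ) ^ (q - 1) : ℝ) : ℂ))).mul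
      (hci.comp (by fun_prop) hmaps)).mul (continuousOn_const (c := e))
    exact (aestronglyMeasurable_indicator_iff measurableSet_Ioc).2
      ((hcomp.aestronglyMeasurable (μ := volume) measurableSet_Ioc).mono_measure
        (Measure.restrict_mono le_rfl Measure.restrict_le_self))
  · filter_upwards [hbound, hrescaled] with i hbi hri
    refine (ae_restrict_iff' measurableSet_Ioi).2 (ae_of_all _ fun t ht ↦ ?_)
    by_cases htL : t ∈ Set.Ioc 0 (L * N i)
    · obtain ⟨hmem, hmul⟩ := hri t htL
      simpa only [Set.indicator_of_mem htL, hmul] using hbi _ hmem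
    · simpa only [Set.indicator_of_notMem htL, norm_zero] using hnonneg t ht
  · refine (ae_restrict_iff' measurableSet_Ioi).2 (ae_of_all _ fun t ht ↦ ?_)
    refine (hlim t ht).congr' ?_
    have hbig : Tendsto (fun i ↦ L * (N i : ℝ)) l atTop :=
      (tendsto_natCast_atTop_atTop.comp hN).const_mul_atTop hL
    filter_upwards [hbig.eventually_ge_atTop t] with i hi
    rw [Set.indicator_of_mem (show t ∈ Set.Ioc 0 (L * (N i : ℝ)) from ⟨ht, hi⟩)]
  · filter_upwards [hN.eventually_gt_atTop 0] with i hi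
    rw [rpow_mul_segmentIntegral _ e hL q hi]

theorem integrableOn_ray {s d : ℝ} (hs : -1 < s) (hd : 0 < d) (he : 0 < e.re) :
    IntegrableOn (fun t : ℝ ↦ e * ((-e) ^ (s : ℂ) * ((t ^ s : ℝ) : ℂ)) *
      Complex.exp (-((d * e) * t))) (Set.Ioi 0) := by
  have hre : 0 < ((d : ℂ) * e).re := by
    rw [Complex.re_ofReal_mul]
    positivity
  have hpow : IntegrableOn (fun t : ℝ ↦ ((t ^ s : ℝ) : ℂ) * Complex.exp (-((d * e) * t)))
      (Set.Ioi 0) := by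
    refine Integrable.mono' (integrableOn_rpow_mul_exp hs hre)
      ((continuousOn_rpow_mul_exp s _).aestronglyMeasurable measurableSet_Ioi) ?_
    refine (ae_restrict_iff' measurableSet_Ioi).2 (ae_of_all _ fun t ht ↦ ?_)
    rw [norm_mul, Complex.norm_real, Real.norm_of_nonneg (Real.rpow_nonneg (le_of_lt ht) s),
      Complex.norm_exp]
    simp
  refine (hpow.const_mul (e * (-e) ^ (s : ℂ))).congr (ae_of_all _ fun t ↦ ?_)
  ring

end RescaledSegment

/-- The open sector of all `ζ ≠ 0` with `φ < |arg ζ|`, for `0 < φ < π / 2`. It is described by its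
cosine, which avoids the branch cut of the argument. -/
def wedge (φ : ℝ) : Set ℂ := {ζ | ζ.re < ‖ζ‖ * Real.cos φ}

section Wedge

variable {φ ψ : ℝ} {ζ : ℂ}

theorem norm_pos_of_mem_wedge (hζ : ζ ∈ wedge φ) : 0 < ‖ζ‖ := by
  refine norm_pos_iff.2 fun h ↦ ?_
  simp [wedge, h] at hζ

theorem mem_wedge_of_re_neg (hφ : 0 ≤ Real.cos φ) (hζ : ζ.re < 0) : ζ ∈ wedge φ :=
  hζ.trans_le (mul_nonneg (norm_nonneg ζ) hφ)

theorem mem_wedge_of_re_le_norm_mul_cos (hψ : Real.cos ψ < Real.cos φ) (hζ₀ : ζ ≠ 0)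
    (hζ : ζ.re ≤ ‖ζ‖ * Real.cos ψ) : ζ ∈ wedge φ :=
  hζ.trans_lt (mul_lt_mul_of_pos_left hψ (norm_pos_iff.2 hζ₀))

theorem re_le_norm_mul_cos (hψ : 0 < ψ) (hψ' : ψ < Real.pi / 2)
    (h : ζ.re * Real.sin ψ ≤ |ζ.im| * Real.cos ψ) : ζ.re ≤ ‖ζ‖ * Real.cos ψ := by
  have hcos : 0 < Real.cos ψ := Real.cos_pos_of_mem_Ioo ⟨by linarith, hψ'⟩
  have hsin : 0 < Real.sin ψ := Real.sin_pos_of_pos_of_lt_pi hψ (by linarith [Real.pi_pos])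
  rcases lt_or_ge ζ.re 0 with hre | hre
  · exact hre.le.trans (by positivity)
  · refine le_of_sq_le_sq ?_ (by positivity)
    have hsq : (ζ.re * Real.sin ψ) ^ 2 ≤ (|ζ.im| * Real.cos ψ) ^ 2 := by gcongr
    rw [mul_pow, mul_pow, sq_abs] at hsq
    rw [mul_pow, Complex.sq_norm, Complex.normSq_apply]
    nlinarith [Real.sin_sq_add_cos_sq ψ]

theorem mem_wedge_of_re_mul_sin_lt (hφ : 0 < φ) (hφ' : φ < Real.pi / 2)
    (h : ζ.re * Real.sin φ < |ζ.im| * Real.cos φ) : ζ ∈ wedge φ := by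
  have hcos : 0 < Real.cos φ := Real.cos_pos_of_mem_Ioo ⟨by linarith, hφ'⟩
  rcases lt_or_ge ζ.re 0 with hre | hre
  · exact mem_wedge_of_re_neg hcos.le hre
  · have hsin : 0 < Real.sin φ := Real.sin_pos_of_pos_of_lt_pi hφ (by linarith [Real.pi_pos])
    rw [wedge, Set.mem_ofPred_eq]
    refine lt_of_pow_lt_pow_left₀ 2 (by positivity) ?_
    have hsq : (ζ.re * Real.sin φ) ^ 2 < (|ζ.im| * Real.cos φ) ^ 2 := by gcongr
    rw [mul_pow, mul_pow, sq_abs] at hsq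
    rw [mul_pow, Complex.sq_norm, Complex.normSq_apply]
    nlinarith [Real.sin_sq_add_cos_sq φ]

theorem ofReal_mul_mem_wedge {t : ℝ} (ht : 0 < t) (hζ : ζ ∈ wedge φ) : t * ζ ∈ wedge φ := by
  rw [wedge, Set.mem_ofPred_eq, Complex.re_ofReal_mul, norm_mul, Complex.norm_real,
    Real.norm_of_nonneg ht.le, mul_assoc]
  exact mul_lt_mul_of_pos_left hζ ht

theorem closedBall_subset_wedge {k : ℝ} (hψ : 0 ≤ Real.cos ψ) (hk : 0 < k)
    (hkφ : Real.cos ψ + 3 * k ≤ Real.cos φ) (hζ₀ : ζ ≠ 0) (hζ : ζ.re ≤ ‖ζ‖ * Real.cos ψ) :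
    Metric.closedBall ζ (k * ‖ζ‖) ⊆ wedge φ := by
  intro w hw
  rw [Metric.mem_closedBall, dist_eq_norm] at hw
  have hnorm : ‖ζ‖ - k * ‖ζ‖ ≤ ‖w‖ := by
    linarith [norm_sub_norm_le ζ w, norm_sub_rev ζ w]
  have hre : w.re ≤ ζ.re + k * ‖ζ‖ := by
    have := (Complex.re_le_norm (w - ζ)).trans hw
    rw [Complex.sub_re] at this
    linarith
  have hcos : (‖ζ‖ - k * ‖ζ‖) * Real.cos φ ≤ ‖w‖ * Real.cos φ :=
    mul_le_mul_of_nonneg_right hnorm (by linarith)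
  have hpos : 0 < k * ‖ζ‖ := mul_pos hk (norm_pos_iff.2 hζ₀)
  rw [wedge, Set.mem_ofPred_eq]
  nlinarith [Real.cos_le_one φ, mul_le_mul_of_nonneg_left hkφ (norm_nonneg ζ)]

end Wedge

section RayExpansion

theorem isLittleO_norm_rpow {α : Type*} {l : Filter α} {u : α → ℂ} (hu : Tendsto u l (𝓝 0))
    {s t : ℝ} (hs : 0 ≤ s) (hst : s < t) :
    (fun x ↦ ‖u x‖ ^ t) =o[l] fun x ↦ ‖u x‖ ^ s := by
  have hpow : Tendsto (fun x ↦ ‖u x‖ ^ (t - s)) l (𝓝 0) := by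
    have h := hu.norm.rpow_const (p := t - s) (Or.inr (sub_nonneg.2 hst.le))
    rwa [norm_zero, Real.zero_rpow (sub_pos.2 hst).ne'] at h
  refine (((isLittleO_one_iff ℝ).2 hpow).mul_isBigO (isBigO_refl (fun x ↦ ‖u x‖ ^ s) l)).congr
    (fun x ↦ ?_) fun x ↦ one_mul _
  rw [← Real.rpow_add_of_nonneg (norm_nonneg _) (sub_nonneg.2 hst.le) hs, sub_add_cancel]

theorem isBigO_one_sub_exp_cpow {s : ℝ} (hs : 0 ≤ s) :
    (fun ζ ↦ (1 - Complex.exp ζ) ^ (s : ℂ)) =O[𝓝 0] fun ζ : ℂ ↦ ‖ζ‖ ^ s := by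
  refine IsBigO.of_bound (2 ^ s) ?_
  filter_upwards [Metric.closedBall_mem_nhds (0 : ℂ) one_pos] with ζ hζ
  rw [mem_closedBall_zero_iff] at hζ
  rw [Complex.norm_cpow_real, norm_sub_rev, Real.norm_of_nonneg (by positivity),
    ← Real.mul_rpow (by norm_num) (norm_nonneg _)]
  gcongr
  exact Complex.norm_exp_sub_one_le hζ

theorem tendsto_ofReal_mul_zero (e : ℂ) :
    Tendsto (fun t : ℝ ↦ (t : ℂ) * e) (𝓝[>] 0) (𝓝 0) := by
  have hcont : Continuous fun t : ℝ ↦ (t : ℂ) * e := by fun_prop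
  have h := hcont.tendsto 0
  simp only [Complex.ofReal_zero, zero_mul] at h
  exact h.mono_left nhdsWithin_le_nhds

theorem tendsto_one_sub_exp_cpow_ray {e : ℂ} (he : -e ∈ Complex.slitPlane) (s : ℝ) :
    Tendsto (fun t : ℝ ↦ (1 - Complex.exp (t * e)) ^ (s : ℂ) / ((t ^ s : ℝ) : ℂ)) (𝓝[>] 0)
      (𝓝 ((-e) ^ (s : ℂ))) := by
  have hslope : Tendsto (fun t : ℝ ↦ -(dslope Complex.exp 0 (t * e) * e)) (𝓝[>] 0) (𝓝 (-e)) := by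
    have h := (continuousAt_dslope_same.2
      (Complex.differentiableAt_exp (x := 0))).tendsto.comp (tendsto_ofReal_mul_zero e)
    rw [dslope_same, Complex.deriv_exp, Complex.exp_zero] at h
    simpa [Function.comp_def] using (h.mul_const e).neg
  have hpow := (continuousAt_cpow_const he (b := (s : ℂ))).tendsto.comp hslope
  have hne := hslope.eventually_ne (Complex.slitPlane_ne_zero he)
  refine hpow.congr' ?_
  filter_upwards [self_mem_nhdsWithin, hne] with t ht hne
  rw [Set.mem_Ioi] at ht
  have hexp : 1 - Complex.exp (t * e) = t * (-(dslope Complex.exp 0 (t * e) * e)) := by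
    have h := sub_smul_dslope Complex.exp 0 ((t : ℂ) * e)
    rw [sub_zero, smul_eq_mul, Complex.exp_zero] at h
    linear_combination h
  have hts : (t : ℂ) ^ (s : ℂ) ≠ 0 := by
    rw [← Complex.ofReal_cpow ht.le]
    exact_mod_cast (Real.rpow_pos_of_pos ht s).ne'
  rw [Function.comp_apply, hexp, ofReal_mul_cpow ht hne, Complex.ofReal_cpow ht.le,
    mul_div_cancel_left₀ _ hts]

theorem tendsto_ray_of_isLittleO {g : ℂ → ℂ} {φ s : ℝ} {e c : ℂ} (hew : e ∈ wedge φ)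
    (he : -e ∈ Complex.slitPlane)
    (hg : (fun ζ ↦ g ζ - c * (1 - Complex.exp ζ) ^ (s : ℂ)) =o[𝓝[wedge φ] 0] fun ζ ↦ ‖ζ‖ ^ s) :
    Tendsto (fun t : ℝ ↦ g (t * e) / ((t ^ s : ℝ) : ℂ)) (𝓝[>] 0) (𝓝 (c * (-e) ^ (s : ℂ))) := by
  have hray : Tendsto (fun t : ℝ ↦ (t : ℂ) * e) (𝓝[>] 0) (𝓝[wedge φ] 0) := by
    refine tendsto_nhdsWithin_iff.2 ⟨tendsto_ofReal_mul_zero e, ?_⟩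
    filter_upwards [self_mem_nhdsWithin] with t ht using ofReal_mul_mem_wedge ht hew
  have herror : Tendsto (fun t : ℝ ↦ (g (t * e) - c * (1 - Complex.exp (t * e)) ^ (s : ℂ)) /
      ((t ^ s : ℝ) : ℂ)) (𝓝[>] 0) (𝓝 0) := by
    refine IsLittleO.tendsto_div_nhds_zero <|
      (hg.comp_tendsto hray).trans_isBigO (IsBigO.of_bound (‖e‖ ^ s) ?_)
    filter_upwards [self_mem_nhdsWithin] with t ht
    rw [Set.mem_Ioi] at ht
    rw [Function.comp_apply, norm_mul, Complex.norm_real, Complex.norm_real,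
      Real.mul_rpow (norm_nonneg _) (norm_nonneg _), Real.norm_of_nonneg ht.le,
      Real.norm_of_nonneg (by positivity), Real.norm_of_nonneg (by positivity), mul_comm]
  have h := herror.add ((tendsto_one_sub_exp_cpow_ray he s).const_mul c)
  rw [zero_add] at h
  refine h.congr fun t ↦ ?_
  ring

end RayExpansion

/-- Functions `f`, `T`, `G` of the exponential coordinate `ζ` (where `z = R * exp ζ`) with an
algebraic singularity at `ζ = 0`, in the form needed to shift the contour of the coefficient
integral. They are holomorphic on `domain`, which contains the left half-plane, a punctured
neighbourhood of `0` in `wedge φ`, and a full period of the punctured imaginary axis. Up to the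
singular terms `c * (1 - exp ζ) ^ (q - 1)` and `a * (1 - exp ζ) ^ q`, the functions `f` and `G`
agree near `0` with the regular functions `p` and `Q`. The bound `7 / 2` is an arbitrary number
between `π` and `2 * π`. -/
structure SingularData (f T G : ℂ → ℂ) (b₀ b₁ q : ℝ) (a c : ℂ) where
  domain : Set ℂ
  φ : ℝ
  radius : ℝ
  p : ℂ → ℂ
  Q : ℂ → ℂ
  angle_pos : 0 < φ
  angle_lt : φ < Real.pi / 2
  radius_pos : 0 < radius
  one_lt : 1 < q
  isOpen : IsOpen domain
  left_subset : {ζ : ℂ | ζ.re < 0} ⊆ domain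
  wedge_subset : wedge φ ∩ Metric.ball 0 radius ⊆ domain
  axis_mem : ∀ y : ℝ, y ≠ 0 → |y| ≤ 7 / 2 → y * Complex.I ∈ domain
  axis_lt : ∀ y : ℝ, y ≠ 0 → |y| ≤ 7 / 2 → (G (y * Complex.I)).re < b₀
  periodic_f : Function.Periodic f (2 * Real.pi * Complex.I)
  periodic_T : Function.Periodic T (2 * Real.pi * Complex.I)
  periodic_G : Function.Periodic G (2 * Real.pi * Complex.I)
  differentiableOn_f : DifferentiableOn ℂ f domain
  differentiableOn_T : DifferentiableOn ℂ T domain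
  differentiableOn_G : DifferentiableOn ℂ G domain
  differentiableOn_p : DifferentiableOn ℂ p (Metric.ball 0 radius)
  differentiableOn_T_ball : DifferentiableOn ℂ T (Metric.ball 0 radius)
  differentiableOn_Q : DifferentiableOn ℂ Q (Metric.ball 0 radius)
  p_zero : p 0 = 1
  Q_zero : Q 0 = b₀
  hasDerivAt_Q : HasDerivAt Q b₁ 0
  expansion_f : (fun ζ ↦ f ζ - p ζ - c * (1 - Complex.exp ζ) ^ ((q - 1 : ℝ) : ℂ))
    =o[𝓝[wedge φ] 0] fun ζ ↦ ‖ζ‖ ^ (q - 1)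
  expansion_G : (fun ζ ↦ G ζ - Q ζ - a * (1 - Complex.exp ζ) ^ (q : ℂ))
    =o[𝓝[wedge φ] 0] fun ζ ↦ ‖ζ‖ ^ q

namespace SingularData

variable {f T G : ℂ → ℂ} {b₀ b₁ q : ℝ} {a c : ℂ} (S : SingularData f T G b₀ b₁ q a c)

section LocalBounds

include S

theorem cos_pos : 0 < Real.cos S.φ :=
  Real.cos_pos_of_mem_Ioo ⟨by linarith [S.angle_pos, Real.pi_pos], S.angle_lt⟩

theorem isBigO_f_sub_p : (fun ζ ↦ f ζ - S.p ζ) =O[𝓝[wedge S.φ] 0] fun ζ ↦ ‖ζ‖ ^ (q - 1) := by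
  have h := ((isBigO_one_sub_exp_cpow (sub_nonneg.2 S.one_lt.le)).mono
    (nhdsWithin_le_nhds (s := wedge S.φ))).const_mul_left c
  exact (S.expansion_f.isBigO.add h).congr_left fun ζ ↦ by ring

theorem isBigO_G_sub_Q : (fun ζ ↦ G ζ - S.Q ζ) =O[𝓝[wedge S.φ] 0] fun ζ ↦ ‖ζ‖ ^ q := by
  have h := ((isBigO_one_sub_exp_cpow (zero_le_one.trans S.one_lt.le)).mono
    (nhdsWithin_le_nhds (s := wedge S.φ))).const_mul_left a
  exact (S.expansion_G.isBigO.add h).congr_left fun ζ ↦ by ring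

theorem isLittleO_G_sub_Q : (fun ζ ↦ G ζ - S.Q ζ) =o[𝓝[wedge S.φ] 0] fun ζ ↦ ζ :=
  (S.isBigO_G_sub_Q.trans_isLittleO ((isLittleO_norm_rpow
    (tendsto_id'.2 nhdsWithin_le_nhds) zero_le_one S.one_lt).congr_right fun _ ↦
    Real.rpow_one _)).of_norm_right

end LocalBounds

/-- Explicit constants for the local behaviour of singular data at `0`: on the ball of radius `r`
the regular part `Q` is within `η * ‖ζ‖` of its tangent, and in the wedge `f` and `G` are close to
their regular parts. -/
structure LocalBounds (η r M : ℝ) : Prop where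
  pos : 0 < r
  le_radius : r ≤ S.radius
  nonneg : 0 ≤ M
  f_sub_p : ∀ ζ ∈ wedge S.φ, ‖ζ‖ < r → ‖f ζ - S.p ζ‖ ≤ M * ‖ζ‖ ^ (q - 1)
  G_sub_Q : ∀ ζ ∈ wedge S.φ, ‖ζ‖ < r → ‖G ζ - S.Q ζ‖ ≤ M * ‖ζ‖ ^ q
  G_sub_Q_le_mul : ∀ ζ ∈ wedge S.φ, ‖ζ‖ < r → ‖G ζ - S.Q ζ‖ ≤ η * ‖ζ‖
  Q_sub_linear : ∀ ζ : ℂ, ‖ζ‖ < r → ‖S.Q ζ - b₀ - b₁ * ζ‖ ≤ η * ‖ζ‖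
  T_sub : ∀ ζ : ℂ, ‖ζ‖ < r → ‖T ζ - T 0‖ ≤ M
  p_le : ∀ ζ : ℂ, ‖ζ‖ < r → ‖S.p ζ‖ ≤ M

theorem exists_localBounds {η : ℝ} (hη : 0 < η) : ∃ r M : ℝ, S.LocalBounds η r M := by
  obtain ⟨Mf, hf⟩ := S.isBigO_f_sub_p.bound
  obtain ⟨MG, hG⟩ := S.isBigO_G_sub_Q.bound
  have hGη := S.isLittleO_G_sub_Q.def hη
  have hQ := (hasDerivAt_iff_isLittleO.1 S.hasDerivAt_Q).def hη
  have hball := Metric.ball_mem_nhds (0 : ℂ) S.radius_pos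
  have hT := Metric.tendsto_nhds.1
    (S.differentiableOn_T_ball.continuousOn.continuousAt hball).tendsto 1 one_pos
  have hp := (S.differentiableOn_p.continuousOn.continuousAt hball).norm.eventually_lt_const
    (lt_add_one _)
  simp only [S.p_zero, norm_one] at hp
  rw [eventually_nhdsWithin_iff] at hf hG hGη
  obtain ⟨r, hr, hlocal⟩ := Metric.eventually_nhds_iff.1
    (hf.and (hG.and (hGη.and (hQ.and (hT.and (hp.and hball))))))
  simp only [dist_zero_right] at hlocal
  refine ⟨min r S.radius, max (max Mf MG) 2, lt_min hr S.radius_pos, min_le_right _ _,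
    le_max_of_le_right (by norm_num), fun ζ hw hζ ↦ ?_, fun ζ hw hζ ↦ ?_, fun ζ hw hζ ↦ ?_,
    fun ζ hζ ↦ ?_, fun ζ hζ ↦ ?_, fun ζ hζ ↦ ?_⟩ <;>
  obtain ⟨hf, hG, hGη, hQ, hT, hp, -⟩ := hlocal (hζ.trans_le (min_le_left _ _))
  · refine (hf hw).trans ?_
    rw [Real.norm_of_nonneg (by positivity)]
    gcongr
    exact (le_max_left _ _).trans (le_max_left _ _)
  · refine (hG hw).trans ?_
    rw [Real.norm_of_nonneg (by positivity)]
    gcongr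
    exact (le_max_right _ _).trans (le_max_left _ _)
  · exact hGη hw
  · simpa [S.Q_zero, mul_comm] using hQ
  · rw [dist_eq_norm] at hT
    exact hT.le.trans (le_max_of_le_right (by norm_num))
  · exact hp.le.trans (le_max_of_le_right (by norm_num))

theorem exists_norm_deriv_sub_le {ψ η : ℝ} (hψ₀ : 0 ≤ Real.cos ψ)
    (hψ : Real.cos ψ < Real.cos S.φ) (hη : 0 < η) :
    ∃ r > 0, ∀ ζ : ℂ, ζ ≠ 0 → ζ.re ≤ ‖ζ‖ * Real.cos ψ → ‖ζ‖ < r → ‖deriv G ζ - b₁‖ ≤ η := by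
  obtain ⟨k, hk, hkφ⟩ : ∃ k > 0, Real.cos ψ + 3 * k = Real.cos S.φ :=
    ⟨(Real.cos S.φ - Real.cos ψ) / 3, by linarith, by ring⟩
  obtain ⟨r, M, hB⟩ := S.exists_localBounds (η := η * k / 4) (by positivity)
  refine ⟨r / 2, half_pos hB.pos, fun ζ hζ₀ hζ hζr ↦ ?_⟩
  have hkζ : 0 < k * ‖ζ‖ := mul_pos hk (norm_pos_iff.2 hζ₀)
  have hwedge := closedBall_subset_wedge hψ₀ hk hkφ.le hζ₀ hζ
  have hnorm : ∀ w ∈ Metric.closedBall ζ (k * ‖ζ‖), ‖w‖ ≤ 2 * ‖ζ‖ := fun w hw ↦ by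
    rw [Metric.mem_closedBall, dist_eq_norm] at hw
    nlinarith [norm_sub_norm_le w ζ, Real.cos_le_one S.φ, norm_nonneg ζ]
  have hdiff : ∀ w ∈ Metric.closedBall ζ (k * ‖ζ‖), DifferentiableAt ℂ G w := fun w hw ↦
    S.differentiableOn_G.differentiableAt <| S.isOpen.mem_nhds <| S.wedge_subset
      ⟨hwedge hw, by rw [mem_ball_zero_iff]; linarith [hnorm w hw, hB.le_radius]⟩
  have hcont : DiffContOnCl ℂ (fun w ↦ G w - b₀ - b₁ * w) (Metric.ball ζ (k * ‖ζ‖)) :=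
    DifferentiableOn.diffContOnCl_ball (fun w hw ↦ (((hdiff w hw).sub_const _).sub
      (differentiableAt_id.const_mul _)).differentiableWithinAt) le_rfl
  have hbound : ∀ w ∈ Metric.sphere ζ (k * ‖ζ‖), ‖G w - b₀ - b₁ * w‖ ≤ η * (k * ‖ζ‖) := by
    intro w hw
    have hw := Metric.sphere_subset_closedBall hw
    have hwr : ‖w‖ < r := by linarith [hnorm w hw]
    calc ‖G w - b₀ - b₁ * w‖ = ‖(G w - S.Q w) + (S.Q w - b₀ - b₁ * w)‖ := by congr 1; ring
      _ ≤ η * k / 4 * ‖w‖ + η * k / 4 * ‖w‖ := norm_add_le_of_le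
        (hB.G_sub_Q_le_mul w (hwedge hw) hwr) (hB.Q_sub_linear w hwr)
      _ = η * k / 2 * ‖w‖ := by ring
      _ ≤ η * k / 2 * (2 * ‖ζ‖) := by gcongr; exact hnorm w hw
      _ = _ := by ring
  have hderiv : deriv (fun w ↦ G w - b₀ - b₁ * w) ζ = deriv G ζ - b₁ := by
    have h := ((hdiff ζ (Metric.mem_closedBall_self hkζ.le)).hasDerivAt.sub_const (b₀ : ℂ)).sub
      ((hasDerivAt_id' ζ).const_mul (b₁ : ℂ))
    rw [mul_one] at h
    exact h.deriv
  rw [← hderiv]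
  exact (Complex.norm_deriv_le_of_forall_mem_sphere_norm_le hkζ hcont hbound).trans_eq
    (mul_div_cancel_right₀ _ hkζ.ne')

end SingularData

/-- The part `re ζ < ρ`, `σ * im ζ < 7 / 2` of the half-plane to the left of the ray of direction
`exp (σ * φ * I)`, for `σ = 1` or `σ = -1`. Contours are deformed inside these convex sets. -/
def tiltedStrip (φ ρ σ : ℝ) : Set ℂ :=
  {ζ | ζ.re * Real.sin φ < σ * ζ.im * Real.cos φ ∧ ζ.re < ρ ∧ σ * ζ.im < 7 / 2}

theorem isOpen_tiltedStrip (φ ρ σ : ℝ) : IsOpen (tiltedStrip φ ρ σ) := by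
  simp only [tiltedStrip, Set.ofPred_and]
  exact (isOpen_lt (by fun_prop) (by fun_prop)).inter <|
    (isOpen_lt (by fun_prop) (by fun_prop)).inter (isOpen_lt (by fun_prop) (by fun_prop))

theorem convex_tiltedStrip (φ ρ σ : ℝ) : Convex ℝ (tiltedStrip φ ρ σ) := by
  have hray : IsLinearMap ℝ fun ζ : ℂ ↦ ζ.re * Real.sin φ - σ * ζ.im * Real.cos φ :=
    ⟨fun z w ↦ by simp only [Complex.add_re, Complex.add_im]; ring,
      fun t z ↦ by simp only [Complex.smul_re, Complex.smul_im, smul_eq_mul]; ring⟩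
  have him : IsLinearMap ℝ fun ζ : ℂ ↦ σ * ζ.im :=
    ⟨fun z w ↦ by simp only [Complex.add_im]; ring,
      fun t z ↦ by simp only [Complex.smul_im, smul_eq_mul]; ring⟩
  have h := (convex_halfSpace_lt hray 0).inter <|
    (convex_halfSpace_lt Complex.reLm.isLinear ρ).inter (convex_halfSpace_lt him (7 / 2))
  simp only [sub_neg] at h
  exact h

theorem norm_le_norm_of_im_eq {w ζ : ℂ} (hw : 0 ≤ w.re) (hre : w.re ≤ ζ.re) (him : w.im = ζ.im) :
    ‖w‖ ≤ ‖ζ‖ := by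
  refine le_of_sq_le_sq ?_ (norm_nonneg ζ)
  rw [Complex.sq_norm, Complex.sq_norm, Complex.normSq_apply, Complex.normSq_apply, him]
  nlinarith

namespace SingularData

variable {f T G : ℂ → ℂ} {b₀ b₁ q v₂ d₀ : ℝ} {a c : ℂ} (S : SingularData f T G b₀ b₁ q a c)

section VerticalSide

include S

theorem exists_re_le_of_norm_lt {ψ η : ℝ} (hψ : S.φ < ψ) (hψ' : ψ < Real.pi / 2) (hη : 0 < η) :
    ∃ r > 0, r ≤ S.radius ∧ ∀ ζ : ℂ, 0 ≤ ζ.re → ζ.im ≠ 0 → |ζ.im| ≤ 7 / 2 →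
      ζ.re * Real.sin ψ ≤ |ζ.im| * Real.cos ψ → ‖ζ‖ < r → (G ζ).re ≤ b₀ + (b₁ + η) * ζ.re := by
  have hψ₀ : 0 < ψ := S.angle_pos.trans hψ
  have hsin : 0 ≤ Real.sin ψ := Real.sin_nonneg_of_nonneg_of_le_pi hψ₀.le (by linarith)
  have hcos : Real.cos ψ < Real.cos S.φ :=
    Real.cos_lt_cos_of_nonneg_of_le_pi_div_two S.angle_pos.le hψ'.le hψ
  obtain ⟨r, hr, hderiv⟩ := S.exists_norm_deriv_sub_le
    (Real.cos_nonneg_of_mem_Icc ⟨by linarith, hψ'.le⟩) hcos hη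
  refine ⟨min r S.radius, lt_min hr S.radius_pos, min_le_right _ _,
    fun ζ hre him him' hζ hζr ↦ ?_⟩
  have hside : ∀ w ∈ Set.Icc 0 ζ.re ×ℂ {ζ.im},
      w ≠ 0 ∧ w.re ≤ ‖w‖ * Real.cos ψ ∧ ‖w‖ < min r S.radius := by
    rintro w ⟨⟨hw₀, hw₁⟩, hw⟩
    rw [Set.mem_preimage, Set.mem_singleton_iff] at hw
    refine ⟨fun h ↦ him (by rw [← hw, h, Complex.zero_im]), re_le_norm_mul_cos hψ₀ hψ' ?_,
      lt_of_le_of_lt ?_ hζr⟩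
    · rw [hw]
      exact (mul_le_mul_of_nonneg_right hw₁ hsin).trans hζ
    · exact norm_le_norm_of_im_eq hw₀ hw₁ hw
  have hmean := Convex.norm_image_sub_le_of_norm_hasDerivWithin_le (𝕜 := ℂ)
    (f := fun w ↦ G w - b₁ * w) (f' := fun w ↦ deriv G w - b₁) (C := η)
    (x := ζ.im * Complex.I) (y := ζ) (fun w hw ↦ ?_) (fun w hw ↦ ?_)
    (((convex_Icc 0 ζ.re).linear_preimage Complex.reLm).inter
      ((convex_singleton ζ.im).linear_preimage Complex.imLm)) ?_ ?_
  · have haxis := S.axis_lt ζ.im him him'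
    rw [show ζ - ζ.im * Complex.I = ζ.re by simp [Complex.ext_iff], Complex.norm_real,
      Real.norm_of_nonneg hre] at hmean
    have hre' := (Complex.re_le_norm _).trans hmean
    simp only [Complex.sub_re, Complex.re_ofReal_mul, Complex.I_re, mul_zero, sub_zero,
      tsub_le_iff_right] at hre'
    linarith
  · obtain ⟨hw₀, hw, hwr⟩ := hside w hw
    have hG := S.differentiableOn_G.differentiableAt <| S.isOpen.mem_nhds <| S.wedge_subset
      ⟨mem_wedge_of_re_le_norm_mul_cos hcos hw₀ hw,
        mem_ball_zero_iff.2 (hwr.trans_le (min_le_right _ _))⟩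
    have h := hG.hasDerivAt.sub ((hasDerivAt_id' w).const_mul (b₁ : ℂ))
    rw [mul_one] at h
    exact h.hasDerivWithinAt
  · obtain ⟨hw₀, hw, hwr⟩ := hside w hw
    exact hderiv w hw₀ hw (hwr.trans_le (min_le_left _ _))
  · simp [hre]
  · simp [hre]

theorem exists_re_lt_of_le_abs_im {r : ℝ} (hr : 0 < r) :
    ∃ ρ > 0, ∀ ζ : ℂ, 0 ≤ ζ.re → ζ.re < ρ → r ≤ |ζ.im| → |ζ.im| ≤ 7 / 2 →
      ζ ∈ S.domain ∧ (G ζ).re < b₀ := by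
  have hopen : IsOpen (S.domain ∩ G ⁻¹' {z | z.re < b₀}) :=
    S.differentiableOn_G.continuousOn.isOpen_inter_preimage S.isOpen
      (isOpen_lt Complex.continuous_re continuous_const)
  have hcompact : IsCompact
      ((fun y : ℝ ↦ (y : ℂ) * Complex.I) '' {y : ℝ | r ≤ |y| ∧ |y| ≤ 7 / 2}) := by
    refine IsCompact.image ?_ (by fun_prop)
    refine isCompact_Icc.of_isClosed_subset (s := Set.Icc (-(7 / 2 : ℝ)) (7 / 2)) ?_
      fun y hy ↦ abs_le.1 hy.2
    exact (isClosed_le continuous_const continuous_abs).inter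
      (isClosed_le continuous_abs continuous_const)
  obtain ⟨ρ, hρ, hsub⟩ := hcompact.exists_thickening_subset_open hopen (by
    rintro _ ⟨y, hy, rfl⟩
    have hy₀ : y ≠ 0 := abs_pos.1 (hr.trans_le hy.1)
    exact ⟨S.axis_mem y hy₀ hy.2, S.axis_lt y hy₀ hy.2⟩)
  refine ⟨ρ, hρ, fun ζ hre hreρ him him' ↦ hsub ?_⟩
  refine Metric.mem_thickening_iff.2 ⟨ζ.im * Complex.I, ⟨ζ.im, ⟨him, him'⟩, rfl⟩, ?_⟩
  rw [dist_eq_norm, show ζ - ζ.im * Complex.I = ζ.re by simp [Complex.ext_iff],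
    Complex.norm_real, Real.norm_of_nonneg hre]
  exact hreρ

theorem exists_side {ψ η : ℝ} (hψ : S.φ < ψ) (hψ' : ψ < Real.pi / 2) (hη : 0 < η) :
    ∃ ρ > 0, ∀ ζ : ℂ, 0 < ζ.re → ζ.re < ρ → ζ.re * Real.sin ψ ≤ |ζ.im| * Real.cos ψ →
      |ζ.im| ≤ 7 / 2 → ζ ∈ S.domain ∧ ((G ζ).re < b₀ ∨ (G ζ).re ≤ b₀ + (b₁ + η) * ζ.re) := by
  have hψ₀ : 0 < ψ := S.angle_pos.trans hψ
  have hsin : 0 < Real.sin ψ := Real.sin_pos_of_pos_of_lt_pi hψ₀ (by linarith)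
  have hcos : Real.cos ψ < Real.cos S.φ :=
    Real.cos_lt_cos_of_nonneg_of_le_pi_div_two S.angle_pos.le hψ'.le hψ
  obtain ⟨r, hr, hrS, hnear⟩ := S.exists_re_le_of_norm_lt hψ hψ' hη
  obtain ⟨ρ, hρ, hfar⟩ := S.exists_re_lt_of_le_abs_im (half_pos hr)
  refine ⟨min ρ (r / 2), lt_min hρ (half_pos hr), fun ζ hre hreρ hζ him ↦ ?_⟩
  rcases le_or_gt (r / 2) |ζ.im| with hζr | hζr
  · exact (hfar ζ hre.le (hreρ.trans_le (min_le_left _ _)) hζr him).imp_right Or.inl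
  · have hnorm : ‖ζ‖ < r := by
      have h := Complex.norm_le_abs_re_add_abs_im ζ
      rw [abs_of_pos hre] at h
      linarith [min_le_right ρ (r / 2)]
    have him₀ : ζ.im ≠ 0 := fun h ↦ by
      rw [h, abs_zero, zero_mul] at hζ
      exact absurd hζ (mul_pos hre hsin).not_ge
    have hζ₀ : ζ ≠ 0 := fun h ↦ him₀ (by rw [h, Complex.zero_im])
    have hwedge := mem_wedge_of_re_le_norm_mul_cos hcos hζ₀ (re_le_norm_mul_cos hψ₀ hψ' hζ)
    exact ⟨S.wedge_subset ⟨hwedge, mem_ball_zero_iff.2 (hnorm.trans_le hrS)⟩,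
      Or.inr (hnear ζ hre.le him₀ him hζ hnorm)⟩

theorem exists_tiltedStrip_subset :
    ∃ ρ > 0, ∀ σ : ℝ, |σ| = 1 → tiltedStrip S.φ ρ σ ⊆ S.domain := by
  obtain ⟨ρ, hρ, hfar⟩ := S.exists_re_lt_of_le_abs_im (half_pos S.radius_pos)
  refine ⟨min ρ (S.radius / 2), lt_min hρ (half_pos S.radius_pos), ?_⟩
  rintro σ hσ ζ ⟨hray, hre, him⟩
  rcases lt_or_ge ζ.re 0 with hre₀ | hre₀
  · exact S.left_subset hre₀
  have hsin : 0 ≤ Real.sin S.φ :=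
    Real.sin_nonneg_of_nonneg_of_le_pi S.angle_pos.le (by linarith [S.angle_lt, Real.pi_pos])
  have hσim : 0 < σ * ζ.im :=
    pos_of_mul_pos_left ((mul_nonneg hre₀ hsin).trans_lt hray) S.cos_pos.le
  have habs : |ζ.im| = σ * ζ.im := by rw [← abs_of_pos hσim, abs_mul, hσ, one_mul]
  rw [← habs] at hray him
  rcases le_or_gt (S.radius / 2) |ζ.im| with hζr | hζr
  · exact (hfar ζ hre₀ (hre.trans_le (min_le_left _ _)) hζr him.le).1
  · refine S.wedge_subset
      ⟨mem_wedge_of_re_mul_sin_lt S.angle_pos S.angle_lt hray, mem_ball_zero_iff.2 ?_⟩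
    have hnorm := Complex.norm_le_abs_re_add_abs_im ζ
    rw [abs_of_nonneg hre₀] at hnorm
    linarith [min_le_right ρ (S.radius / 2)]

end VerticalSide

theorem re_exponent_le {v m : ℝ} {w ζ : ℂ} (hv : v ∈ Set.Icc 0 v₂) (hd : d₀ ≤ 1 - v * b₁)
    (hζ : 0 ≤ ζ.re) (hm : 0 ≤ m) (hw : w.re ≤ b₁ * ζ.re + m) :
    (v * w - ζ).re ≤ v₂ * m - d₀ * ζ.re := by
  rw [Complex.sub_re, Complex.re_ofReal_mul]
  have hdζ := mul_le_mul_of_nonneg_right hd hζ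
  have hvm := mul_le_mul_of_nonneg_right hv.2 hm
  have hvw := mul_le_mul_of_nonneg_left hw hv.1
  linarith

/-- The constants of the deformed contour: it leaves `0` along two legs of length `L` in the
directions `exp (± ψ * I)` and continues on the vertical line through their end points, on which
the exponent `v * (G ζ - b₀) - ζ` has real part at most `-κ` as long as `v ∈ [0, v₂]` and
`d₀ ≤ 1 - v * b₁`. -/
structure Contour (v₂ d₀ : ℝ) where
  ψ : ℝ
  L : ℝ
  r : ℝ
  M : ℝ
  η : ℝ
  κ : ℝ
  ρ : ℝ
  d₀_pos : 0 < d₀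
  lt_angle : S.φ < ψ
  angle_lt : ψ < Real.pi / 2
  length_pos : 0 < L
  length_lt : L < r
  length_le_cos : L ≤ Real.cos S.φ
  localBounds : S.LocalBounds η r M
  mul_le : 4 * v₂ * η ≤ d₀ * Real.cos ψ
  strip_subset : tiltedStrip S.φ ρ 1 ⊆ S.domain
  strip_subset' : tiltedStrip S.φ ρ (-1) ⊆ S.domain
  side_lt : L * Real.cos ψ < ρ
  κ_pos : 0 < κ
  side_mem : ∀ ζ : ℂ, ζ.re = L * Real.cos ψ → L * Real.sin ψ ≤ |ζ.im| → |ζ.im| ≤ 7 / 2 →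
    ζ ∈ S.domain
  side_le : ∀ ζ : ℂ, ζ.re = L * Real.cos ψ → L * Real.sin ψ ≤ |ζ.im| → |ζ.im| ≤ 7 / 2 →
    ∀ v ∈ Set.Icc 0 v₂, d₀ ≤ 1 - v * b₁ → (v * (G ζ - b₀) - ζ).re ≤ -κ

theorem nonempty_contour (hv₂ : 0 < v₂) (hd₀ : 0 < d₀) : Nonempty (S.Contour v₂ d₀) := by
  obtain ⟨ψ, hψ, hψ'⟩ := exists_between S.angle_lt
  have hcos : 0 < Real.cos ψ := Real.cos_pos_of_mem_Ioo ⟨by linarith [S.angle_pos], hψ'⟩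
  obtain ⟨r, M, hB⟩ := S.exists_localBounds (η := d₀ * Real.cos ψ / (4 * v₂)) (by positivity)
  obtain ⟨ρ, hρ, hstrip⟩ := S.exists_tiltedStrip_subset
  obtain ⟨ρ', hρ', hside⟩ := S.exists_side hψ hψ' (η := d₀ / (2 * v₂)) (by positivity)
  obtain ⟨L, hL, hLlt⟩ : ∃ L, 0 < L ∧ L < min (min r (Real.cos S.φ)) (min ρ ρ') :=
    exists_between (lt_min (lt_min hB.pos S.cos_pos) (lt_min hρ hρ'))
  simp only [lt_min_iff] at hLlt
  obtain ⟨⟨hLr, hLφ⟩, hLρ, hLρ'⟩ := hLlt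
  have hx : 0 < L * Real.cos ψ := mul_pos hL hcos
  have hxL : L * Real.cos ψ ≤ L := mul_le_of_le_one_right hL.le (Real.cos_le_one ψ)
  have hside' : ∀ ζ : ℂ, ζ.re = L * Real.cos ψ → L * Real.sin ψ ≤ |ζ.im| → |ζ.im| ≤ 7 / 2 →
      ζ ∈ S.domain ∧ ((G ζ).re < b₀ ∨ (G ζ).re ≤ b₀ + (b₁ + d₀ / (2 * v₂)) * ζ.re) :=
    fun ζ hre him him' ↦ hside ζ (by linarith) (by linarith) (by rw [hre]; nlinarith) him'
  refine ⟨⟨ψ, L, r, M, _, min 1 (d₀ / 2) * (L * Real.cos ψ), ρ, hd₀, hψ, hψ', hL, hLr, hLφ.le, hB,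
    (by field_simp; rfl), hstrip 1 (by simp), hstrip (-1) (by simp), by linarith, by positivity,
    fun ζ hre him him' ↦ (hside' ζ hre him him').1, fun ζ hre him him' v hv hd ↦ ?_⟩⟩
  rw [← hre] at hx ⊢
  have hmin₁ := mul_le_mul_of_nonneg_right (min_le_left 1 (d₀ / 2)) hx.le
  have hmin₂ := mul_le_mul_of_nonneg_right (min_le_right 1 (d₀ / 2)) hx.le
  rcases (hside' ζ hre him him').2 with hG | hG
  · rw [Complex.sub_re, Complex.re_ofReal_mul, Complex.sub_re, Complex.ofReal_re]
    linarith [mul_nonpos_of_nonneg_of_nonpos hv.1 (sub_nonpos.2 hG.le)]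
  · have h := re_exponent_le (w := G ζ - b₀) (m := d₀ / (2 * v₂) * ζ.re) hv hd hx.le
      (by positivity) (by rw [Complex.sub_re, Complex.ofReal_re]; linarith)
    have hcancel : v₂ * (d₀ / (2 * v₂) * ζ.re) = d₀ / 2 * ζ.re := by field_simp
    linarith

end SingularData

namespace SingularData

variable {f T G : ℂ → ℂ} {b₀ b₁ q v₂ d₀ : ℝ} {a c : ℂ} {S : SingularData f T G b₀ b₁ q a c}

namespace LocalBounds

variable {η r M v : ℝ} {ζ : ℂ} (hB : S.LocalBounds η r M)

include hB

theorem G_sub_le (hw : ζ ∈ wedge S.φ) (hζ : ‖ζ‖ < r) : ‖G ζ - b₀‖ ≤ (2 * η + |b₁|) * ‖ζ‖ := by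
  calc ‖G ζ - b₀‖ = ‖(G ζ - S.Q ζ) + (S.Q ζ - b₀ - b₁ * ζ) + b₁ * ζ‖ := by congr 1; ring
    _ ≤ η * ‖ζ‖ + η * ‖ζ‖ + |b₁| * ‖ζ‖ := norm_add_le_of_le
      (norm_add_le_of_le (hB.G_sub_Q_le_mul ζ hw hζ) (hB.Q_sub_linear ζ hζ))
      (by rw [norm_mul, Complex.norm_real, Real.norm_eq_abs])
    _ = _ := by ring

theorem exists_norm_kern_le (N : ℕ) (hv : v ∈ Set.Icc 0 v₂) :
    ∃ B, ∀ ζ ∈ wedge S.φ, ‖ζ‖ < r → ‖kern f T G b₀ N v ζ‖ ≤ B := by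
  refine ⟨_, fun ζ hw hζ ↦ norm_kern_le (B := M * r ^ (q - 1) + M)
    (c := v₂ * |(2 * η + |b₁|) * r| + r) hv ?_ (hB.T_sub ζ hζ) ?_⟩
  · calc ‖f ζ‖ = ‖(f ζ - S.p ζ) + S.p ζ‖ := by rw [sub_add_cancel]
      _ ≤ M * ‖ζ‖ ^ (q - 1) + M := norm_add_le_of_le (hB.f_sub_p ζ hw hζ) (hB.p_le ζ hζ)
      _ ≤ M * r ^ (q - 1) + M := by
        have := hB.nonneg
        have := sub_nonneg.2 S.one_lt.le
        gcongr
  · have hG : ‖G ζ - b₀‖ ≤ |(2 * η + |b₁|) * r| := by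
      refine (hB.G_sub_le hw hζ).trans ((le_abs_self _).trans ?_)
      rw [abs_mul, abs_mul, abs_norm]
      gcongr
      exact hζ.le.trans (le_abs_self r)
    refine (Complex.re_le_norm _).trans ((norm_sub_le _ _).trans (add_le_add ?_ hζ.le))
    rw [norm_mul, Complex.norm_real, Real.norm_of_nonneg hv.1]
    exact mul_le_mul hv.2 hG (norm_nonneg _) (hv.1.trans hv.2)

end LocalBounds

namespace Contour

variable (K : S.Contour v₂ d₀)

/-- The direction `exp (σ * ψ * I)` of a leg of the contour, for `σ = 1` or `σ = -1`. -/
noncomputable def direction (σ : ℝ) : ℂ := Complex.exp ((σ * K.ψ : ℝ) * Complex.I)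

section Legs

include K

theorem cos_pos : 0 < Real.cos K.ψ :=
  Real.cos_pos_of_mem_Ioo ⟨by linarith [S.angle_pos, K.lt_angle, Real.pi_pos], K.angle_lt⟩

theorem sin_pos : 0 < Real.sin K.ψ :=
  Real.sin_pos_of_pos_of_lt_pi (S.angle_pos.trans K.lt_angle)
    (by linarith [K.angle_lt, Real.pi_pos])

theorem cos_lt_cos : Real.cos K.ψ < Real.cos S.φ :=
  Real.cos_lt_cos_of_nonneg_of_le_pi_div_two S.angle_pos.le K.angle_lt.le K.lt_angle

theorem norm_direction (σ : ℝ) : ‖K.direction σ‖ = 1 := Complex.norm_exp_ofReal_mul_I _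

theorem norm_ofReal_mul_direction {x : ℝ} (hx : 0 ≤ x) (σ : ℝ) : ‖x * K.direction σ‖ = x := by
  rw [norm_mul, K.norm_direction, mul_one, Complex.norm_of_nonneg hx]

variable {σ : ℝ} (hσ : |σ| = 1)

include hσ

theorem direction_re : (K.direction σ).re = Real.cos K.ψ := by
  rw [direction, Complex.exp_ofReal_mul_I_re, ← Real.cos_abs, abs_mul, hσ, one_mul, Real.cos_abs]

theorem direction_im : (K.direction σ).im = σ * Real.sin K.ψ := by
  rw [direction, Complex.exp_ofReal_mul_I_im]
  rcases eq_or_eq_neg_of_abs_eq hσ with rfl | rfl <;> simp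

theorem direction_mem_wedge : K.direction σ ∈ wedge S.φ :=
  mem_wedge_of_re_le_norm_mul_cos K.cos_lt_cos (Complex.exp_ne_zero _)
    (by rw [K.direction_re hσ, K.norm_direction, one_mul])

theorem neg_direction_mem_slitPlane : -K.direction σ ∈ Complex.slitPlane := by
  refine Or.inr ?_
  rw [Complex.neg_im, K.direction_im hσ]
  exact neg_ne_zero.2 (mul_ne_zero (abs_pos.1 (by rw [hσ]; exact one_pos)) K.sin_pos.ne')

theorem ofReal_mul_direction_mem_domain {x : ℝ} (hx : x ∈ Set.Ioc 0 K.L) :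
    x * K.direction σ ∈ S.domain := by
  refine S.wedge_subset ⟨ofReal_mul_mem_wedge hx.1 (K.direction_mem_wedge hσ), ?_⟩
  rw [mem_ball_zero_iff, K.norm_ofReal_mul_direction hx.1.le]
  linarith [hx.2, K.length_lt, K.localBounds.le_radius]

end Legs

theorem re_exponent_Q_le {v : ℝ} {ζ : ℂ} (hv : v ∈ Set.Icc 0 v₂) (hd : d₀ ≤ 1 - v * b₁)
    (hζ : ‖ζ‖ < K.r) (hre : ‖ζ‖ * Real.cos K.ψ ≤ ζ.re) :
    (v * (S.Q ζ - b₀) - ζ).re ≤ -(3 / 4 * d₀ * ζ.re) := by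
  have hQ := K.localBounds.Q_sub_linear ζ hζ
  have hQre : (S.Q ζ - b₀).re ≤ b₁ * ζ.re + K.η * ‖ζ‖ := by
    have h := (Complex.re_le_norm _).trans hQ
    rw [Complex.sub_re _ (b₁ * ζ), Complex.re_ofReal_mul] at h
    linarith
  have h := re_exponent_le hv hd ((mul_nonneg (norm_nonneg ζ) K.cos_pos.le).trans hre)
    ((norm_nonneg _).trans hQ) hQre
  have hη := mul_le_mul_of_nonneg_right K.mul_le (norm_nonneg ζ)
  have hdre := mul_le_mul_of_nonneg_left hre K.d₀_pos.le
  linarith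

theorem norm_kern_sub_ray_le {v x σ : ℝ} (hσ : |σ| = 1) (hv : v ∈ Set.Icc 0 v₂)
    (hd : d₀ ≤ 1 - v * b₁) (N : ℕ) (hx : x ∈ Set.Ioc 0 K.L) :
    ‖kern f T G b₀ N v (x * K.direction σ) - kern S.p T S.Q b₀ N v (x * K.direction σ)‖ ≤
      Real.exp (v₂ * K.M) * (K.M * x ^ (q - 1) + K.M * (N * (v₂ * (K.M * x ^ q)))) *
        Real.exp (-(d₀ * Real.cos K.ψ / 2 * (N * x))) := by
  have hnorm := K.norm_ofReal_mul_direction hx.1.le σ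
  have hre : (x * K.direction σ).re = x * Real.cos K.ψ := by
    rw [Complex.re_ofReal_mul, K.direction_re hσ]
  have hwedge := ofReal_mul_mem_wedge hx.1 (K.direction_mem_wedge hσ)
  have hr : ‖x * K.direction σ‖ < K.r := hnorm.trans_lt (hx.2.trans_lt K.length_lt)
  have hf := K.localBounds.f_sub_p _ hwedge hr
  have hG := K.localBounds.G_sub_Q _ hwedge hr
  have hexponent := K.re_exponent_Q_le hv hd hr (by rw [hnorm, hre])
  have hGη := mul_le_mul_of_nonneg_left (K.localBounds.G_sub_Q_le_mul _ hwedge hr) hv.1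
  rw [hnorm] at hf hG hGη
  rw [hre] at hexponent
  have hvη : v * (K.η * x) ≤ d₀ / 4 * (x * Real.cos K.ψ) := by
    have hηx : 0 ≤ K.η * x := by
      simpa only [hnorm] using (norm_nonneg _).trans (K.localBounds.G_sub_Q_le_mul _ hwedge hr)
    have h₁ := mul_le_mul_of_nonneg_right hv.2 hηx
    have h₂ := mul_le_mul_of_nonneg_right K.mul_le hx.1.le
    linarith
  have hexp : N * ((v * (S.Q (x * K.direction σ) - b₀) - x * K.direction σ).re +
      v * ‖G (x * K.direction σ) - S.Q (x * K.direction σ)‖) ≤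
      -(d₀ * Real.cos K.ψ / 2 * (N * x)) := by
    calc _ ≤ N * (-(d₀ * Real.cos K.ψ / 2) * x) :=
        mul_le_mul_of_nonneg_left (by linarith) N.cast_nonneg
      _ = _ := by ring
  refine (norm_kern_sub_le hv (K.localBounds.T_sub _ hr)).trans ?_
  have hM := K.localBounds.nonneg
  have hv₂ := hv.1.trans hv.2
  have hxq := Real.rpow_nonneg hx.1.le
  gcongr
  exacts [by have := hxq q; have := hxq (q - 1); positivity, K.localBounds.p_le _ hr]

end Contour
end SingularData

theorem mul_rayIntegral_add_mul_rayIntegral {q d : ℝ} {e : ℂ} (hq : 1 < q) (hd : 0 < d)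
    (he : 0 < e.re) (x y : ℂ) :
    x * rayIntegral (q - 1) d e + y * rayIntegral q d e =
      ∫ t in Set.Ioi (0 : ℝ), (x * ((-e) ^ ((q - 1 : ℝ) : ℂ) * ((t ^ (q - 1) : ℝ) : ℂ)) +
        y * ((-e) ^ (q : ℂ) * ((t ^ q : ℝ) : ℂ))) * e * Complex.exp (-(d * e * t)) := by
  rw [rayIntegral, rayIntegral, ← integral_const_mul, ← integral_const_mul, ← integral_add
    ((integrableOn_ray (by linarith) hd he).const_mul _)
    ((integrableOn_ray (by linarith) hd he).const_mul _)]
  congr 1 with t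
  ring

namespace SingularData

variable {f T G : ℂ → ℂ} {b₀ b₁ q v₂ d₀ : ℝ} {a c : ℂ}
variable {ι : Type*} {l : Filter ι} {N : ι → ℕ} {v : ι → ℝ} {vs : ℝ}

theorem tendsto_rpow_mul_kern_sub_ray (S : SingularData f T G b₀ b₁ q a c) {e : ℂ}
    (hew : e ∈ wedge S.φ) (he : -e ∈ Complex.slitPlane) (hN : Tendsto N l atTop)
    (hv : Tendsto v l (𝓝 vs)) {t : ℝ} (ht : 0 < t) :
    Tendsto (fun i ↦ (((N i : ℝ) ^ (q - 1) : ℝ) : ℂ) *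
      (kern f T G b₀ (N i) (v i) (((t / N i : ℝ) : ℂ) * e) -
        kern S.p T S.Q b₀ (N i) (v i) (((t / N i : ℝ) : ℂ) * e))) l
      (𝓝 (Complex.exp (vs * (b₁ * (t * e)) - t * e) *
        (c * (-e) ^ ((q - 1 : ℝ) : ℂ) * ((t ^ (q - 1) : ℝ) : ℂ) +
          1 * (vs * (a * (-e) ^ (q : ℂ) * ((t ^ q : ℝ) : ℂ)))))) := by
  have hball := Metric.ball_mem_nhds (0 : ℂ) S.radius_pos
  have hζ := (tendsto_ofReal_mul_zero e).comp (tendsto_div_natCast_nhdsGT hN ht)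
  have hp := (S.differentiableOn_p.continuousOn.continuousAt hball).tendsto.comp hζ
  have hT := (S.differentiableOn_T_ball.continuousOn.continuousAt hball).tendsto.comp hζ
  rw [S.p_zero] at hp
  have hfp := tendsto_ray_of_isLittleO (g := fun ζ ↦ f ζ - S.p ζ) hew he S.expansion_f
  have hGQ := tendsto_ray_of_isLittleO (g := fun ζ ↦ G ζ - S.Q ζ) hew he S.expansion_G
  refine tendsto_rpow_mul_kern_sub hN hv S.one_lt (tendsto_const_nhds.congr' ?_) hp hT ?_
    (tendsto_rpow_mul_of_tendsto_div hN hfp ht) (tendsto_rpow_mul_of_tendsto_div hN hGQ ht)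
  · filter_upwards [hN.eventually_gt_atTop 0] with i hi
    have hNi : (N i : ℂ) ≠ 0 := by exact_mod_cast hi.ne'
    push_cast
    field_simp
  · refine (tendsto_natCast_mul_sub hN S.hasDerivAt_Q (t * e)).congr fun i ↦ ?_
    rw [S.Q_zero]
    push_cast
    ring_nf

namespace Contour

variable {S : SingularData f T G b₀ b₁ q a c} (K : S.Contour v₂ d₀) {σ : ℝ} (hσ : |σ| = 1)

include hσ

theorem norm_rpow_mul_kern_sub_ray_le {n : ℕ} {w x : ℝ} (hw : w ∈ Set.Icc 0 v₂)
    (hd : d₀ ≤ 1 - w * b₁) (hx : x ∈ Set.Ioc 0 K.L) :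
    ‖(((n : ℝ) ^ (q - 1) : ℝ) : ℂ) * (kern f T G b₀ n w (x * K.direction σ) -
        kern S.p T S.Q b₀ n w (x * K.direction σ)) * K.direction σ‖ ≤
      Real.exp (v₂ * K.M) * (K.M * (n * x) ^ (q - 1) + K.M * (v₂ * (K.M * (n * x) ^ q))) *
        Real.exp (-(d₀ * Real.cos K.ψ / 2 * (n * x))) := by
  rw [norm_mul, norm_mul, K.norm_direction, mul_one, Complex.norm_of_nonneg (by positivity)]
  refine (mul_le_mul_of_nonneg_left (K.norm_kern_sub_ray_le hσ hw hd n hx) (by positivity)).trans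
    (le_of_eq ?_)
  rcases n.eq_zero_or_pos with rfl | hn
  · simp [Real.zero_rpow (sub_pos.2 S.one_lt).ne', Real.zero_rpow (zero_lt_one.trans S.one_lt).ne']
  · have hn' : (0 : ℝ) < n := by exact_mod_cast hn
    have hpow : (n : ℝ) ^ q = (n : ℝ) ^ (q - 1) * n := by
      rw [Real.rpow_sub_one hn'.ne', div_mul_cancel₀ _ hn'.ne']
    rw [Real.mul_rpow hn'.le hx.1.le, Real.mul_rpow hn'.le hx.1.le, hpow]
    ring

theorem continuousOn_kern_sub_ray (n : ℕ) (w : ℝ) :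
    ContinuousOn (fun t : ℝ ↦ (kern f T G b₀ n w - kern S.p T S.Q b₀ n w) (t * K.direction σ))
      (Set.Ioc 0 K.L) := by
  have hmaps : Set.MapsTo (fun t : ℝ ↦ (t : ℂ) * K.direction σ) (Set.Ioc 0 K.L)
      (S.domain ∩ Metric.ball 0 S.radius) := fun t ht ↦
    ⟨K.ofReal_mul_direction_mem_domain hσ ht, by
      rw [mem_ball_zero_iff, K.norm_ofReal_mul_direction ht.1.le]
      linarith [ht.2, K.length_lt, K.localBounds.le_radius]⟩
  have hcont := (differentiableOn_kern S.differentiableOn_f S.differentiableOn_T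
    S.differentiableOn_G b₀ n w).continuousOn
  have hcont' := (differentiableOn_kern S.differentiableOn_p S.differentiableOn_T_ball
    S.differentiableOn_Q b₀ n w).continuousOn
  exact ((hcont.mono Set.inter_subset_left).sub (hcont'.mono Set.inter_subset_right)).comp
    (by fun_prop) hmaps

theorem tendsto_rpow_mul_segmentIntegral_sub [l.IsCountablyGenerated] (hN : Tendsto N l atTop)
    (hv : Tendsto v l (𝓝 vs)) (hvs : 0 < 1 - vs * b₁)
    (hvI : ∀ᶠ i in l, v i ∈ Set.Icc 0 v₂ ∧ d₀ ≤ 1 - v i * b₁) (hv₂ : 0 ≤ v₂) :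
    Tendsto (fun i ↦ (((N i : ℝ) ^ q : ℝ) : ℂ) * segmentIntegral
        (kern f T G b₀ (N i) (v i) - kern S.p T S.Q b₀ (N i) (v i)) 0 (K.L * K.direction σ)) l
      (𝓝 (c * rayIntegral (q - 1) (1 - vs * b₁) (K.direction σ) +
        vs * a * rayIntegral q (1 - vs * b₁) (K.direction σ))) := by
  have hq := S.one_lt
  have hM := K.localBounds.nonneg
  have hre : 0 < (K.direction σ).re := K.direction_re hσ ▸ K.cos_pos
  have hrate : 0 < d₀ * Real.cos K.ψ / 2 := by have := K.d₀_pos; have := K.cos_pos; positivity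
  have hint : IntegrableOn (fun t : ℝ ↦ Real.exp (v₂ * K.M) * (K.M * t ^ (q - 1) +
      K.M * (v₂ * (K.M * t ^ q))) * Real.exp (-(d₀ * Real.cos K.ψ / 2 * t))) (Set.Ioi 0) := by
    refine ((((integrableOn_rpow_mul_exp (s := q - 1) (by linarith) hrate).const_mul K.M).add
      ((integrableOn_rpow_mul_exp (s := q) (by linarith) hrate).const_mul
        (K.M * (v₂ * K.M)))).const_mul (Real.exp (v₂ * K.M))).congr (.of_forall fun t ↦ ?_)
    simp only [Pi.add_apply]
    ring
  have hlimit := tendsto_rpow_mul_segmentIntegral (q := q) (e := K.direction σ)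
    (h := fun i ↦ kern f T G b₀ (N i) (v i) - kern S.p T S.Q b₀ (N i) (v i)) hN K.length_pos
    (.of_forall fun i ↦ ?_) ?_ hint (fun t ht ↦ by positivity)
    (fun t ht ↦ (tendsto_rpow_mul_kern_sub_ray S (K.direction_mem_wedge hσ)
      (K.neg_direction_mem_slitPlane hσ) hN hv ht).mul_const _)
  · convert hlimit using 2
    refine (mul_rayIntegral_add_mul_rayIntegral hq hvs hre c (vs * a)).trans ?_
    congr 1 with t
    have hexp : (vs : ℂ) * (b₁ * (t * K.direction σ)) - t * K.direction σ =
        -(((1 - vs * b₁ : ℝ) : ℂ) * K.direction σ * t) := by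
      push_cast
      ring
    rw [hexp]
    ring
  · exact K.continuousOn_kern_sub_ray hσ _ _
  · filter_upwards [hvI] with i hi x hx using K.norm_rpow_mul_kern_sub_ray_le hσ hi.1 hi.2 hx

end Contour
end SingularData

namespace SingularData.Contour

variable {f T G : ℂ → ℂ} {b₀ b₁ q v₂ d₀ : ℝ} {a c : ℂ} {S : SingularData f T G b₀ b₁ q a c}
  (K : S.Contour v₂ d₀)

/-- The end point `L * cos ψ + σ * π * I` of the contour, for `σ = 1` or `σ = -1`. The two end
points differ by the period `2 * π * I`. -/
noncomputable def endpoint (σ : ℝ) : ℂ :=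
  ((K.L * Real.cos K.ψ : ℝ) : ℂ) + ((σ * Real.pi : ℝ) : ℂ) * Complex.I

section Sides

include K

theorem endpoint_sub_period : K.endpoint 1 - 2 * Real.pi * Complex.I = K.endpoint (-1) := by
  simp only [endpoint]
  push_cast
  ring

theorem endpoint_re (σ : ℝ) : (K.endpoint σ).re = K.L * Real.cos K.ψ := by
  rw [endpoint, Complex.add_re, Complex.ofReal_re, Complex.re_ofReal_mul, Complex.I_re, mul_zero,
    add_zero]

theorem endpoint_im (σ : ℝ) : (K.endpoint σ).im = σ * Real.pi := by
  rw [endpoint, Complex.add_im, Complex.ofReal_im, Complex.im_ofReal_mul, Complex.I_im, mul_one,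
    zero_add]

theorem length_mul_cos_pos : 0 < K.L * Real.cos K.ψ := mul_pos K.length_pos K.cos_pos

theorem length_mul_cos_le_cos : K.L * Real.cos K.ψ ≤ Real.cos S.φ :=
  (mul_le_of_le_one_right K.length_pos.le (Real.cos_le_one _)).trans K.length_le_cos

theorem length_mul_sin_le_pi : K.L * Real.sin K.ψ ≤ Real.pi := by
  have h := mul_le_of_le_one_right K.length_pos.le (Real.sin_le_one K.ψ)
  linarith [K.length_le_cos, Real.cos_le_one S.φ, Real.pi_gt_three]

variable {σ : ℝ} (hσ : |σ| = 1)

include hσ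

theorem length_mul_direction_re : (K.L * K.direction σ).re = K.L * Real.cos K.ψ := by
  rw [Complex.re_ofReal_mul, K.direction_re hσ]

theorem length_mul_direction_im : (K.L * K.direction σ).im = σ * (K.L * Real.sin K.ψ) := by
  rw [Complex.im_ofReal_mul, K.direction_im hσ]
  ring

theorem re_im_of_mem_segment_side {ζ : ℂ}
    (hζ : ζ ∈ segment ℝ (K.L * K.direction σ) (K.endpoint σ)) :
    ζ.re = K.L * Real.cos K.ψ ∧ K.L * Real.sin K.ψ ≤ |ζ.im| ∧ |ζ.im| ≤ 7 / 2 := by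
  have hσσ : σ * σ = 1 := by rw [← abs_mul_abs_self, hσ, one_mul]
  have hlin : IsLinearMap ℝ fun ζ : ℂ ↦ σ * ζ.im :=
    ⟨fun z w ↦ by simp only [Complex.add_im]; ring,
      fun t z ↦ by simp only [Complex.smul_im, smul_eq_mul]; ring⟩
  have hconv : Convex ℝ ({ζ : ℂ | ζ.re = K.L * Real.cos K.ψ} ∩
      {ζ : ℂ | σ * ζ.im ∈ Set.Icc (K.L * Real.sin K.ψ) Real.pi}) :=
    (convex_hyperplane Complex.reLm.isLinear _).inter ((convex_Icc _ _).is_linear_preimage hlin)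
  obtain ⟨hre, him⟩ := hconv.segment_subset (x := K.L * K.direction σ) (y := K.endpoint σ)
    ⟨K.length_mul_direction_re hσ, by
      rw [Set.mem_ofPred_eq, K.length_mul_direction_im hσ, ← mul_assoc, hσσ, one_mul]
      exact ⟨le_rfl, K.length_mul_sin_le_pi⟩⟩
    ⟨K.endpoint_re σ, by
      rw [Set.mem_ofPred_eq, K.endpoint_im, ← mul_assoc, hσσ, one_mul]
      exact ⟨K.length_mul_sin_le_pi, le_rfl⟩⟩ hζ
  have him₀ : |ζ.im| = σ * ζ.im := by
    rw [← abs_of_nonneg ((mul_nonneg K.length_pos.le K.sin_pos.le).trans him.1), abs_mul, hσ,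
      one_mul]
  exact ⟨hre, him₀ ▸ him.1, by linarith [him₀ ▸ him.2, Real.pi_lt_d2]⟩

theorem segment_side_subset : segment ℝ (K.L * K.direction σ) (K.endpoint σ) ⊆ S.domain :=
  fun ζ hζ ↦ by
    obtain ⟨hre, him, him'⟩ := K.re_im_of_mem_segment_side hσ hζ
    exact K.side_mem ζ hre him him'

theorem exists_norm_segmentIntegral_side_le : ∃ C, ∀ n : ℕ, ∀ w ∈ Set.Icc 0 v₂,
    d₀ ≤ 1 - w * b₁ → ‖segmentIntegral (kern f T G b₀ n w) (K.L * K.direction σ) (K.endpoint σ)‖ ≤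
      C * Real.exp (-(K.κ * n)) := by
  have hside := K.segment_side_subset hσ
  obtain ⟨B, hB⟩ := (isCompact_segment (K.L * K.direction σ) (K.endpoint σ))
    |>.exists_bound_of_continuousOn (S.differentiableOn_f.continuousOn.mono hside)
  obtain ⟨M, hM⟩ := (isCompact_segment (K.L * K.direction σ) (K.endpoint σ))
    |>.exists_bound_of_continuousOn
      ((S.differentiableOn_T.continuousOn.mono hside).sub (continuousOn_const (c := T 0)))
  refine ⟨B * Real.exp (v₂ * M) * ‖K.endpoint σ - K.L * K.direction σ‖, fun n w hw hd ↦
    (norm_segmentIntegral_le fun ζ hζ ↦ norm_kern_le (c := -K.κ) hw (hB ζ hζ) (hM ζ hζ) ?_).trans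
      (le_of_eq ?_)⟩
  · obtain ⟨hre, him, him'⟩ := K.re_im_of_mem_segment_side hσ hζ
    exact K.side_le ζ hre him him' w hw hd
  · rw [show (n : ℝ) * -K.κ = -(K.κ * n) by ring]
    ring

end Sides

theorem norm_kern_regular_le_of_mem_chord {w : ℝ} {ζ : ℂ} (n : ℕ) (hw : w ∈ Set.Icc 0 v₂)
    (hd : d₀ ≤ 1 - w * b₁)
    (hζ : ζ ∈ segment ℝ (K.L * K.direction (-1)) (K.L * K.direction 1)) :
    ‖kern S.p T S.Q b₀ n w ζ‖ ≤
      K.M * Real.exp (v₂ * K.M) * Real.exp (n * -(3 / 4 * d₀ * (K.L * Real.cos K.ψ))) := by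
  have hL : ‖ζ‖ ≤ K.L := mem_closedBall_zero_iff.1 <| (convex_closedBall 0 K.L).segment_subset
    (mem_closedBall_zero_iff.2 (K.norm_ofReal_mul_direction K.length_pos.le _).le)
    (mem_closedBall_zero_iff.2 (K.norm_ofReal_mul_direction K.length_pos.le _).le) hζ
  have hr := hL.trans_lt K.length_lt
  have hre : ζ.re = K.L * Real.cos K.ψ :=
    (convex_hyperplane (r := K.L * Real.cos K.ψ) Complex.reLm.isLinear).segment_subset
      (K.length_mul_direction_re (by rw [abs_neg, abs_one])) (K.length_mul_direction_re abs_one) hζ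
  refine norm_kern_le hw (K.localBounds.p_le ζ hr) (K.localBounds.T_sub ζ hr) ?_
  rw [← hre]
  refine K.re_exponent_Q_le hw hd hr ?_
  rw [hre]
  exact mul_le_mul_of_nonneg_right hL K.cos_pos.le

theorem exists_norm_segmentIntegral_regular_sub_le : ∃ C, ∀ n : ℕ, ∀ w ∈ Set.Icc 0 v₂,
    d₀ ≤ 1 - w * b₁ → ‖segmentIntegral (kern S.p T S.Q b₀ n w) 0 (K.L * K.direction 1) -
      segmentIntegral (kern S.p T S.Q b₀ n w) 0 (K.L * K.direction (-1))‖ ≤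
        C * Real.exp (-(3 / 4 * d₀ * (K.L * Real.cos K.ψ) * n)) := by
  refine ⟨K.M * Real.exp (v₂ * K.M) * ‖K.L * K.direction 1 - K.L * K.direction (-1)‖,
    fun n w hw hd ↦ ?_⟩
  have hball : ∀ σ : ℝ, K.L * K.direction σ ∈ Metric.ball (0 : ℂ) S.radius := fun σ ↦ by
    rw [mem_ball_zero_iff, K.norm_ofReal_mul_direction K.length_pos.le]
    exact K.length_lt.trans_le K.localBounds.le_radius
  have hchord := segmentIntegral_add_of_convex (convex_ball 0 S.radius) Metric.isOpen_ball
    (differentiableOn_kern S.differentiableOn_p S.differentiableOn_T_ball S.differentiableOn_Q b₀ n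
      w) (Metric.mem_ball_self S.radius_pos) (hball (-1)) (hball 1)
  rw [← hchord, add_sub_cancel_left]
  refine (norm_segmentIntegral_le fun ζ hζ ↦
    K.norm_kern_regular_le_of_mem_chord n hw hd hζ).trans (le_of_eq ?_)
  rw [mul_neg, mul_comm (n : ℝ)]
  ring

section Deformation

include K

theorem sub_ofReal_mem_tiltedStrip {σ ε : ℝ} {ζ : ℂ} (hε : 0 < ε)
    (hre : ζ.re ≤ K.L * Real.cos K.ψ) (him : σ * ζ.im < 7 / 2)
    (hζ : ζ.re * Real.sin S.φ ≤ σ * ζ.im * Real.cos S.φ) :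
    ζ - (ε : ℝ) ∈ tiltedStrip S.φ K.ρ σ := by
  have hsin : 0 < Real.sin S.φ :=
    Real.sin_pos_of_pos_of_lt_pi S.angle_pos (by linarith [S.angle_lt, Real.pi_pos])
  have hεsin := mul_pos hε hsin
  simp only [tiltedStrip, Set.mem_ofPred_eq, Complex.sub_re, Complex.sub_im, Complex.ofReal_re,
    Complex.ofReal_im, sub_zero]
  exact ⟨by linarith, by linarith [K.side_lt], him⟩

theorem exists_eq_ofReal_mul_direction {σ : ℝ} {ζ : ℂ}
    (hζ : ζ ∈ segment ℝ 0 (K.L * K.direction σ)) :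
    ∃ x ∈ Set.Icc 0 K.L, ζ = x * K.direction σ := by
  rw [segment_eq_image] at hζ
  obtain ⟨t, ht, rfl⟩ := hζ
  have hL := K.length_pos.le
  refine ⟨t * K.L, ⟨mul_nonneg ht.1 hL, mul_le_of_le_one_left hL ht.2⟩, ?_⟩
  simp [mul_assoc]

variable {σ : ℝ} (hσ : |σ| = 1)

include hσ

theorem vertex_sub_ofReal_mem_tiltedStrip {ε : ℝ} (hε : 0 < ε) : ∀ z ∈ ({0, K.L * K.direction σ,
    K.endpoint σ, ((σ * Real.pi : ℝ) : ℂ) * Complex.I} : Set ℂ),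
      z - (ε : ℝ) ∈ tiltedStrip S.φ K.ρ σ := by
  have hσσ (x : ℝ) : σ * (σ * x) = x := by
    rw [← mul_assoc, ← abs_mul_abs_self, hσ, one_mul, one_mul]
  have hx := K.length_mul_cos_pos
  have hcos := S.cos_pos
  have hpi : Real.pi < 7 / 2 := by linarith [Real.pi_lt_d2]
  have hsin : K.L * Real.cos K.ψ * Real.sin S.φ ≤ Real.pi * Real.cos S.φ := by
    have h := mul_le_of_le_one_right hx.le (Real.sin_le_one S.φ)
    have hpi' := mul_le_mul_of_nonneg_right (one_le_two.trans Real.two_le_pi) hcos.le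
    linarith [K.length_mul_cos_le_cos]
  rintro z (rfl | rfl | rfl | rfl)
  · exact K.sub_ofReal_mem_tiltedStrip hε (by simpa using hx.le) (by norm_num) (by simp)
  · have him : σ * (K.L * K.direction σ).im = K.L * Real.sin K.ψ := by
      rw [K.length_mul_direction_im hσ, hσσ]
    have hre := K.length_mul_direction_re hσ
    refine K.sub_ofReal_mem_tiltedStrip hε hre.le (him ▸ K.length_mul_sin_le_pi.trans_lt hpi) ?_
    have hangle := Real.sin_nonneg_of_nonneg_of_le_pi (x := K.ψ - S.φ) (by linarith [K.lt_angle])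
      (by linarith [K.angle_lt, S.angle_pos, Real.pi_pos])
    rw [Real.sin_sub] at hangle
    rw [him, hre]
    linarith [mul_nonneg K.length_pos.le hangle]
  · have him : σ * (K.endpoint σ).im = Real.pi := by rw [K.endpoint_im, hσσ]
    have hre := K.endpoint_re σ
    exact K.sub_ofReal_mem_tiltedStrip hε hre.le (him ▸ hpi) (by rw [him, hre]; exact hsin)
  · have him : σ * (((σ * Real.pi : ℝ) : ℂ) * Complex.I).im = Real.pi := by
      rw [Complex.im_ofReal_mul, Complex.I_im, mul_one, hσσ]
    have hre : (((σ * Real.pi : ℝ) : ℂ) * Complex.I).re = 0 := by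
      rw [Complex.re_ofReal_mul, Complex.I_re, mul_zero]
    refine K.sub_ofReal_mem_tiltedStrip hε (hre.trans_le hx.le) (him.trans_lt hpi) ?_
    rw [him, hre, zero_mul]
    positivity

theorem mem_domain_of_mem_segment {ζ : ℂ} (hζ : ζ ∈ segment ℝ 0 (K.L * K.direction σ))
    (hζ₀ : ζ ≠ 0) : ζ ∈ S.domain := by
  obtain ⟨x, hx, rfl⟩ := K.exists_eq_ofReal_mul_direction hζ
  refine K.ofReal_mul_direction_mem_domain hσ ⟨hx.1.lt_of_ne fun h ↦ hζ₀ ?_, hx.2⟩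
  rw [← h, Complex.ofReal_zero, zero_mul]

theorem sub_ofReal_mem_wedge_of_mem_segment {ε : ℝ} (hε : ε ∈ Set.Ioo 0 (K.r - K.L)) {ζ : ℂ}
    (hζ : ζ ∈ segment ℝ 0 (K.L * K.direction σ)) :
    ζ - (ε : ℝ) ∈ wedge S.φ ∧ ‖ζ - (ε : ℝ)‖ < K.r := by
  obtain ⟨x, hx, rfl⟩ := K.exists_eq_ofReal_mul_direction hζ
  have hnorm := K.norm_ofReal_mul_direction hx.1 σ
  have hcos : Real.cos S.φ < 1 := by
    rw [← Real.cos_zero]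
    exact Real.cos_lt_cos_of_nonneg_of_le_pi_div_two le_rfl S.angle_lt.le S.angle_pos
  refine ⟨?_, ?_⟩
  · have hsub := norm_sub_norm_le (x * K.direction σ) (ε : ℝ)
    rw [hnorm, Complex.norm_of_nonneg hε.1.le] at hsub
    rw [wedge, Set.mem_ofPred_eq, Complex.sub_re, Complex.re_ofReal_mul, K.direction_re hσ,
      Complex.ofReal_re]
    linarith [mul_le_mul_of_nonneg_left K.cos_lt_cos.le hx.1, mul_pos hε.1 (sub_pos.2 hcos),
      mul_le_mul_of_nonneg_right hsub S.cos_pos.le]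
  · refine (norm_sub_le _ _).trans_lt ?_
    rw [hnorm, Complex.norm_of_nonneg hε.1.le]
    linarith [hε.2, hx.2]

omit hσ

theorem eq_segmentIntegral_legs_add_sides {n : ℕ} {w : ℝ} {C : ℂ} (hw : w ∈ Set.Icc 0 v₂)
    (hC : ∀ ε : ℝ, 0 < ε → segmentIntegral (kern f T G b₀ n w) (-(ε : ℂ))
      (-(ε : ℂ) + 2 * Real.pi * Complex.I) = C) :
    C = segmentIntegral (kern f T G b₀ n w) 0 (K.L * K.direction 1) +
        segmentIntegral (kern f T G b₀ n w) (K.L * K.direction 1) (K.endpoint 1) -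
      (segmentIntegral (kern f T G b₀ n w) 0 (K.L * K.direction (-1)) +
        segmentIntegral (kern f T G b₀ n w) (K.L * K.direction (-1)) (K.endpoint (-1))) := by
  have hσ₁ : |(1 : ℝ)| = 1 := abs_one
  have hσ₂ : |(-1 : ℝ)| = 1 := by rw [abs_neg, abs_one]
  obtain ⟨B, hB⟩ := K.localBounds.exists_norm_kern_le n hw
  have hbound {σ : ℝ} (hσ : |σ| = 1) : ∀ ε ∈ Set.Ioo 0 (K.r - K.L),
      ∀ z ∈ segment ℝ 0 (K.L * K.direction σ), ‖kern f T G b₀ n w (z - (ε : ℝ))‖ ≤ B :=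
    fun ε hε z hz ↦ hB _ (K.sub_ofReal_mem_wedge_of_mem_segment hσ hε hz).1
      (K.sub_ofReal_mem_wedge_of_mem_segment hσ hε hz).2
  rw [← K.endpoint_sub_period]
  refine eq_segmentIntegral_legs (t := ((1 * Real.pi : ℝ) : ℂ) * Complex.I) S.isOpen
    (differentiableOn_kern S.differentiableOn_f S.differentiableOn_T S.differentiableOn_G b₀ n w)
    (kern_periodic S.periodic_f S.periodic_T S.periodic_G Complex.exp_two_pi_mul_I b₀ n w)
    (convex_tiltedStrip S.φ K.ρ 1) (isOpen_tiltedStrip S.φ K.ρ 1) K.strip_subset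
    (convex_tiltedStrip S.φ K.ρ (-1)) (isOpen_tiltedStrip S.φ K.ρ (-1)) K.strip_subset'
    (convex_halfSpace_lt Complex.reLm.isLinear 0)
    (isOpen_lt Complex.continuous_re continuous_const) S.left_subset (sub_pos.2 K.length_lt)
    (fun ε hε ↦ K.vertex_sub_ofReal_mem_tiltedStrip hσ₁ hε.1) ?_ ?_
    (fun z ↦ K.mem_domain_of_mem_segment hσ₁) (fun z ↦ K.mem_domain_of_mem_segment hσ₂)
    (hbound hσ₁) (hbound hσ₂) (K.segment_side_subset hσ₁) ?_ ?_
  · intro ε hε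
    rw [K.endpoint_sub_period, show ((1 * Real.pi : ℝ) : ℂ) * Complex.I - 2 * Real.pi * Complex.I =
      ((-1 * Real.pi : ℝ) : ℂ) * Complex.I by push_cast; ring]
    exact K.vertex_sub_ofReal_mem_tiltedStrip hσ₂ hε.1
  · rintro ε hε z (rfl | rfl | rfl) <;> simpa using hε.1
  · rw [K.endpoint_sub_period]
    exact K.segment_side_subset hσ₂
  · intro ε hε
    rw [zero_sub]
    exact hC ε hε.1

end Deformation

end SingularData.Contour

namespace SingularData

variable {f T G : ℂ → ℂ} {b₀ b₁ q v₂ d₀ : ℝ} {a c : ℂ} {S : SingularData f T G b₀ b₁ q a c}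

namespace Contour

variable (K : S.Contour v₂ d₀)

theorem segmentIntegral_leg_sub {σ w : ℝ} (hσ : |σ| = 1) (n : ℕ) (hw : w ∈ Set.Icc 0 v₂) :
    segmentIntegral (kern f T G b₀ n w) 0 (K.L * K.direction σ) -
        segmentIntegral (kern S.p T S.Q b₀ n w) 0 (K.L * K.direction σ) =
      segmentIntegral (kern f T G b₀ n w - kern S.p T S.Q b₀ n w) 0 (K.L * K.direction σ) := by
  have hlt : ∀ z ∈ segment ℝ 0 (K.L * K.direction σ), ‖z‖ < K.r := fun z hz ↦ by
    obtain ⟨x, hx, rfl⟩ := K.exists_eq_ofReal_mul_direction hz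
    exact (K.norm_ofReal_mul_direction hx.1 σ).trans_lt (hx.2.trans_lt K.length_lt)
  obtain ⟨B, hB⟩ := K.localBounds.exists_norm_kern_le n hw
  refine segmentIntegral_sub (differentiableOn_kern S.differentiableOn_f S.differentiableOn_T
      S.differentiableOn_G b₀ n w).continuousOn
    ((differentiableOn_kern S.differentiableOn_p S.differentiableOn_T_ball S.differentiableOn_Q b₀
      n w).continuousOn.mono fun z hz ↦ mem_ball_zero_iff.2 ((hlt z hz).trans_le
        K.localBounds.le_radius))
    (fun z ↦ K.mem_domain_of_mem_segment hσ) (M := B) fun z hz hz₀ ↦ hB z ?_ (hlt z hz)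
  obtain ⟨x, hx, rfl⟩ := K.exists_eq_ofReal_mul_direction hz
  have hx₀ : x ≠ 0 := fun h ↦ hz₀ (by rw [h, Complex.ofReal_zero, zero_mul])
  exact ofReal_mul_mem_wedge (hx.1.lt_of_ne' hx₀) (K.direction_mem_wedge hσ)

theorem eq_leg_sub_add_chord_add_sides {n : ℕ} {w : ℝ} {C : ℂ} (hw : w ∈ Set.Icc 0 v₂)
    (hC : ∀ ε : ℝ, 0 < ε → segmentIntegral (kern f T G b₀ n w) (-(ε : ℂ))
      (-(ε : ℂ) + 2 * Real.pi * Complex.I) = C) :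
    C = segmentIntegral (kern f T G b₀ n w - kern S.p T S.Q b₀ n w) 0 (K.L * K.direction 1) -
        segmentIntegral (kern f T G b₀ n w - kern S.p T S.Q b₀ n w) 0 (K.L * K.direction (-1)) +
      (segmentIntegral (kern S.p T S.Q b₀ n w) 0 (K.L * K.direction 1) -
        segmentIntegral (kern S.p T S.Q b₀ n w) 0 (K.L * K.direction (-1))) +
      segmentIntegral (kern f T G b₀ n w) (K.L * K.direction 1) (K.endpoint 1) -
      segmentIntegral (kern f T G b₀ n w) (K.L * K.direction (-1)) (K.endpoint (-1)) := by
  rw [K.eq_segmentIntegral_legs_add_sides hw hC, ← K.segmentIntegral_leg_sub abs_one n hw,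
    ← K.segmentIntegral_leg_sub (by rw [abs_neg, abs_one]) n hw]
  ring

theorem rayIntegral_direction_sub {s d : ℝ} (hs : -1 < s) (hd : 0 < d) :
    rayIntegral s d (K.direction 1) - rayIntegral s d (K.direction (-1)) =
      2 * Real.pi * Complex.I * ((d ^ (-s - 1) / Real.Gamma (-s) : ℝ) : ℂ) := by
  rw [direction, direction, one_mul, neg_one_mul]
  exact rayIntegral_sub hs hd (S.angle_pos.trans K.lt_angle) K.angle_lt

end Contour

theorem tendsto_rpow_mul_contourIntegral {ι : Type*} {l : Filter ι} [l.IsCountablyGenerated]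
    {N : ι → ℕ} {v : ι → ℝ} {vs : ℝ} {C : ι → ℂ} (S : SingularData f T G b₀ b₁ q a c)
    (hN : Tendsto N l atTop) (hv : Tendsto v l (𝓝 vs)) (hvs : 0 < vs) (hd : vs * b₁ < 1)
    (hC : ∀ i, ∀ ε : ℝ, 0 < ε → segmentIntegral (kern f T G b₀ (N i) (v i)) (-(ε : ℂ))
      (-(ε : ℂ) + 2 * Real.pi * Complex.I) = C i) :
    Tendsto (fun i ↦ (((N i : ℝ) ^ q : ℝ) : ℂ) * C i) l
      (𝓝 (2 * Real.pi * Complex.I *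
        (c * (((1 - vs * b₁) ^ (-q) / Real.Gamma (1 - q) : ℝ) : ℂ) +
          vs * a * (((1 - vs * b₁) ^ (-q - 1) / Real.Gamma (-q) : ℝ) : ℂ)))) := by
  have hd' := sub_pos.2 hd
  obtain ⟨K⟩ := S.nonempty_contour (v₂ := 2 * vs) (d₀ := (1 - vs * b₁) / 2) (by positivity)
    (by positivity)
  have hvI : ∀ᶠ i in l, v i ∈ Set.Icc 0 (2 * vs) ∧ (1 - vs * b₁) / 2 ≤ 1 - v i * b₁ :=
    (hv.eventually_mem (Icc_mem_nhds hvs (by linarith))).and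
      ((tendsto_const_nhds.sub (hv.mul_const b₁)).eventually_const_le (by linarith))
  have hσ : |(-1 : ℝ)| = 1 := by rw [abs_neg, abs_one]
  have hleg {σ : ℝ} (hσ : |σ| = 1) :=
    K.tendsto_rpow_mul_segmentIntegral_sub hσ hN hv hd' hvI (by positivity)
  have hside {σ : ℝ} (hσ : |σ| = 1) : Tendsto (fun i ↦ (((N i : ℝ) ^ q : ℝ) : ℂ) *
      segmentIntegral (kern f T G b₀ (N i) (v i)) (K.L * K.direction σ) (K.endpoint σ)) l
      (𝓝 0) := by
    obtain ⟨B, hB⟩ := K.exists_norm_segmentIntegral_side_le hσ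
    exact tendsto_rpow_mul_of_norm_le_exp hN K.κ_pos
      (hvI.mono fun i hi ↦ hB (N i) (v i) hi.1 hi.2) q
  obtain ⟨B, hB⟩ := K.exists_norm_segmentIntegral_regular_sub_le
  have hchord := tendsto_rpow_mul_of_norm_le_exp hN
    (mul_pos (mul_pos (by norm_num) K.d₀_pos) K.length_mul_cos_pos)
    (hvI.mono fun i hi ↦ hB (N i) (v i) hi.1 hi.2) q
  have hsum := (((hleg abs_one).sub (hleg hσ)).add hchord).add ((hside abs_one).sub (hside hσ))
  have hlimit : c * (rayIntegral (q - 1) (1 - vs * b₁) (K.direction 1) -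
        rayIntegral (q - 1) (1 - vs * b₁) (K.direction (-1))) +
      vs * a * (rayIntegral q (1 - vs * b₁) (K.direction 1) -
        rayIntegral q (1 - vs * b₁) (K.direction (-1))) = 2 * Real.pi * Complex.I *
        (c * (((1 - vs * b₁) ^ (-q) / Real.Gamma (1 - q) : ℝ) : ℂ) +
          vs * a * (((1 - vs * b₁) ^ (-q - 1) / Real.Gamma (-q) : ℝ) : ℂ)) := by
    rw [K.rayIntegral_direction_sub (by linarith [S.one_lt]) hd',
      K.rayIntegral_direction_sub (by linarith [S.one_lt]) hd',
      show -(q - 1) - 1 = -q by ring, neg_sub]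
    ring
  rw [← hlimit]
  refine (hsum.congr' ?_).trans_eq ?_
  · filter_upwards [hvI] with i hi
    rw [K.eq_leg_sub_add_chord_add_sides hi.1 (hC i)]
    ring
  · congr 1
    ring

end SingularData

section Domain

variable {R η φ : ℝ}

theorem mem_Delta0_iff (hφ : 0 < φ) (hφ' : φ < Real.pi / 2) {z : ℂ} :
    z ∈ Delta0 R η φ ↔
      ‖z‖ < ‖(R : ℂ) * (1 + η * Complex.exp (φ * Complex.I))‖ ∧ z - R ∈ wedge φ := by
  rw [Delta0, Set.mem_ofPred_eq, wedge, Set.mem_ofPred_eq]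
  refine and_congr_right fun _ ↦ ?_
  by_cases hz : z = R
  · simp [hz]
  have hnorm : 0 < ‖z - R‖ := norm_pos_iff.2 (sub_ne_zero.2 hz)
  have hcos : φ < |Complex.arg (z - R)| ↔ Real.cos |Complex.arg (z - R)| < Real.cos φ :=
    (Real.strictAntiOn_cos.lt_iff_gt ⟨abs_nonneg _, Complex.abs_arg_le_pi _⟩
      ⟨hφ.le, by linarith [Real.pi_pos]⟩).symm
  rw [hcos, Real.cos_abs, ← Complex.norm_mul_cos_arg (z - R), mul_lt_mul_iff_right₀ hnorm]
  simp [hz]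

theorem isOpen_Delta0 (hφ : 0 < φ) (hφ' : φ < Real.pi / 2) : IsOpen (Delta0 R η φ) := by
  have heq : Delta0 R η φ = {z | ‖z‖ < ‖(R : ℂ) * (1 + η * Complex.exp (φ * Complex.I))‖} ∩
      {z : ℂ | (z - R).re < ‖z - R‖ * Real.cos φ} := Set.ext fun z ↦ mem_Delta0_iff hφ hφ'
  rw [heq]
  exact (isOpen_lt (by fun_prop) (by fun_prop)).inter (isOpen_lt (by fun_prop) (by fun_prop))

section

variable (hR : 0 < R) (hη : 0 < η) (hφ : 0 < φ) (hφ' : φ < Real.pi / 2)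

include hR hη hφ hφ'

theorem lt_norm_outer_radius : R < ‖(R : ℂ) * (1 + η * Complex.exp (φ * Complex.I))‖ := by
  have hcos : 0 < Real.cos φ := Real.cos_pos_of_mem_Ioo ⟨by linarith, hφ'⟩
  have hre : (1 + η * Complex.exp (φ * Complex.I)).re = 1 + η * Real.cos φ := by
    rw [Complex.add_re, Complex.re_ofReal_mul, Complex.exp_ofReal_mul_I_re, Complex.one_re]
  rw [norm_mul, Complex.norm_real, Real.norm_of_nonneg hR.le]
  refine lt_mul_of_one_lt_right hR (lt_of_lt_of_le ?_ (Complex.re_le_norm _))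
  rw [hre]
  exact lt_add_of_pos_right 1 (mul_pos hη hcos)

theorem mem_Delta0_of_norm_le {z : ℂ} (hz : ‖z‖ ≤ R) (hre : z.re < R) : z ∈ Delta0 R η φ :=
  (mem_Delta0_iff hφ hφ').2 ⟨hz.trans_lt (lt_norm_outer_radius hR hη hφ hφ'),
    mem_wedge_of_re_neg (Real.cos_nonneg_of_mem_Icc ⟨by linarith, hφ'.le⟩) (by simpa using hre)⟩

theorem ball_subset_Delta0 : Metric.ball 0 R ⊆ Delta0 R η φ := fun z hz ↦ by
  rw [mem_ball_zero_iff] at hz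
  exact mem_Delta0_of_norm_le hR hη hφ hφ' hz.le ((Complex.re_le_norm z).trans_lt hz)

theorem tendsto_ofReal_nhdsWithin_Delta0 :
    Tendsto (fun r : ℝ ↦ (r : ℂ)) (𝓝[<] R) (𝓝[Delta0 R η φ] (R : ℂ)) := by
  refine tendsto_nhdsWithin_iff.2
    ⟨(Complex.continuous_ofReal.tendsto R).mono_left nhdsWithin_le_nhds, ?_⟩
  filter_upwards [Ioo_mem_nhdsLT hR] with r hr
  refine ball_subset_Delta0 hR hη hφ hφ' ?_
  rw [mem_ball_zero_iff, Complex.norm_real, Real.norm_of_nonneg hr.1.le]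
  exact hr.2

omit hη hφ hφ' in
theorem norm_mul_exp (ζ : ℂ) : ‖(R * Complex.exp ζ : ℂ)‖ = R * Real.exp ζ.re := by
  rw [norm_mul, Complex.norm_real, Real.norm_of_nonneg hR.le, Complex.norm_exp]

theorem mul_exp_mem_Delta0_of_re_neg {ζ : ℂ} (hζ : ζ.re < 0) :
    (R * Complex.exp ζ : ℂ) ∈ Delta0 R η φ := by
  refine ball_subset_Delta0 hR hη hφ hφ' ?_
  rw [mem_ball_zero_iff, norm_mul_exp hR]
  exact mul_lt_of_lt_one_right hR (Real.exp_lt_one_iff.2 hζ)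

theorem mul_exp_mul_I_mem_Delta0 {y : ℝ} (hy : Real.cos y ≠ 1) :
    (R * Complex.exp (y * Complex.I) : ℂ) ∈ Delta0 R η φ := by
  refine mem_Delta0_of_norm_le hR hη hφ hφ' (by rw [norm_mul_exp hR]; simp) ?_
  rw [Complex.re_ofReal_mul, Complex.exp_ofReal_mul_I_re]
  exact mul_lt_of_lt_one_right hR ((Real.cos_le_one y).lt_of_ne hy)

end

theorem cos_ne_one_of_abs_le {y : ℝ} (hy : y ≠ 0) (hy' : |y| ≤ 7 / 2) : Real.cos y ≠ 1 := by
  have := abs_le.1 hy'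
  have := Real.pi_gt_three
  rwa [Ne, Real.cos_eq_one_iff_of_lt_of_lt (by linarith) (by linarith)]

variable {φ₁ : ℝ} (hφ : 0 < φ) (hφφ₁ : φ < φ₁) (hφ₁ : φ₁ < Real.pi / 2)

include hφ hφφ₁ hφ₁

theorem eventually_exp_sub_one_mem_wedge :
    ∀ᶠ ζ in 𝓝[wedge φ₁] (0 : ℂ), Complex.exp ζ - 1 ∈ wedge φ := by
  have hcos : Real.cos φ₁ < Real.cos φ :=
    Real.cos_lt_cos_of_nonneg_of_le_pi_div_two hφ.le hφ₁.le hφφ₁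
  have hk : 0 < (Real.cos φ - Real.cos φ₁) / 3 := by linarith
  have hexp : ∀ᶠ ζ in 𝓝 (0 : ℂ),
      ‖Complex.exp ζ - 1 - ζ‖ ≤ (Real.cos φ - Real.cos φ₁) / 3 * ‖ζ‖ := by
    simpa using (hasDerivAt_iff_isLittleO.1 (Complex.hasDerivAt_exp 0)).def hk
  filter_upwards [nhdsWithin_le_nhds hexp, self_mem_nhdsWithin] with ζ hζ hw
  refine closedBall_subset_wedge (Real.cos_nonneg_of_mem_Icc ⟨by linarith, hφ₁.le⟩) hk
    (by linarith) (norm_pos_iff.1 (norm_pos_of_mem_wedge hw)) (le_of_lt hw) ?_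
  rwa [Metric.mem_closedBall, dist_eq_norm]

theorem tendsto_mul_exp_nhdsWithin_Delta0 (hR : 0 < R) (hη : 0 < η) :
    Tendsto (fun ζ : ℂ ↦ R * Complex.exp ζ) (𝓝[wedge φ₁] 0) (𝓝[Delta0 R η φ] (R : ℂ)) := by
  have hφ' := hφφ₁.trans hφ₁
  have hcont : Continuous fun ζ : ℂ ↦ (R : ℂ) * Complex.exp ζ := by fun_prop
  have hlim := hcont.tendsto 0
  rw [Complex.exp_zero, mul_one] at hlim
  replace hlim := hlim.mono_left (nhdsWithin_le_nhds (s := wedge φ₁))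
  have hnorm := hlim.norm
  rw [Complex.norm_real, Real.norm_of_nonneg hR.le] at hnorm
  refine tendsto_nhdsWithin_iff.2 ⟨hlim, ?_⟩
  filter_upwards [eventually_exp_sub_one_mem_wedge hφ hφφ₁ hφ₁,
    hnorm.eventually_lt_const (lt_norm_outer_radius hR hη hφ hφ')] with ζ hw hζ
  refine (mem_Delta0_iff hφ hφ').2 ⟨hζ, ?_⟩
  rw [← mul_sub_one]
  exact ofReal_mul_mem_wedge hR hw

end Domain

section Expansion

/-- The function `g` has at `R`, along `D`, the singular expansion
`∑_{n < m} p_n (1 - z / R)^n + a (1 - z / R)^s + o(|1 - z / R|^s)`. -/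
def HasSingularExpansion (g : ℂ → ℂ) (D : Set ℂ) (R : ℝ) (p : ℕ → ℂ) (m : ℕ) (a : ℂ) (s : ℝ) :
    Prop :=
  (fun z ↦ g z - ((∑ n ∈ Finset.range m, p n * (1 - z / R) ^ n) + a * (1 - z / R) ^ (s : ℂ)))
    =o[𝓝[D] (R : ℂ)] fun z : ℂ ↦ ‖1 - z / R‖ ^ s

/-- The sum `∑_{n < m} p_n (1 - e^ζ)^n`, that is, the regular part of a singular expansion in the
coordinate `z = R e^ζ`. -/
noncomputable def expPoly (p : ℕ → ℂ) (m : ℕ) (ζ : ℂ) : ℂ :=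
  ∑ n ∈ Finset.range m, p n * (1 - Complex.exp ζ) ^ n

variable {p : ℕ → ℂ} {m : ℕ}

theorem differentiable_expPoly : Differentiable ℂ (expPoly p m) := by
  unfold expPoly
  fun_prop

theorem expPoly_zero (hm : 0 < m) : expPoly p m 0 = p 0 := by
  rw [expPoly, Finset.sum_eq_single_of_mem 0 (by simpa using hm) (fun n _ hn ↦ by simp [hn])]
  simp

theorem hasDerivAt_expPoly_zero (hm : 1 < m) : HasDerivAt (expPoly p m) (-p 1) 0 := by
  have hderiv : HasDerivAt (expPoly p m) (∑ n ∈ Finset.range m,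
      p n * (n * (1 - Complex.exp 0) ^ (n - 1) * (-Complex.exp 0))) 0 :=
    HasDerivAt.fun_sum fun n _ ↦
      (((Complex.hasDerivAt_exp 0).const_sub 1).fun_pow n).const_mul (p n)
  rw [Finset.sum_eq_single_of_mem 1 (by simpa using hm)] at hderiv
  · simpa using hderiv
  · intro n _ hn
    rcases n.eq_zero_or_pos with rfl | hn₀
    · simp
    · simp [show n - 1 ≠ 0 by lia]

variable {g : ℂ → ℂ} {R s : ℝ} {a : ℂ}

theorem tendsto_one_sub_div (hR : R ≠ 0) (D : Set ℂ) :
    Tendsto (fun z : ℂ ↦ 1 - z / R) (𝓝[D] (R : ℂ)) (𝓝 0) := by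
  have hcont : Continuous fun z : ℂ ↦ 1 - z / R := by fun_prop
  have h := hcont.tendsto R
  rw [div_self (Complex.ofReal_ne_zero.2 hR), sub_self] at h
  exact h.mono_left nhdsWithin_le_nhds

namespace HasSingularExpansion

theorem of_isBigO {D : Set ℂ} {δ : ℝ} (hR : R ≠ 0) (hs : 0 ≤ s) (hδ : 0 < δ)
    (hg : (fun z ↦ g z - ((∑ n ∈ Finset.range m, p n * (1 - z / R) ^ n) +
      a * (1 - z / R) ^ (s : ℂ))) =O[𝓝[D] (R : ℂ)] fun z : ℂ ↦ ‖1 - z / R‖ ^ (s + δ)) :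
    HasSingularExpansion g D R p m a s :=
  hg.trans_isLittleO (isLittleO_norm_rpow (tendsto_one_sub_div hR D) hs (lt_add_of_pos_right s hδ))

theorem tendsto {D : Set ℂ} (h : HasSingularExpansion g D R p m a s) (hR : R ≠ 0) (hs : 0 < s)
    (hm : 0 < m) : Tendsto g (𝓝[D] (R : ℂ)) (𝓝 (p 0)) := by
  have hu := tendsto_one_sub_div hR D
  have hrpow := hu.norm.rpow_const (p := s) (Or.inr hs.le)
  rw [norm_zero, Real.zero_rpow hs.ne'] at hrpow
  have hcpow : Tendsto (fun z : ℂ ↦ (1 - z / R) ^ (s : ℂ)) (𝓝[D] (R : ℂ)) (𝓝 0) :=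
    tendsto_zero_iff_norm_tendsto_zero.2 (by simpa only [Complex.norm_cpow_real] using hrpow)
  have hsum : Tendsto (fun z : ℂ ↦ ∑ n ∈ Finset.range m, p n * (1 - z / R) ^ n) (𝓝[D] (R : ℂ))
      (𝓝 (∑ n ∈ Finset.range m, p n * 0 ^ n)) :=
    tendsto_finsetSum _ fun n _ ↦ (hu.pow n).const_mul (p n)
  rw [Finset.sum_eq_single_of_mem 0 (by simpa using hm) (fun n _ hn ↦ by simp [hn])] at hsum
  have hlim := (IsLittleO.trans_tendsto h hrpow).add (hsum.add (hcpow.const_mul a))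
  simpa using hlim

variable {η φ φ₁ : ℝ}

theorem comp_mul_exp (h : HasSingularExpansion g (Delta0 R η φ) R p m a s) (hR : 0 < R)
    (hη : 0 < η) (hφ : 0 < φ) (hφφ₁ : φ < φ₁) (hφ₁ : φ₁ < Real.pi / 2) (hs : 0 ≤ s) :
    (fun ζ ↦ g (R * Complex.exp ζ) - expPoly p m ζ - a * (1 - Complex.exp ζ) ^ (s : ℂ))
      =o[𝓝[wedge φ₁] 0] fun ζ ↦ ‖ζ‖ ^ s := by
  have hdiv (ζ : ℂ) : 1 - R * Complex.exp ζ / R = 1 - Complex.exp ζ := by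
    rw [mul_div_cancel_left₀ _ (Complex.ofReal_ne_zero.2 hR.ne')]
  have hcomp := IsLittleO.comp_tendsto h (tendsto_mul_exp_nhdsWithin_Delta0 hφ hφφ₁ hφ₁ hR hη)
  simp only [Function.comp_def, hdiv] at hcomp
  refine (hcomp.congr_left fun ζ ↦ ?_).trans_isBigO
    (((isBigO_one_sub_exp_cpow hs).mono nhdsWithin_le_nhds).norm_left.congr_left fun ζ ↦ ?_)
  · rw [expPoly, sub_sub]
  · exact Complex.norm_cpow_real _ _

theorem comp_mul_exp_of_le (h : HasSingularExpansion g (Delta0 R η φ) R p m a s) (hR : 0 < R)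
    (hη : 0 < η) (hφ : 0 < φ) (hφφ₁ : φ < φ₁) (hφ₁ : φ₁ < Real.pi / 2) {u : ℝ} (hu : 0 ≤ u)
    (hus : u ≤ s) :
    (fun ζ ↦ g (R * Complex.exp ζ) - expPoly p m ζ -
      (if u = s then a else 0) * (1 - Complex.exp ζ) ^ (u : ℂ))
      =o[𝓝[wedge φ₁] 0] fun ζ ↦ ‖ζ‖ ^ u := by
  have hexp := h.comp_mul_exp hR hη hφ hφφ₁ hφ₁ (hu.trans hus)
  rcases hus.eq_or_lt with rfl | hlt
  · simpa using hexp
  · have hpow := ((isBigO_one_sub_exp_cpow (hu.trans hus)).mono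
      (nhdsWithin_le_nhds (s := wedge φ₁))).const_mul_left a
    have hsum := ((hexp.isBigO.add hpow).congr_left fun ζ ↦ sub_add_cancel _ _).trans_isLittleO
      (isLittleO_norm_rpow (tendsto_id'.2 nhdsWithin_le_nhds) hu hlt)
    simpa [hlt.ne] using hsum

end HasSingularExpansion

end Expansion

section Positivity

theorem genCoeff_nonneg {κ : ℕ → ℝ} (hκ : ∀ j, 1 ≤ j → 0 ≤ κ j) (j : ℕ) : 0 ≤ genCoeff κ j := by
  rcases j.eq_zero_or_pos with rfl | hj
  · simp [genCoeff]
  · exact div_nonneg (hκ j hj) (Nat.cast_nonneg _)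

theorem exists_dvd_iff_cos_eq_one (y : ℝ) : ∃ d : ℤ, ∀ n : ℤ, d ∣ n ↔ Real.cos (n * y) = 1 := by
  obtain ⟨d, hd⟩ := Int.subgroup_cyclic
    ((AddSubgroup.zmultiples (2 * Real.pi)).comap (zmultiplesHom ℝ y))
  refine ⟨d, fun n ↦ ?_⟩
  rw [← Int.mem_zmultiples_iff, AddSubgroup.zmultiples_eq_closure, ← hd, AddSubgroup.mem_comap,
    AddSubgroup.mem_zmultiples_iff, Real.cos_eq_one_iff]
  simp

theorem NonArithmetic.exists_cos_ne_one {κ : ℕ → ℝ} (hNA : NonArithmetic κ) {y : ℝ}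
    (hy : Real.cos y ≠ 1) : ∃ j : ℕ, 1 ≤ j ∧ κ j ≠ 0 ∧ Real.cos (j * y) ≠ 1 := by
  by_contra! hcos
  obtain ⟨d, hd⟩ := exists_dvd_iff_cos_eq_one y
  have hdvd : ∀ j : ℕ, 1 ≤ j → κ j ≠ 0 → d.natAbs ∣ j := fun j hj hκj ↦ by
    rw [← Int.natCast_dvd_natCast, Int.natAbs_dvd, hd]
    exact_mod_cast hcos j hj hκj
  obtain ⟨hprim, j, hj, hκj⟩ := hNA
  have hd_ne_zero : d.natAbs ≠ 0 := fun h ↦ by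
    have := hdvd j (by lia) hκj.ne'
    rw [h, zero_dvd_iff] at this
    lia
  have hd_le_one : ¬ 1 < d.natAbs := fun h ↦ hprim ⟨_, h, hdvd⟩
  have hd_dvd_one : d ∣ 1 := by
    rw [← Int.natAbs_dvd, show d.natAbs = 1 by lia, Nat.cast_one]
  rw [hd, Int.cast_one, one_mul] at hd_dvd_one
  exact hy hd_dvd_one

variable {b : ℕ → ℝ}

theorem re_add_le_re_of_hasSum (hb : ∀ k, 0 ≤ b k) {r y : ℝ} (hr : 0 ≤ r) {g₀ g₁ : ℂ}
    (h₀ : HasSum (fun k ↦ (b k : ℂ) * (r : ℂ) ^ k) g₀)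
    (h₁ : HasSum (fun k ↦ (b k : ℂ) * (r * Complex.exp (y * Complex.I)) ^ k) g₁) (j : ℕ) :
    g₁.re + b j * (1 - Real.cos (j * y)) * r ^ j ≤ g₀.re := by
  have hterm (k : ℕ) : ((b k : ℂ) * (r : ℂ) ^ k).re -
      ((b k : ℂ) * (r * Complex.exp (y * Complex.I)) ^ k).re =
        b k * (1 - Real.cos (k * y)) * r ^ k := by
    rw [mul_pow, ← Complex.exp_nat_mul, ← mul_assoc (k : ℂ), ← Complex.ofReal_natCast,
      ← Complex.ofReal_mul, ← Complex.ofReal_pow, Complex.re_ofReal_mul, Complex.re_ofReal_mul,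
      Complex.re_ofReal_mul, Complex.exp_ofReal_mul_I_re, Complex.ofReal_re]
    ring
  have hsum := (Complex.hasSum_re h₀).sub (Complex.hasSum_re h₁)
  simp only [hterm] at hsum
  have hle := le_hasSum hsum j fun k _ ↦ mul_nonneg
    (mul_nonneg (hb k) (sub_nonneg.2 (Real.cos_le_one _))) (pow_nonneg hr k)
  linarith

theorem re_lt_of_cos_ne_one (hb : ∀ k, 0 ≤ b k) {R : ℝ} (hR : 0 < R) {g : ℂ → ℂ}
    (hg : ∀ z : ℂ, ‖z‖ < R → HasSum (fun k ↦ (b k : ℂ) * z ^ k) (g z)) {b₀ : ℝ}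
    (hlim : Tendsto (fun r : ℝ ↦ g r) (𝓝[<] R) (𝓝 b₀)) {j : ℕ} (hj : b j ≠ 0) {y : ℝ}
    (hy : Real.cos (j * y) ≠ 1) (hc : ContinuousAt g (R * Complex.exp (y * Complex.I))) :
    (g (R * Complex.exp (y * Complex.I))).re < b₀ := by
  have hgap : 0 < b j * (1 - Real.cos (j * y)) * R ^ j :=
    mul_pos (mul_pos ((hb j).lt_of_ne' hj) (sub_pos.2 ((Real.cos_le_one _).lt_of_ne hy)))
      (pow_pos hR j)
  have hcircle : Tendsto (fun r : ℝ ↦ (g (r * Complex.exp (y * Complex.I))).re +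
      b j * (1 - Real.cos (j * y)) * r ^ j) (𝓝[<] R)
      (𝓝 ((g (R * Complex.exp (y * Complex.I))).re + b j * (1 - Real.cos (j * y)) * R ^ j)) := by
    have harg : Continuous fun r : ℝ ↦ (r * Complex.exp (y * Complex.I) : ℂ) := by fun_prop
    have hpow : Continuous fun r : ℝ ↦ b j * (1 - Real.cos (j * y)) * r ^ j := by fun_prop
    have hre := (Complex.continuous_re.tendsto _).comp (hc.tendsto.comp (harg.tendsto R))
    exact (hre.add (hpow.tendsto R)).mono_left nhdsWithin_le_nhds
  have hreal : Tendsto (fun r : ℝ ↦ (g r).re) (𝓝[<] R) (𝓝 b₀) :=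
    (Complex.continuous_re.tendsto _).comp hlim
  refine lt_of_lt_of_le (lt_add_of_pos_right _ hgap) (le_of_tendsto_of_tendsto hcircle hreal ?_)
  filter_upwards [Ioo_mem_nhdsLT hR] with r hr
  have hnorm : ‖(r : ℂ)‖ < R := by rw [Complex.norm_real, Real.norm_of_nonneg hr.1.le]; exact hr.2
  refine re_add_le_re_of_hasSum hb hr.1.le (hg r hnorm) (hg _ ?_) j
  rwa [norm_mul, Complex.norm_exp_ofReal_mul_I, mul_one]

end Positivity

section Transfer

variable {R η φ φ₁ : ℝ}

theorem exists_wedge_inter_ball_subset_preimage_Delta0 (hR : 0 < R) (hη : 0 < η) (hφ : 0 < φ)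
    (hφφ₁ : φ < φ₁) (hφ₁ : φ₁ < Real.pi / 2) :
    ∃ r > 0, wedge φ₁ ∩ Metric.ball 0 r ⊆
      (fun ζ : ℂ ↦ (R * Complex.exp ζ : ℂ)) ⁻¹' Delta0 R η φ := by
  have hmem := (tendsto_mul_exp_nhdsWithin_Delta0 hφ hφφ₁ hφ₁ hR hη).eventually
    self_mem_nhdsWithin
  obtain ⟨r, hr, hsub⟩ := Metric.mem_nhdsWithin_iff.1 hmem
  exact ⟨r, hr, fun ζ hζ ↦ hsub hζ.symm⟩

theorem exists_differentiableOn_comp_mul_exp_ball {g : ℂ → ℂ} (hg : AnalyticAt ℂ g (R : ℂ)) :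
    ∃ r > 0, DifferentiableOn ℂ (fun ζ ↦ g (R * Complex.exp ζ)) (Metric.ball 0 r) := by
  have hcomp : AnalyticAt ℂ (fun ζ ↦ g (R * Complex.exp ζ)) 0 :=
    AnalyticAt.fun_comp (by simpa using hg) (by fun_prop)
  obtain ⟨r, hr, hball⟩ := Metric.eventually_nhds_iff.1 hcomp.eventually_analyticAt
  exact ⟨r, hr, fun ζ hζ ↦ (hball hζ).differentiableAt.differentiableWithinAt⟩

theorem periodic_comp_mul_exp (g : ℂ → ℂ) :
    Function.Periodic (fun ζ ↦ g (R * Complex.exp ζ)) (2 * Real.pi * Complex.I) := fun ζ ↦ by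
  simp only [Complex.exp_periodic ζ]

theorem differentiableOn_comp_mul_exp {g : ℂ → ℂ} {D : Set ℂ} (hg : DifferentiableOn ℂ g D) :
    DifferentiableOn ℂ (fun ζ ↦ g (R * Complex.exp ζ))
      ((fun ζ : ℂ ↦ (R * Complex.exp ζ : ℂ)) ⁻¹' D) :=
  hg.comp (by fun_prop) (Set.mapsTo_preimage _ _)

theorem nonempty_singularData (hR : 0 < R) (hη : 0 < η) (hφ : 0 < φ) (hφ' : φ < Real.pi / 2)
    {f gθ gκ : ℂ → ℂ} (hf : DifferentiableOn ℂ f (Delta0 R η φ))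
    (hgθ : DifferentiableOn ℂ gθ (Delta0 R η φ)) (hgθR : AnalyticAt ℂ gθ (R : ℂ))
    (hgκ : DifferentiableOn ℂ gκ (Delta0 R η φ)) {b₀ b₁ s β q a c : ℝ}
    (haxis : ∀ y : ℝ, Real.cos y ≠ 1 → (gκ (R * Complex.exp (y * Complex.I))).re < b₀)
    {pf pκ : ℕ → ℂ} {mf mκ : ℕ} (hmf : 0 < mf) (hmκ : 1 < mκ) (hpf : pf 0 = 1) (hpκ₀ : pκ 0 = b₀)
    (hpκ₁ : pκ 1 = -b₁) (hf_exp : HasSingularExpansion f (Delta0 R η φ) R pf mf c β)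
    (hgκ_exp : HasSingularExpansion gκ (Delta0 R η φ) R pκ mκ a s) (hq : 1 < q) (hqs : q ≤ s)
    (hqβ : q - 1 ≤ β) :
    Nonempty (SingularData (fun ζ ↦ f (R * Complex.exp ζ)) (fun ζ ↦ gθ (R * Complex.exp ζ))
      (fun ζ ↦ gκ (R * Complex.exp ζ)) b₀ b₁ q ((if q = s then a else 0 : ℝ) : ℂ)
      ((if q - 1 = β then c else 0 : ℝ) : ℂ)) := by
  obtain ⟨φ₁, hφφ₁, hφ₁⟩ := exists_between hφ'
  obtain ⟨r, hr, hwedge⟩ := exists_wedge_inter_ball_subset_preimage_Delta0 hR hη hφ hφφ₁ hφ₁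
  obtain ⟨r', hr', hball⟩ := exists_differentiableOn_comp_mul_exp_ball hgθR
  exact ⟨{
    domain := (fun ζ : ℂ ↦ (R * Complex.exp ζ : ℂ)) ⁻¹' Delta0 R η φ
    φ := φ₁
    radius := min r r'
    p := expPoly pf mf
    Q := expPoly pκ mκ
    angle_pos := hφ.trans hφφ₁
    angle_lt := hφ₁
    radius_pos := lt_min hr hr'
    one_lt := hq
    isOpen := (isOpen_Delta0 hφ hφ').preimage (by fun_prop)
    left_subset := fun ζ hζ ↦ mul_exp_mem_Delta0_of_re_neg hR hη hφ hφ' hζ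
    wedge_subset := (Set.inter_subset_inter_right _
      (Metric.ball_subset_ball (min_le_left r r'))).trans hwedge
    axis_mem := fun y hy hy' ↦ mul_exp_mul_I_mem_Delta0 hR hη hφ hφ' (cos_ne_one_of_abs_le hy hy')
    axis_lt := fun y hy hy' ↦ haxis y (cos_ne_one_of_abs_le hy hy')
    periodic_f := periodic_comp_mul_exp f
    periodic_T := periodic_comp_mul_exp gθ
    periodic_G := periodic_comp_mul_exp gκ
    differentiableOn_f := differentiableOn_comp_mul_exp hf
    differentiableOn_T := differentiableOn_comp_mul_exp hgθ
    differentiableOn_G := differentiableOn_comp_mul_exp hgκ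
    differentiableOn_p := differentiable_expPoly.differentiableOn
    differentiableOn_T_ball := hball.mono (Metric.ball_subset_ball (min_le_right r r'))
    differentiableOn_Q := differentiable_expPoly.differentiableOn
    p_zero := (expPoly_zero hmf).trans hpf
    Q_zero := (expPoly_zero (zero_lt_one.trans hmκ)).trans hpκ₀
    hasDerivAt_Q := by simpa [hpκ₁] using hasDerivAt_expPoly_zero (p := pκ) hmκ
    expansion_f := by
      simpa only [apply_ite Complex.ofReal, Complex.ofReal_zero] using
        hf_exp.comp_mul_exp_of_le hR hη hφ hφφ₁ hφ₁ (sub_nonneg.2 hq.le) hqβ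
    expansion_G := by
      simpa only [apply_ite Complex.ofReal, Complex.ofReal_zero] using
        hgκ_exp.comp_mul_exp_of_le hR hη hφ hφφ₁ hφ₁ (zero_le_one.trans hq.le) hqs }⟩

end Transfer

section UniformConvergence

theorem tendstoUniformlyOn_of_forall_tendsto {ι α β : Type*} [TopologicalSpace α] [UniformSpace β]
    {l : Filter ι} {K : Set α} (hK : IsCompact K) {F : ι → α → β} {g : α → β}
    (hg : ContinuousOn g K)
    (hF : ∀ x ∈ K, Tendsto (fun z : ι × α ↦ F z.1 z.2) (l ×ˢ 𝓝[K] x) (𝓝 (g x))) :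
    TendstoUniformlyOn F g l K := by
  refine (tendstoLocallyUniformlyOn_iff_tendstoUniformlyOn_of_compact hK).1
    (tendstoLocallyUniformlyOn_iff_forall_tendsto.2 fun x hx ↦ ?_)
  exact (((hg x hx).tendsto.comp tendsto_snd).prodMk_nhds (hF x hx)).mono_right
    (nhds_le_uniformity (g x))

variable {K : Set ℝ} {A : ℕ → ℝ → ℂ} {S : ℕ → ℝ → ℝ} {g : ℝ → ℝ}

theorem eventually_norm_sub_le_of_tendstoUniformlyOn_div
    (hS : ∀ᶠ N in atTop, ∀ v ∈ K, 0 < S N v)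
    (h : TendstoUniformlyOn (fun N v ↦ A N v / S N v) (fun v ↦ (g v : ℂ)) atTop K) {ε : ℝ}
    (hε : 0 < ε) :
    ∀ᶠ N in atTop, ∀ v ∈ K, ‖A N v - ((S N v * g v : ℝ) : ℂ)‖ ≤ ε * S N v := by
  filter_upwards [hS, Metric.tendstoUniformlyOn_iff.1 h ε hε] with N hS hN v hv
  have hS₀ : (S N v : ℂ) ≠ 0 := Complex.ofReal_ne_zero.2 (hS v hv).ne'
  have hmul : A N v - ((S N v * g v : ℝ) : ℂ) = (A N v / S N v - g v) * S N v := by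
    rw [sub_mul, div_mul_cancel₀ _ hS₀]
    push_cast
    ring
  rw [hmul, norm_mul, Complex.norm_real, Real.norm_of_nonneg (hS v hv).le, ← dist_eq_norm,
    dist_comm]
  exact mul_le_mul_of_nonneg_right (hN v hv).le (hS v hv).le

theorem unifEquiv_of_tendstoUniformlyOn_div (hK : IsCompact K) (hg : ContinuousOn g K)
    (hg₀ : ∀ v ∈ K, g v ≠ 0) (hS : ∀ᶠ N in atTop, ∀ v ∈ K, 0 < S N v)
    (h : TendstoUniformlyOn (fun N v ↦ A N v / S N v) (fun v ↦ (g v : ℂ)) atTop K) :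
    UnifEquiv K A (fun N v ↦ S N v * g v) := fun ε hε ↦ by
  obtain ⟨m, hm, hmg⟩ := hK.exists_forall_le' hg.abs fun v hv ↦ abs_pos.2 (hg₀ v hv)
  filter_upwards [hS, eventually_norm_sub_le_of_tendstoUniformlyOn_div hS h (mul_pos hε hm)]
    with N hS hN v hv
  calc ‖A N v - ((S N v * g v : ℝ) : ℂ)‖ ≤ ε * m * S N v := hN v hv
    _ ≤ ε * |g v| * S N v := by
        have := (hS v hv).le
        have := hmg v hv
        gcongr
    _ = ε * |S N v * g v| := by rw [abs_mul, abs_of_pos (hS v hv)]; ring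

end UniformConvergence

section Coefficients

/-- The order of magnitude `e^{v (t + N b₀)} {N (1 - v b₁)}^{-q} R^{-N}` of the coefficients
`[z^N] f e^{v (g_θ + N g_κ)}`, where `t = g_θ(R)`, `b₀ = g_κ(R)` and `b₁ = R g_κ'(R)`. -/
noncomputable def coeffScale (t b₀ b₁ R q : ℝ) (N : ℕ) (v : ℝ) : ℝ :=
  Real.exp (v * (t + N * b₀)) * (N * (1 - v * b₁)) ^ (-q) / R ^ N

/-- The limit of the coefficients divided by `coeffScale`: the first summand stems from the
singular term `c (1 - z / R)^(q - 1)` of `f`, the second from the singular term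
`a (1 - z / R)^q` of `g_κ`. -/
noncomputable def coeffBracket (b₁ q a c v : ℝ) : ℝ :=
  c / Real.Gamma (1 - q) + v * a / (Real.Gamma (-q) * (1 - v * b₁))

variable {t b₀ b₁ R q a c v : ℝ} {N : ℕ}

theorem coeffScale_pos (hR : 0 < R) (hN : 0 < N) (hd : v * b₁ < 1) :
    0 < coeffScale t b₀ b₁ R q N v := by
  have := sub_pos.2 hd
  unfold coeffScale
  positivity

theorem inv_coeffScale (hd : v * b₁ ≤ 1) : (coeffScale t b₀ b₁ R q N v)⁻¹ =
    Real.exp (-(v * (t + N * b₀))) * ((N : ℝ) ^ q * (1 - v * b₁) ^ q) * R ^ N := by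
  have hd' := sub_nonneg.2 hd
  rw [coeffScale, inv_div, Real.rpow_neg (by positivity), Real.mul_rpow N.cast_nonneg hd',
    Real.exp_neg]
  field_simp

theorem continuousOn_coeffBracket {K : Set ℝ} (hK : ∀ v ∈ K, v * b₁ < 1) :
    ContinuousOn (coeffBracket b₁ q a c) K := by
  have hquot : ContinuousOn (fun v : ℝ ↦ v * a / (1 - v * b₁)) K :=
    ContinuousOn.div (by fun_prop) (by fun_prop) fun v hv ↦ (sub_pos.2 (hK v hv)).ne'
  have hadd : ContinuousOn (fun v : ℝ ↦ c / Real.Gamma (1 - q) +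
      v * a / (1 - v * b₁) / Real.Gamma (-q)) K :=
    continuousOn_const.add (hquot.div_const _)
  exact hadd.congr fun v _ ↦ by rw [coeffBracket, mul_comm (Real.Gamma _), ← div_div]

variable {f gθ gκ : ℂ → ℂ}

theorem kern_comp_mul_exp (b : ℂ) (ζ : ℂ) :
    kern (fun ζ ↦ f (R * Complex.exp ζ)) (fun ζ ↦ gθ (R * Complex.exp ζ))
      (fun ζ ↦ gκ (R * Complex.exp ζ)) b N v ζ =
    f (R * Complex.exp ζ) * Complex.exp (v * (gθ (R * Complex.exp ζ) + N * gκ (R * Complex.exp ζ)))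
      * Complex.exp (-(N * ζ)) * Complex.exp (-(v * (gθ R + N * b))) := by
  rw [kern, Complex.exp_zero, mul_one, mul_assoc, mul_assoc, mul_assoc, ← Complex.exp_add,
    ← Complex.exp_add, ← Complex.exp_add]
  ring_nf

theorem segmentIntegral_kern_eq_coeffAt (hR : 0 < R) (hf : DifferentiableOn ℂ f (Metric.ball 0 R))
    (hgθ : DifferentiableOn ℂ gθ (Metric.ball 0 R)) (hgκ : DifferentiableOn ℂ gκ (Metric.ball 0 R))
    (b : ℂ) {ε : ℝ} (hε : 0 < ε) :
    segmentIntegral (kern (fun ζ ↦ f (R * Complex.exp ζ)) (fun ζ ↦ gθ (R * Complex.exp ζ))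
      (fun ζ ↦ gκ (R * Complex.exp ζ)) b N v) (-ε) (-ε + 2 * Real.pi * Complex.I) =
    2 * Real.pi * Complex.I * (R : ℂ) ^ N *
      coeffAt N (fun z ↦ f z * Complex.exp (v * (gθ z + N * gκ z))) *
        Complex.exp (-(v * (gθ R + N * b))) := by
  have hF : DifferentiableOn ℂ (fun z ↦ f z * Complex.exp (v * (gθ z + N * gκ z)))
      (Metric.ball 0 R) := hf.mul ((hgθ.add (hgκ.const_mul _)).const_mul _).cexp
  rw [← segmentIntegral_mul_exp_eq_coeffAt hR hF N hε, segmentIntegral, segmentIntegral,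
    ← intervalIntegral.integral_mul_const]
  refine intervalIntegral.integral_congr fun x _ ↦ ?_
  simp only [kern_comp_mul_exp]
  ring

section

variable (S : SingularData (fun ζ ↦ f (R * Complex.exp ζ)) (fun ζ ↦ gθ (R * Complex.exp ζ))
    (fun ζ ↦ gκ (R * Complex.exp ζ)) b₀ b₁ q a c) (hR : 0 < R)
  (hf : DifferentiableOn ℂ f (Metric.ball 0 R)) (hgθ : DifferentiableOn ℂ gθ (Metric.ball 0 R))
  (hgκ : DifferentiableOn ℂ gκ (Metric.ball 0 R)) (ht : gθ R = t)

include S hR hf hgθ hgκ ht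

theorem SingularData.tendsto_coeffAt_div_coeffScale {ι : Type*} {l : Filter ι}
    [l.IsCountablyGenerated] {N : ι → ℕ} {v : ι → ℝ} {vs : ℝ} (hN : Tendsto N l atTop)
    (hv : Tendsto v l (𝓝 vs)) (hvs : 0 < vs) (hd : vs * b₁ < 1) :
    Tendsto (fun i ↦ coeffAt (N i) (fun z ↦ f z * Complex.exp (v i * (gθ z + N i * gκ z))) /
      coeffScale t b₀ b₁ R q (N i) (v i)) l (𝓝 (coeffBracket b₁ q a c vs : ℂ)) := by
  have hd' := sub_pos.2 hd
  have hint := S.tendsto_rpow_mul_contourIntegral hN hv hvs hd fun i ε hε ↦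
    segmentIntegral_kern_eq_coeffAt hR hf hgθ hgκ b₀ hε
  have hpow : Tendsto (fun i ↦ (((1 - v i * b₁) ^ q : ℝ) : ℂ)) l
      (𝓝 (((1 - vs * b₁) ^ q : ℝ) : ℂ)) :=
    (Complex.continuous_ofReal.tendsto _).comp
      ((tendsto_const_nhds.sub (hv.mul_const b₁)).rpow_const (Or.inl hd'.ne'))
  have hlim := (hint.mul hpow).div_const (2 * Real.pi * Complex.I)
  have hbracket : 2 * Real.pi * Complex.I *
      (c * (((1 - vs * b₁) ^ (-q) / Real.Gamma (1 - q) : ℝ) : ℂ) +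
        vs * a * (((1 - vs * b₁) ^ (-q - 1) / Real.Gamma (-q) : ℝ) : ℂ)) *
      (((1 - vs * b₁) ^ q : ℝ) : ℂ) / (2 * Real.pi * Complex.I) = coeffBracket b₁ q a c vs := by
    have hq := (Real.rpow_pos_of_pos hd' q).ne'
    rw [mul_assoc, mul_div_cancel_left₀ _ Complex.two_pi_I_ne_zero]
    norm_cast
    rw [coeffBracket, Real.rpow_sub_one hd'.ne', Real.rpow_neg hd'.le]
    field_simp
  rw [hbracket] at hlim
  refine hlim.congr' ?_
  filter_upwards [(hv.mul_const b₁).eventually_le_const hd] with i hi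
  rw [div_eq_mul_inv (coeffAt _ _), ← Complex.ofReal_inv, inv_coeffScale hi, ht]
  have := Complex.two_pi_I_ne_zero
  push_cast
  field_simp

theorem SingularData.tendstoUniformlyOn_coeffAt_div_coeffScale {K : Set ℝ} (hK : IsCompact K)
    (hK₀ : ∀ v ∈ K, 0 < v) (hK₁ : ∀ v ∈ K, v * b₁ < 1) :
    TendstoUniformlyOn (fun (N : ℕ) (v : ℝ) ↦
      coeffAt N (fun z ↦ f z * Complex.exp (v * (gθ z + N * gκ z))) / coeffScale t b₀ b₁ R q N v)
      (fun v : ℝ ↦ (coeffBracket b₁ q a c v : ℂ)) atTop K := by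
  have hcont := Complex.continuous_ofReal.comp_continuousOn
    (continuousOn_coeffBracket (q := q) (a := a) (c := c) hK₁)
  exact tendstoUniformlyOn_of_forall_tendsto hK hcont fun v hv ↦
    S.tendsto_coeffAt_div_coeffScale hR hf hgθ hgκ ht tendsto_fst
      (tendsto_snd.mono_right nhdsWithin_le_nhds) (hK₀ v hv) (hK₁ v hv)

end

end Coefficients

section BoundaryValues

variable {x : ℕ → ℝ} {g : ℂ → ℂ} {R : ℝ}
  (hg : ∀ z : ℂ, ‖z‖ < R → HasSum (fun j : ℕ ↦ (genCoeff x j : ℂ) * z ^ j) (g z))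

include hg

theorem ofReal_genFun {r : ℝ} (hr : |r| < R) : (genFun x r : ℂ) = g r := by
  rw [genFun, Complex.ofReal_tsum, ← (hg r (by simpa using hr)).tsum_eq]
  push_cast
  rfl

theorem tendsto_ofReal_genFun (hR : 0 < R) (hc : ContinuousAt g R) :
    Tendsto (fun r ↦ (genFun x r : ℂ)) (𝓝[<] R) (𝓝 (g R)) := by
  have hlim : Tendsto (fun r : ℝ ↦ g r) (𝓝[<] R) (𝓝 (g R)) :=
    hc.tendsto.comp ((Complex.continuous_ofReal.tendsto R).mono_left nhdsWithin_le_nhds)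
  refine hlim.congr' ?_
  filter_upwards [Ioo_mem_nhdsLT hR] with r hr
  exact (ofReal_genFun hg ((abs_of_pos hr.1).trans_lt hr.2)).symm

theorem eq_toReal_boundaryDeriv_zero (hR : 0 < R) (hc : ContinuousAt g R) :
    g R = ((boundaryDeriv x 0 R).toReal : ℂ) := by
  have hlim := tendsto_ofReal_genFun hg hR hc
  have hre : Tendsto (genFun x) (𝓝[<] R) (𝓝 (g R).re) := (Complex.continuous_re.tendsto _).comp hlim
  have him : (g R).im = 0 := (tendsto_nhds_unique tendsto_const_nhds
    ((Complex.continuous_im.tendsto _).comp hlim :)).symm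
  have hb : boundaryDeriv x 0 R = ((g R).re : EReal) := by
    refine Tendsto.limUnder_eq ?_
    simpa only [modDeriv, pow_zero, one_mul, iteratedDeriv_zero, Function.comp_def] using
      (continuous_coe_real_ereal.tendsto _).comp hre
  rw [hb, EReal.toReal_coe]
  exact Complex.ext rfl him

end BoundaryValues

section CycleIndex

variable {k : Type*} [Field k]

/-- The weight `∏ (x_j / j)^{c_j} / c_j!` of a multiset of cycle lengths in which `j` occurs `c_j`
times. -/
def cycleWeight (x : ℕ → k) (m : Multiset ℕ) : k :=
  ∏ j ∈ m.toFinset, (x j / j) ^ m.count j / (m.count j).factorial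

/-- The cycle index of the symmetric group of degree `n` at `x`, as a sum over the partitions
of `n`. -/
def cycleIndex (x : ℕ → k) (n : ℕ) : k :=
  ∑ p : n.Partition, cycleWeight x p.parts

theorem cycleWeight_eq_prod_of_subset (x : ℕ → k) {m : Multiset ℕ} {s : Finset ℕ}
    (h : m.toFinset ⊆ s) :
    cycleWeight x m = ∏ j ∈ s, (x j / j) ^ m.count j / (m.count j).factorial :=
  Finset.prod_subset h fun j _ hj ↦ by
    rw [Multiset.count_eq_zero_of_notMem (Multiset.mem_toFinset.not.1 hj)]
    simp

theorem cycleIndex_zero (x : ℕ → k) : cycleIndex x 0 = 1 := by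
  rw [cycleIndex, Fintype.sum_unique]
  simp [cycleWeight]

variable [CharZero k]

theorem mul_count_mul_cycleWeight_cons (x : ℕ → k) {j : ℕ} (hj : j ≠ 0) (m : Multiset ℕ) :
    (j * (j ::ₘ m).count j : ℕ) * cycleWeight x (j ::ₘ m) = x j * cycleWeight x m := by
  have hj₀ : (j : k) ≠ 0 := Nat.cast_ne_zero.2 hj
  have hfac : ((m.count j).factorial : k) ≠ 0 := Nat.cast_ne_zero.2 (m.count j).factorial_ne_zero
  have hcount : (m.count j : k) + 1 ≠ 0 := Nat.cast_add_one_ne_zero _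
  have herase : ∏ i ∈ (insert j m.toFinset).erase j,
      (x i / i) ^ (j ::ₘ m).count i / ((j ::ₘ m).count i).factorial =
      ∏ i ∈ (insert j m.toFinset).erase j, (x i / i) ^ m.count i / (m.count i).factorial :=
    Finset.prod_congr rfl fun i hi ↦ by
      rw [Multiset.count_cons_of_ne (Finset.ne_of_mem_erase hi)]
  rw [cycleWeight_eq_prod_of_subset x (Multiset.toFinset_cons j m).subset,
    cycleWeight_eq_prod_of_subset x (Finset.subset_insert j m.toFinset),
    ← Finset.mul_prod_erase _ _ (Finset.mem_insert_self j _),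
    ← Finset.mul_prod_erase _ _ (Finset.mem_insert_self j _), herase, Multiset.count_cons_self,
    Nat.factorial_succ, pow_succ]
  push_cast
  field_simp

theorem prod_mul_cycleWeight (x : ℕ → k) {m : Multiset ℕ} (hm : ∀ j ∈ m, j ≠ 0) :
    (∏ j ∈ m.toFinset, j ^ m.count j * (m.count j).factorial : ℕ) * cycleWeight x m =
      ∏ j ∈ m.toFinset, x j ^ m.count j := by
  rw [cycleWeight, Nat.cast_prod, ← Finset.prod_mul_distrib]
  refine Finset.prod_congr rfl fun j hj ↦ ?_
  have hj₀ : (j : k) ≠ 0 := Nat.cast_ne_zero.2 (hm j (Multiset.mem_toFinset.1 hj))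
  have hfac : ((m.count j).factorial : k) ≠ 0 := Nat.cast_ne_zero.2 (m.count j).factorial_ne_zero
  rw [div_pow]
  push_cast
  field_simp

theorem sum_mul_count_parts {n : ℕ} (p : n.Partition) :
    ∑ j ∈ Finset.Icc 1 n, j * p.parts.count j = n := by
  have hsub : p.parts.toFinset ⊆ Finset.Icc 1 n := fun j hj ↦ by
    rw [Multiset.mem_toFinset] at hj
    exact Finset.mem_Icc.2 ⟨p.parts_pos hj, p.le_of_mem_parts hj⟩
  conv_rhs => rw [← p.parts_sum, Finset.sum_multiset_count_of_subset p.parts _ hsub]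
  exact Finset.sum_congr rfl fun j _ ↦ by rw [smul_eq_mul, mul_comm]

theorem sum_mul_count_mul_cycleWeight (x : ℕ → k) {n j : ℕ} (hj : 0 < j) (hjn : j ≤ n) :
    ∑ p : n.Partition, (j * p.parts.count j : ℕ) * cycleWeight x p.parts =
      x j * cycleIndex x (n - j) := by
  rw [cycleIndex, Finset.mul_sum]
  have hfilter : ∀ p ∈ (Finset.univ : Finset n.Partition),
      ((j * p.parts.count j : ℕ) : k) * cycleWeight x p.parts ≠ 0 → j ∈ p.parts := fun p _ hp ↦ by
    by_contra hc
    simp [Multiset.count_eq_zero_of_notMem hc] at hp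
  rw [← Finset.sum_filter_of_ne hfilter]
  refine Finset.sum_bij'
    (fun p hp ↦ ⟨p.parts.erase j, fun h ↦ p.parts_pos (Multiset.mem_of_mem_erase h), ?_⟩)
    (fun p _ ↦ ⟨j ::ₘ p.parts, fun h ↦ (Multiset.mem_cons.1 h).elim (· ▸ hj) p.parts_pos, ?_⟩)
    (fun _ _ ↦ Finset.mem_univ _) (fun p _ ↦ by simp) (fun p hp ↦ ?_) (fun p _ ↦ ?_)
    fun p hp ↦ ?_
  · have hsum := congrArg Multiset.sum (Multiset.cons_erase (Finset.mem_filter.1 hp).2)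
    rw [Multiset.sum_cons, p.parts_sum] at hsum
    exact (Nat.sub_eq_of_eq_add' hsum.symm).symm
  · rw [Multiset.sum_cons, p.parts_sum, Nat.add_sub_cancel' hjn]
  · exact Nat.Partition.ext (Multiset.cons_erase (Finset.mem_filter.1 hp).2)
  · exact Nat.Partition.ext (Multiset.erase_cons_head _ _)
  · rw [← mul_count_mul_cycleWeight_cons x hj.ne',
      Multiset.cons_erase (Finset.mem_filter.1 hp).2]

theorem succ_mul_cycleIndex_succ (x : ℕ → k) (n : ℕ) :
    ((n + 1 : ℕ) : k) * cycleIndex x (n + 1) =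
      ∑ j ∈ Finset.range (n + 1), x (j + 1) * cycleIndex x (n - j) := calc
  _ = ∑ j ∈ Finset.Icc 1 (n + 1), ∑ p : (n + 1).Partition,
        ((j * p.parts.count j : ℕ) : k) * cycleWeight x p.parts := by
    rw [Finset.sum_comm, cycleIndex, Finset.mul_sum]
    refine Finset.sum_congr rfl fun p _ ↦ ?_
    rw [← Finset.sum_mul, ← Nat.cast_sum, sum_mul_count_parts p]
  _ = ∑ j ∈ Finset.Icc 1 (n + 1), x j * cycleIndex x (n + 1 - j) :=
    Finset.sum_congr rfl fun j hj ↦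
      sum_mul_count_mul_cycleWeight x (Finset.mem_Icc.1 hj).1 (Finset.mem_Icc.1 hj).2
  _ = _ := by
    rw [← Finset.Ico_add_one_right_eq_Icc, Finset.sum_Ico_eq_sum_range]
    refine Finset.sum_congr rfl fun j _ ↦ ?_
    rw [add_comm 1 j, Nat.add_sub_add_right]

section Partition

variable {n : ℕ} (p : n.Partition)

theorem filter_parts_add_replicate :
    p.parts.filter (2 ≤ ·) + Multiset.replicate (p.parts.count 1) 1 = p.parts := by
  conv_rhs => rw [← Multiset.filter_add_not (2 ≤ ·) p.parts]
  rw [← Multiset.filter_eq']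
  congr 1
  refine Multiset.filter_congr fun j hj ↦ ?_
  have := p.parts_pos hj
  omega

theorem sum_filter_parts_add_count : (p.parts.filter (2 ≤ ·)).sum + p.parts.count 1 = n := by
  have hsum := congrArg Multiset.sum (filter_parts_add_replicate p)
  rwa [Multiset.sum_add, p.parts_sum, Multiset.sum_replicate, smul_eq_mul, mul_one] at hsum

theorem factorial_count_one_mul_prod_filter_parts :
    (p.parts.count 1).factorial * (p.parts.filter (2 ≤ ·)).prod *
        ∏ j ∈ (p.parts.filter (2 ≤ ·)).toFinset, ((p.parts.filter (2 ≤ ·)).count j).factorial =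
      ∏ j ∈ p.parts.toFinset, j ^ p.parts.count j * (p.parts.count j).factorial := by
  have hprod : (p.parts.filter (2 ≤ ·)).prod = ∏ j ∈ p.parts.toFinset, j ^ p.parts.count j := by
    have hprod := congrArg Multiset.prod (filter_parts_add_replicate p)
    rw [Multiset.prod_add, Multiset.prod_replicate, one_pow, mul_one] at hprod
    exact hprod.trans (Finset.prod_multiset_count _)
  have herase : (p.parts.filter (2 ≤ ·)).toFinset = (insert 1 p.parts.toFinset).erase 1 := by
    ext j
    simp only [Multiset.mem_toFinset, Multiset.mem_filter, Finset.mem_erase, Finset.mem_insert]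
    have := @Nat.Partition.parts_pos _ p j
    grind
  have hcount : ∏ j ∈ (p.parts.filter (2 ≤ ·)).toFinset,
      ((p.parts.filter (2 ≤ ·)).count j).factorial =
      ∏ j ∈ (insert 1 p.parts.toFinset).erase 1, (p.parts.count j).factorial :=
    Finset.prod_congr herase fun j hj ↦ by
      rw [← herase, Multiset.mem_toFinset, Multiset.mem_filter] at hj
      rw [Multiset.count_filter_of_pos hj.2]
  rw [hprod, hcount, mul_right_comm, Finset.mul_prod_erase (insert 1 p.parts.toFinset)
    (fun j ↦ (p.parts.count j).factorial) (Finset.mem_insert_self _ _),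
    Finset.prod_insert_of_eq_one_if_notMem fun h ↦ by
      rw [Multiset.count_eq_zero_of_notMem (Multiset.mem_toFinset.not.1 h), Nat.factorial_zero],
    mul_comm, Finset.prod_mul_distrib]

end Partition

section Perm

variable {α : Type*} [Fintype α] [DecidableEq α]

theorem partition_eq_iff_cycleType_eq {σ : Equiv.Perm α} (p : (Fintype.card α).Partition) :
    σ.partition = p ↔ σ.cycleType = p.parts.filter (2 ≤ ·) := by
  constructor
  · rintro rfl
    exact Equiv.Perm.filter_parts_partition_eq_cycleType.symm
  · intro h
    have hfix : Fintype.card α - σ.support.card = p.parts.count 1 := by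
      rw [← Equiv.Perm.sum_cycleType, h]
      exact Nat.sub_eq_of_eq_add' (sum_filter_parts_add_count p).symm
    exact Nat.Partition.ext (by
      rw [Equiv.Perm.parts_partition, hfix, h, filter_parts_add_replicate])

theorem card_partition_eq_mul_prod (p : (Fintype.card α).Partition) :
    ({σ : Equiv.Perm α | σ.partition = p} : Finset _).card *
      ∏ j ∈ p.parts.toFinset, j ^ p.parts.count j * (p.parts.count j).factorial =
      (Fintype.card α).factorial := by
  have hsum := sum_filter_parts_add_count p
  have hcard := Equiv.Perm.card_of_cycleType_mul_eq α (p.parts.filter (2 ≤ ·))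
  rw [if_pos ⟨le_of_add_le_left hsum.le, fun j hj ↦ (Multiset.mem_filter.1 hj).2⟩,
    Nat.sub_eq_of_eq_add' hsum.symm, factorial_count_one_mul_prod_filter_parts] at hcard
  simpa only [partition_eq_iff_cycleType_eq] using hcard

theorem sum_perm_prod_pow_count (x : ℕ → k) :
    ∑ σ : Equiv.Perm α, ∏ j ∈ σ.partition.parts.toFinset, x j ^ σ.partition.parts.count j =
      (Fintype.card α).factorial * cycleIndex x (Fintype.card α) := by
  rw [cycleIndex, Finset.mul_sum, ← Finset.sum_fiberwise Finset.univ Equiv.Perm.partition]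
  refine Finset.sum_congr rfl fun p _ ↦ ?_
  have hconst : ∀ σ ∈ ({σ | σ.partition = p} : Finset (Equiv.Perm α)),
      ∏ j ∈ σ.partition.parts.toFinset, x j ^ σ.partition.parts.count j =
        ∏ j ∈ p.parts.toFinset, x j ^ p.parts.count j := fun σ hσ ↦ by
    rw [(Finset.mem_filter.1 hσ).2]
  rw [Finset.sum_congr rfl hconst, Finset.sum_const, nsmul_eq_mul, ← card_partition_eq_mul_prod p,
    Nat.cast_mul, mul_assoc, prod_mul_cycleWeight x fun j hj ↦ (p.parts_pos hj).ne']

end Perm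

theorem ofReal_H_eq_cycleIndex (θ κ : ℕ → ℝ) (N : ℕ) :
    (H θ κ N : ℂ) = cycleIndex (fun j ↦ (θ j + N * κ j : ℂ)) N := by
  have hsum := (sum_perm_prod_pow_count (α := Fin N) fun j ↦ (θ j + N * κ j : ℂ)).trans
    (by rw [Fintype.card_fin])
  rw [H, Complex.ofReal_div, Complex.ofReal_natCast,
    div_eq_iff (Nat.cast_ne_zero.2 N.factorial_ne_zero), mul_comm, ← hsum]
  push_cast
  refine Finset.sum_congr rfl fun σ _ ↦ (Finset.prod_subset ?_ fun j _ hj ↦ ?_).symm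
  · intro j hj
    rw [Multiset.mem_toFinset] at hj
    exact Finset.mem_Icc.2 ⟨σ.partition.parts_pos hj,
      (σ.partition.le_of_mem_parts hj).trans_eq (Fintype.card_fin N)⟩
  · rw [cycleCount, Multiset.count_eq_zero_of_notMem (Multiset.mem_toFinset.not.1 hj), pow_zero]

end CycleIndex

section TaylorCoefficients

theorem hasFPowerSeriesAt_ofScalars {g : ℂ → ℂ} {a : ℕ → ℂ}
    (hg : ∀ᶠ z in 𝓝 0, HasSum (fun j ↦ a j * z ^ j) (g z)) :
    HasFPowerSeriesAt g (FormalMultilinearSeries.ofScalars ℂ a) 0 := by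
  rw [hasFPowerSeriesAt_iff]
  filter_upwards [hg] with z hz
  simpa [mul_comm] using hz

theorem coeffAt_eq_of_hasSum {g : ℂ → ℂ} {a : ℕ → ℂ}
    (hg : ∀ᶠ z in 𝓝 0, HasSum (fun j ↦ a j * z ^ j) (g z)) (n : ℕ) : coeffAt n g = a n := by
  obtain ⟨r, hr⟩ := hasFPowerSeriesAt_ofScalars hg
  rw [coeffAt, iteratedDeriv_eq_iteratedFDeriv, ← hr.factorial_smul 1 n,
    div_eq_iff (Nat.cast_ne_zero.2 n.factorial_ne_zero)]
  simp [mul_comm]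

theorem coeffAt_deriv (n : ℕ) (g : ℂ → ℂ) :
    coeffAt n (deriv g) = (n + 1 : ℕ) * coeffAt (n + 1) g := by
  have hn : ((n + 1 : ℕ) : ℂ) ≠ 0 := Nat.cast_ne_zero.2 n.succ_ne_zero
  rw [coeffAt, coeffAt, ← iteratedDeriv_succ', Nat.factorial_succ, Nat.cast_mul]
  field_simp

theorem coeffAt_mul {f g : ℂ → ℂ} (hf : AnalyticAt ℂ f 0) (hg : AnalyticAt ℂ g 0) (n : ℕ) :
    coeffAt n (fun z ↦ f z * g z) =
      ∑ j ∈ Finset.range (n + 1), coeffAt j f * coeffAt (n - j) g := by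
  simp only [coeffAt]
  rw [iteratedDeriv_fun_mul hf.contDiffAt hg.contDiffAt, Finset.sum_div]
  refine Finset.sum_congr rfl fun j hj ↦ ?_
  have hchoose : (n.choose j : ℂ) * j.factorial * (n - j).factorial = n.factorial :=
    mod_cast Nat.choose_mul_factorial_mul_factorial (Finset.mem_range_succ_iff.1 hj)
  have hn : (n.factorial : ℂ) ≠ 0 := Nat.cast_ne_zero.2 n.factorial_ne_zero
  have hj : (j.factorial : ℂ) ≠ 0 := Nat.cast_ne_zero.2 j.factorial_ne_zero
  have hnj : ((n - j).factorial : ℂ) ≠ 0 := Nat.cast_ne_zero.2 (n - j).factorial_ne_zero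
  rw [div_mul_div_comm, div_eq_div_iff hn (mul_ne_zero hj hnj), ← hchoose]
  ring

theorem succ_mul_coeffAt_succ_exp {g : ℂ → ℂ} (hg : AnalyticAt ℂ g 0) (n : ℕ) :
    ((n + 1 : ℕ) : ℂ) * coeffAt (n + 1) (fun z ↦ Complex.exp (g z)) =
      ∑ j ∈ Finset.range (n + 1), ((j + 1 : ℕ) * coeffAt (j + 1) g) *
        coeffAt (n - j) (fun z ↦ Complex.exp (g z)) := by
  have hderiv : deriv (fun z ↦ Complex.exp (g z)) =ᶠ[𝓝 0]
      fun z ↦ deriv g z * Complex.exp (g z) := by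
    filter_upwards [hg.eventually_analyticAt] with z hz
    rw [hz.differentiableAt.hasDerivAt.cexp.deriv, mul_comm]
  rw [← coeffAt_deriv, coeffAt, hderiv.iteratedDeriv_eq, ← coeffAt, coeffAt_mul hg.deriv hg.cexp']
  simp only [coeffAt_deriv]

theorem cycleIndex_eq_coeffAt_exp {x : ℕ → ℂ} {g : ℂ → ℂ}
    (hg : ∀ᶠ z in 𝓝 0, HasSum (fun j ↦ x j / j * z ^ j) (g z)) (n : ℕ) :
    cycleIndex x n = coeffAt n (fun z ↦ Complex.exp (g z)) := by
  have hcoeff := coeffAt_eq_of_hasSum hg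
  induction n using Nat.strong_induction_on with
  | _ n ih =>
    cases n with
    | zero =>
      have hg₀ : g 0 = 0 := by simpa [coeffAt] using hcoeff 0
      simp [cycleIndex_zero, coeffAt, hg₀]
    | succ n =>
      have hn : ((n + 1 : ℕ) : ℂ) ≠ 0 := Nat.cast_ne_zero.2 n.succ_ne_zero
      refine mul_left_cancel₀ hn ?_
      rw [succ_mul_coeffAt_succ_exp (hasFPowerSeriesAt_ofScalars hg).analyticAt,
        succ_mul_cycleIndex_succ]
      refine Finset.sum_congr rfl fun j _ ↦ ?_
      rw [ih (n - j) (by omega), hcoeff, mul_div_cancel₀ _ (Nat.cast_ne_zero.2 j.succ_ne_zero)]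

theorem ofReal_H_eq_coeffAt_exp {θ κ : ℕ → ℝ} {gθ gκ : ℂ → ℂ}
    (hgθ : ∀ᶠ z in 𝓝 0, HasSum (fun j : ℕ ↦ (genCoeff θ j : ℂ) * z ^ j) (gθ z))
    (hgκ : ∀ᶠ z in 𝓝 0, HasSum (fun j : ℕ ↦ (genCoeff κ j : ℂ) * z ^ j) (gκ z)) (N : ℕ) :
    (H θ κ N : ℂ) = coeffAt N (fun z ↦ Complex.exp (gθ z + N * gκ z)) := by
  rw [ofReal_H_eq_cycleIndex]
  refine cycleIndex_eq_coeffAt_exp ?_ N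
  filter_upwards [hgθ, hgκ] with z hθ hκ
  convert hθ.add (hκ.mul_left (N : ℂ)) using 2 with j
  simp only [genCoeff]
  push_cast
  ring

end TaylorCoefficients

section Asymptotics

variable {κ : ℕ → ℝ} {R η φ t b₀ b₁ a s q c β : ℝ} {pκ pf : ℕ → ℂ} {mκ mf : ℕ}
  {gθ gκ f : ℂ → ℂ} {K : Set ℝ}

section

variable (hκ : ∀ j, 1 ≤ j → 0 ≤ κ j) (hNA : NonArithmetic κ)
  (hR : 0 < R) (hη : 0 < η) (hφ : 0 < φ) (hφ' : φ < Real.pi / 2)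
  (hgκ : ∀ z : ℂ, ‖z‖ < R → HasSum (fun j : ℕ ↦ (genCoeff κ j : ℂ) * z ^ j) (gκ z))
  (hgκ' : DifferentiableOn ℂ gκ (Delta0 R η φ))
  (hexp : HasSingularExpansion gκ (Delta0 R η φ) R pκ mκ a s) (hs : 1 < s) (hmκ : 1 < mκ)
  (hpκ₀ : pκ 0 = b₀)

include hκ hNA hR hη hφ hφ' hgκ hgκ' hexp hs hmκ hpκ₀

theorem re_mul_exp_mul_I_lt {y : ℝ} (hy : Real.cos y ≠ 1) :
    (gκ (R * Complex.exp (y * Complex.I))).re < b₀ := by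
  obtain ⟨j, hj, hκj, hcos⟩ := hNA.exists_cos_ne_one hy
  have hlim : Tendsto (fun r : ℝ ↦ gκ r) (𝓝[<] R) (𝓝 (b₀ : ℂ)) := hpκ₀ ▸
    (hexp.tendsto hR.ne' (zero_lt_one.trans hs) (zero_lt_one.trans hmκ)).comp
      (tendsto_ofReal_nhdsWithin_Delta0 hR hη hφ hφ')
  have hcont : ContinuousAt gκ (R * Complex.exp (y * Complex.I)) := (hgκ'.differentiableAt
    ((isOpen_Delta0 hφ hφ').mem_nhds (mul_exp_mul_I_mem_Delta0 hR hη hφ hφ' hy))).continuousAt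
  exact re_lt_of_cos_ne_one (genCoeff_nonneg hκ) hR hgκ hlim
    (div_ne_zero hκj (Nat.cast_ne_zero.2 (Nat.one_le_iff_ne_zero.1 hj))) hcos hcont

variable (hpκ₁ : pκ 1 = -b₁) (hgθ' : DifferentiableOn ℂ gθ (Delta0 R η φ))
  (hgθR : AnalyticAt ℂ gθ R) (ht : gθ R = t)
  (hf : DifferentiableOn ℂ f (Delta0 R η φ))
  (hf_exp : HasSingularExpansion f (Delta0 R η φ) R pf mf c β) (hmf : 0 < mf) (hpf : pf 0 = 1)
  (hK : IsCompact K) (hK₀ : ∀ v ∈ K, 0 < v) (hK₁ : ∀ v ∈ K, v * b₁ < 1)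

include hpκ₁ hgθ' hgθR ht hf hf_exp hmf hpf hK hK₀ hK₁

theorem tendstoUniformlyOn_coeffAt_div_coeffScale (hq : 1 < q) (hqs : q ≤ s)
    (hqβ : q - 1 ≤ β) :
    TendstoUniformlyOn (fun (N : ℕ) (v : ℝ) ↦
      coeffAt N (fun z ↦ f z * Complex.exp (v * (gθ z + N * gκ z))) / coeffScale t b₀ b₁ R q N v)
      (fun v ↦ (coeffBracket b₁ q (if q = s then a else 0) (if q - 1 = β then c else 0) v : ℂ))
      atTop K := by
  obtain ⟨S⟩ := nonempty_singularData hR hη hφ hφ' hf hgθ' hgθR hgκ'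
    (fun y ↦ re_mul_exp_mul_I_lt hκ hNA hR hη hφ hφ' hgκ hgκ' hexp hs hmκ hpκ₀)
    hmf hmκ hpf hpκ₀ hpκ₁ hf_exp hexp hq hqs hqβ
  have hball := ball_subset_Delta0 hR hη hφ hφ'
  exact S.tendstoUniformlyOn_coeffAt_div_coeffScale hR (hf.mono hball) (hgθ'.mono hball)
    (hgκ'.mono hball) ht hK hK₀ hK₁

theorem unifEquiv_coeffAt (hq : 1 < q) (hqs : q ≤ s) (hqβ : q - 1 ≤ β)
    (hne : ∀ v ∈ K,
      coeffBracket b₁ q (if q = s then a else 0) (if q - 1 = β then c else 0) v ≠ 0) :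
    UnifEquiv K (fun N v ↦ coeffAt N (fun z ↦ f z * Complex.exp (v * (gθ z + N * gκ z))))
      (fun N v ↦ coeffScale t b₀ b₁ R q N v *
        coeffBracket b₁ q (if q = s then a else 0) (if q - 1 = β then c else 0) v) :=
  unifEquiv_of_tendstoUniformlyOn_div hK (continuousOn_coeffBracket hK₁) hne
    ((eventually_gt_atTop 0).mono fun _ hN v hv ↦ coeffScale_pos hR hN (hK₁ v hv))
    (tendstoUniformlyOn_coeffAt_div_coeffScale hκ hNA hR hη hφ hφ' hgκ hgκ' hexp hs hmκ hpκ₀ hpκ₁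
      hgθ' hgθR ht hf hf_exp hmf hpf hK hK₀ hK₁ hq hqs hqβ)

theorem eventually_norm_coeffAt_sub_le (hq : 1 < q) (hqs : q ≤ s) (hqβ : q - 1 ≤ β)
    {ε : ℝ} (hε : 0 < ε) :
    ∀ᶠ N : ℕ in atTop, ∀ v ∈ K,
      ‖coeffAt N (fun z ↦ f z * Complex.exp (v * (gθ z + N * gκ z))) -
        ((coeffScale t b₀ b₁ R q N v *
          coeffBracket b₁ q (if q = s then a else 0) (if q - 1 = β then c else 0) v : ℝ) : ℂ)‖ ≤
      ε * coeffScale t b₀ b₁ R q N v :=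
  eventually_norm_sub_le_of_tendstoUniformlyOn_div
    ((eventually_gt_atTop 0).mono fun _ hN v hv ↦ coeffScale_pos hR hN (hK₁ v hv))
    (tendstoUniformlyOn_coeffAt_div_coeffScale hκ hNA hR hη hφ hφ' hgκ hgκ' hexp hs hmκ hpκ₀ hpκ₁
      hgθ' hgθR ht hf hf_exp hmf hpf hK hK₀ hK₁ hq hqs hqβ) hε

theorem unifEquiv_coeffAt_of_sub_one_lt (ha : a ≠ 0) (hΓ : Real.Gamma (-s) ≠ 0) (hβ : s - 1 < β) :
    UnifEquiv K (fun N v ↦ coeffAt N (fun z ↦ f z * Complex.exp (v * (gθ z + N * gκ z))))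
      (fun N v ↦ Real.exp (v * (t + N * b₀)) * v * a * (N * (1 - v * b₁)) ^ (-s) /
        (R ^ N * Real.Gamma (-s) * (1 - v * b₁))) := by
  have hbracket (v : ℝ) :
      coeffBracket b₁ s (if s = s then a else 0) (if s - 1 = β then c else 0) v =
        v * a / (Real.Gamma (-s) * (1 - v * b₁)) := by
    simp [coeffBracket, hβ.ne]
  have h := unifEquiv_coeffAt hκ hNA hR hη hφ hφ' hgκ hgκ' hexp hs hmκ hpκ₀ hpκ₁ hgθ' hgθR ht hf
    hf_exp hmf hpf hK hK₀ hK₁ hs le_rfl hβ.le fun v hv ↦ by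
      rw [hbracket]
      exact div_ne_zero (mul_ne_zero (hK₀ v hv).ne' ha)
        (mul_ne_zero hΓ (sub_pos.2 (hK₁ v hv)).ne')
  convert h using 3
  rw [hbracket, coeffScale, div_mul_div_comm]
  congr 1 <;> ring

theorem unifEquiv_coeffAt_of_lt_sub_one (hc : c ≠ 0) (hΓ : Real.Gamma (-β) ≠ 0) (hβ : 0 < β)
    (hβs : β < s - 1) :
    UnifEquiv K (fun N v ↦ coeffAt N (fun z ↦ f z * Complex.exp (v * (gθ z + N * gκ z))))
      (fun N v ↦ Real.exp (v * (t + N * b₀)) * c * (N * (1 - v * b₁)) ^ (-β - 1) /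
        (R ^ N * Real.Gamma (-β))) := by
  have hβs : β + 1 < s := lt_sub_iff_add_lt.1 hβs
  have hbracket (v : ℝ) :
      coeffBracket b₁ (β + 1) (if β + 1 = s then a else 0) (if β + 1 - 1 = β then c else 0) v =
        c / Real.Gamma (-β) := by
    simp [coeffBracket, hβs.ne]
  have h := unifEquiv_coeffAt hκ hNA hR hη hφ hφ' hgκ hgκ' hexp hs hmκ hpκ₀ hpκ₁ hgθ' hgθR ht hf
    hf_exp hmf hpf hK hK₀ hK₁ (lt_add_of_pos_left 1 hβ) hβs.le (add_sub_cancel_right β 1).le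
    fun v _ ↦ by
      rw [hbracket]
      exact div_ne_zero hc hΓ
  convert h using 3
  rw [hbracket, coeffScale, neg_add']
  ring

end

theorem Gamma_neg_ne_zero (hs : ∀ m : ℕ, s ≠ m) : Real.Gamma (-s) ≠ 0 :=
  Real.Gamma_ne_zero fun m h ↦ hs m (neg_injective h)

theorem hasSingularExpansion_one (D : Set ℂ) (R s : ℝ) :
    HasSingularExpansion (fun _ ↦ 1) D R (fun _ ↦ 1) 1 0 s := by
  simp [HasSingularExpansion]

theorem isEquivalent_of_unifEquiv_singleton {A : ℕ → ℝ → ℂ} {B : ℕ → ℝ → ℝ} {u : ℕ → ℝ} {v : ℝ}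
    (h : UnifEquiv {v} A B) (hu : ∀ N, (u N : ℂ) = A N v) : u ~[atTop] fun N ↦ B N v := by
  refine isLittleO_iff.2 fun ε hε ↦ (h ε hε).mono fun N hN ↦ ?_
  have hN := hN v rfl
  rwa [← hu, ← Complex.ofReal_sub, Complex.norm_real] at hN

theorem HasSingularExpansion.of_isBigO_of_one_add {D : Set ℂ} {δ : ℝ} {p : ℕ → ℂ} (hR : R ≠ 0)
    (hβ : 0 < β) (hδ : 0 < δ)
    (hf : (fun z ↦ f z - (1 + (∑ n ∈ Finset.Ico 1 ⌈β⌉₊, p n * (1 - z / R) ^ n) +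
      c * (1 - z / R) ^ (β : ℂ))) =O[𝓝[D] (R : ℂ)] fun z : ℂ ↦ ‖1 - z / R‖ ^ (β + δ)) :
    HasSingularExpansion f D R (Function.update p 0 1) ⌈β⌉₊ c β := by
  refine .of_isBigO hR hβ.le hδ (hf.congr_left fun z ↦ ?_)
  rw [Finset.range_eq_Ico, Finset.sum_eq_sum_Ico_succ_bot (Nat.ceil_pos.2 hβ),
    Function.update_self, pow_zero, mul_one]
  congr 3
  refine Finset.sum_congr rfl fun n hn ↦ ?_
  rw [Function.update_of_ne (Nat.one_le_iff_ne_zero.1 (Finset.mem_Ico.1 hn).1)]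

theorem toReal_lt_one {x : EReal} (hx : x < 1) : x.toReal < 1 := by
  induction x with
  | bot => simp
  | top => simp at hx
  | coe x => exact_mod_cast hx

theorem mul_lt_one_of_mem_Icc {b v₁ v₂ v : ℝ} (hv₂ : 1 < v₂) (hb : v₂ < 1 / b)
    (hv : v ∈ Set.Icc v₁ v₂) : v * b < 1 := by
  have hb_pos : 0 < b := one_div_pos.1 (by linarith)
  exact (lt_div_iff₀ hb_pos).1 (hv.2.trans_lt hb)

end Asymptotics

end SurrogateSpatial

open SurrogateSpatial in
theorem mainTheorem11_general
    {θ κ : ℕ → ℝ} (hκ : ∀ j, 1 ≤ j → 0 ≤ κ j) (hNA : NonArithmetic κ)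
    {R η φ : ℝ} (hR : 0 < R) (hη : 0 < η) (hφ : 0 < φ) (hφ' : φ < Real.pi / 2)
    {gκ gθ : ℂ → ℂ}
    (hgκ : ∀ z : ℂ, ‖z‖ < R → HasSum (fun j : ℕ ↦ (genCoeff κ j : ℂ) * z ^ j) (gκ z))
    (hgκ' : DifferentiableOn ℂ gκ (Delta0 R η φ))
    (hgθ : ∀ z : ℂ, ‖z‖ < R → HasSum (fun j : ℕ ↦ (genCoeff θ j : ℂ) * z ^ j) (gθ z))
    (hgθ' : DifferentiableOn ℂ gθ (Delta0 R η φ)) (hgθR : AnalyticAt ℂ gθ R)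
    {s a t b₀ b₁ : ℝ} (hs : 1 < s) (hsZ : ∀ m : ℕ, s ≠ m) (ha : a ≠ 0) {pκ : ℕ → ℂ} {mκ : ℕ}
    (hexp : HasSingularExpansion gκ (Delta0 R η φ) R pκ mκ a s) (hmκ : 1 < mκ)
    (hpκ₀ : pκ 0 = b₀) (hpκ₁ : pκ 1 = -b₁) (ht : gθ R = t) :
    (∀ (f : ℂ → ℂ) (β c : ℝ) (pf : ℕ → ℂ) (mf : ℕ), DifferentiableOn ℂ f (Delta0 R η φ) →
      HasSingularExpansion f (Delta0 R η φ) R pf mf c β → 0 < mf → pf 0 = 1 →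
      ∀ K : Set ℝ, IsCompact K → (∀ v ∈ K, 0 < v) → (∀ v ∈ K, v * b₁ < 1) →
        (s - 1 < β →
          UnifEquiv K (fun N v ↦ coeffAt N (fun z ↦ f z * Complex.exp (v * (gθ z + N * gκ z))))
            (fun N v ↦ Real.exp (v * (t + N * b₀)) * v * a * (N * (1 - v * b₁)) ^ (-s) /
              (R ^ N * Real.Gamma (-s) * (1 - v * b₁)))) ∧
        ((∀ m : ℕ, β ≠ m) → 0 < β → β < s - 1 → c ≠ 0 →
          UnifEquiv K (fun N v ↦ coeffAt N (fun z ↦ f z * Complex.exp (v * (gθ z + N * gκ z))))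
            (fun N v ↦ Real.exp (v * (t + N * b₀)) * c * (N * (1 - v * b₁)) ^ (-β - 1) /
              (R ^ N * Real.Gamma (-β)))) ∧
        (β = s - 1 →
          (∀ ε : ℝ, 0 < ε → ∀ᶠ N : ℕ in atTop, ∀ v ∈ K,
            ‖coeffAt N (fun z ↦ f z * Complex.exp (v * (gθ z + N * gκ z))) -
              ((Real.exp (v * (t + N * b₀)) * (N * (1 - v * b₁)) ^ (-s) / R ^ N *
                (c / Real.Gamma (1 - s) + v * a / (Real.Gamma (-s) * (1 - v * b₁))) : ℝ) : ℂ)‖ ≤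
            ε * (Real.exp (v * (t + N * b₀)) * (N * (1 - v * b₁)) ^ (-s) / R ^ N)) ∧
          ((∀ v ∈ K, c / Real.Gamma (1 - s) + v * a / (Real.Gamma (-s) * (1 - v * b₁)) ≠ 0) →
            UnifEquiv K (fun N v ↦ coeffAt N (fun z ↦ f z * Complex.exp (v * (gθ z + N * gκ z))))
              (fun N v ↦ Real.exp (v * (t + N * b₀)) * (N * (1 - v * b₁)) ^ (-s) / R ^ N *
                (c / Real.Gamma (1 - s) + v * a / (Real.Gamma (-s) * (1 - v * b₁))))))) ∧
    (b₁ < 1 →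
      (fun N : ℕ ↦ H θ κ N) ~[atTop]
        (fun N : ℕ ↦ Real.exp (t + N * b₀) * a * (N * (1 - b₁)) ^ (-s) /
          (R ^ N * Real.Gamma (-s) * (1 - b₁)))) := by
  have hΓ := Gamma_neg_ne_zero hsZ
  refine ⟨fun f β c pf mf hf hf_exp hmf hpf K hK hK₀ hK₁ ↦
    ⟨fun hβ ↦ ?_, fun hβZ hβ hβs hc ↦ ?_, ?_⟩, fun hb₁ ↦ ?_⟩
  · exact unifEquiv_coeffAt_of_sub_one_lt hκ hNA hR hη hφ hφ' hgκ hgκ' hexp hs hmκ hpκ₀ hpκ₁ hgθ'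
      hgθR ht hf hf_exp hmf hpf hK hK₀ hK₁ ha hΓ hβ
  · exact unifEquiv_coeffAt_of_lt_sub_one hκ hNA hR hη hφ hφ' hgκ hgκ' hexp hs hmκ hpκ₀ hpκ₁ hgθ'
      hgθR ht hf hf_exp hmf hpf hK hK₀ hK₁ hc (Gamma_neg_ne_zero hβZ) hβ hβs
  · rintro rfl
    have hexpansion (ε : ℝ) := eventually_norm_coeffAt_sub_le hκ hNA hR hη hφ hφ' hgκ hgκ' hexp hs
      hmκ hpκ₀ hpκ₁ hgθ' hgθR ht hf hf_exp hmf hpf hK hK₀ hK₁ hs le_rfl le_rfl (ε := ε)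
    have hequiv := unifEquiv_coeffAt hκ hNA hR hη hφ hφ' hgκ hgκ' hexp hs hmκ hpκ₀ hpκ₁ hgθ' hgθR ht
      hf hf_exp hmf hpf hK hK₀ hK₁ hs le_rfl le_rfl
    simpa [coeffScale, coeffBracket] using And.intro hexpansion hequiv
  · have hone := unifEquiv_coeffAt_of_sub_one_lt hκ hNA hR hη hφ hφ' hgκ hgκ' hexp hs hmκ hpκ₀ hpκ₁
      hgθ' hgθR ht (differentiableOn_const 1) (hasSingularExpansion_one _ R s) one_pos rfl
      isCompact_singleton (K := {1}) (by simp) (by simpa using hb₁) ha hΓ (sub_one_lt s)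
    have hball := Metric.ball_mem_nhds (0 : ℂ) hR
    simpa only [one_mul, mul_one] using isEquivalent_of_unifEquiv_singleton hone fun N ↦ by
      simpa using ofReal_H_eq_coeffAt_exp
        (eventually_of_mem hball fun z hz ↦ hgθ z (mem_ball_zero_iff.1 hz))
        (eventually_of_mem hball fun z hz ↦ hgκ z (mem_ball_zero_iff.1 hz)) N

theorem mainTheorem11
    (θ κ : ℕ → ℝ) (hθ : ∀ j, 1 ≤ j → 0 ≤ θ j) (hκ : ∀ j, 1 ≤ j → 0 ≤ κ j)
    (hNA : SurrogateSpatial.NonArithmetic κ)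
    (R η φ : ℝ) (hR : 0 < R) (hη : 0 < η) (hφ : 0 < φ) (hφ' : φ < Real.pi / 2)
    -- `g_κ` has radius of convergence `R`
    (hrad : (FormalMultilinearSeries.ofScalars ℂ
      (fun j : ℕ => (SurrogateSpatial.genCoeff κ j : ℂ))).radius = ENNReal.ofReal R)
    -- `gκ` is the holomorphic extension of the generating function to `Δ₀`
    (gκ : ℂ → ℂ)
    (hgκ : ∀ z : ℂ, ‖z‖ < R →
      HasSum (fun j : ℕ => (SurrogateSpatial.genCoeff κ j : ℂ) * z ^ j) (gκ z))
    (hgκ' : DifferentiableOn ℂ gκ (SurrogateSpatial.Delta0 R η φ))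
    -- `gθ` is the holomorphic extension of the generating function to `Δ₀`, regular at `R`
    (gθ : ℂ → ℂ)
    (hgθ : ∀ z : ℂ, ‖z‖ < R →
      HasSum (fun j : ℕ => (SurrogateSpatial.genCoeff θ j : ℂ) * z ^ j) (gθ z))
    (hgθ' : DifferentiableOn ℂ gθ (SurrogateSpatial.Delta0 R η φ))
    (hgθR : AnalyticAt ℂ gθ (R : ℂ))
    -- supercritical case
    (hsup : SurrogateSpatial.boundaryDeriv κ 1 R < 1)
    (s : ℝ) (hs : 1 < s) (hsZ : ∀ m : ℕ, s ≠ m)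
    (hfin : ∀ n : ℕ, (n : ℝ) < s → SurrogateSpatial.boundaryDeriv κ n R < ⊤)
    (hinf : ∀ n : ℕ, s < (n : ℝ) → SurrogateSpatial.boundaryDeriv κ n R = ⊤)
    (a δ : ℝ) (ha : a ≠ 0) (hδ : 0 < δ)
    (hexp : (fun z : ℂ => gκ z -
        ((∑ n ∈ Finset.range ⌈s⌉₊,
            (-1 : ℂ) ^ n * ((SurrogateSpatial.boundaryDeriv κ n R).toReal : ℂ) /
              (Nat.factorial n : ℂ) * (1 - z / R) ^ n)
          + (a : ℂ) * (1 - z / R) ^ (s : ℂ)))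
      =O[𝓝[SurrogateSpatial.Delta0 R η φ] (R : ℂ)] fun z : ℂ => ‖1 - z / R‖ ^ (s + δ)) :
    (∀ (f : ℂ → ℂ) (β c δ' : ℝ), 0 < β → 0 < c → 0 < δ' →
      DifferentiableOn ℂ f (SurrogateSpatial.Delta0 R η φ) →
      ((fun z : ℂ => f z -
          (1 + (∑ n ∈ Finset.Ico 1 ⌈β⌉₊,
              (-1 : ℂ) ^ n * SurrogateSpatial.boundaryDerivC f n R /
                (Nat.factorial n : ℂ) * (1 - z / R) ^ n)
            + (c : ℂ) * (1 - z / R) ^ (β : ℂ)))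
        =O[𝓝[SurrogateSpatial.Delta0 R η φ] (R : ℂ)] fun z : ℂ => ‖1 - z / R‖ ^ (β + δ')) →
      ∀ v₁ v₂ : ℝ, 0 < v₁ → v₁ < 1 → 1 < v₂ →
        v₂ < 1 / (SurrogateSpatial.boundaryDeriv κ 1 R).toReal →
        -- (i)
        (s - 1 < β →
          SurrogateSpatial.UnifEquiv (Set.Icc v₁ v₂)
            (fun N v => SurrogateSpatial.coeffAt N
              (fun z => f z * Complex.exp (v * (gθ z + N * gκ z))))
            (fun N v => Real.exp (v * SurrogateSpatial.GBoundary θ κ R N) * v * a *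
              (N * (1 - v * (SurrogateSpatial.boundaryDeriv κ 1 R).toReal)) ^ (-s) /
              (R ^ N * Real.Gamma (-s) *
                (1 - v * (SurrogateSpatial.boundaryDeriv κ 1 R).toReal)))) ∧
        -- (ii)
        ((∀ m : ℕ, β ≠ m) → β < s - 1 →
          SurrogateSpatial.UnifEquiv (Set.Icc v₁ v₂)
            (fun N v => SurrogateSpatial.coeffAt N
              (fun z => f z * Complex.exp (v * (gθ z + N * gκ z))))
            (fun N v => Real.exp (v * SurrogateSpatial.GBoundary θ κ R N) * c *
              (N * (1 - v * (SurrogateSpatial.boundaryDeriv κ 1 R).toReal)) ^ (-β - 1) /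
              (R ^ N * Real.Gamma (-β)))) ∧
        -- (iii): an `o(1)` in the bracket, uniformly on `[v₁, v₂]`, and genuine equivalence
        -- uniformly on each compact set of `v` where the bracket has no zero
        (β = s - 1 →
          (∀ ε : ℝ, 0 < ε → ∀ᶠ N : ℕ in atTop, ∀ v ∈ Set.Icc v₁ v₂,
            ‖SurrogateSpatial.coeffAt N
                (fun z => f z * Complex.exp (v * (gθ z + N * gκ z))) -
              ((Real.exp (v * SurrogateSpatial.GBoundary θ κ R N) *
                (N * (1 - v * (SurrogateSpatial.boundaryDeriv κ 1 R).toReal)) ^ (-s) / R ^ N *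
                (c / Real.Gamma (1 - s) + v * a / (Real.Gamma (-s) *
                  (1 - v * (SurrogateSpatial.boundaryDeriv κ 1 R).toReal))) : ℝ) : ℂ)‖
            ≤ ε * (Real.exp (v * SurrogateSpatial.GBoundary θ κ R N) *
                (N * (1 - v * (SurrogateSpatial.boundaryDeriv κ 1 R).toReal)) ^ (-s) / R ^ N)) ∧
          (∀ K : Set ℝ, IsCompact K → K ⊆ Set.Icc v₁ v₂ →
            (∀ v ∈ K, c / Real.Gamma (1 - s) + v * a / (Real.Gamma (-s) *
              (1 - v * (SurrogateSpatial.boundaryDeriv κ 1 R).toReal)) ≠ 0) →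
            SurrogateSpatial.UnifEquiv K
              (fun N v => SurrogateSpatial.coeffAt N
                (fun z => f z * Complex.exp (v * (gθ z + N * gκ z))))
              (fun N v => Real.exp (v * SurrogateSpatial.GBoundary θ κ R N) *
                (N * (1 - v * (SurrogateSpatial.boundaryDeriv κ 1 R).toReal)) ^ (-s) / R ^ N *
                (c / Real.Gamma (1 - s) + v * a / (Real.Gamma (-s) *
                  (1 - v * (SurrogateSpatial.boundaryDeriv κ 1 R).toReal))))))) ∧
    -- asymptotics of `H_N`
    (fun N : ℕ => SurrogateSpatial.H θ κ N) ~[atTop]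
      (fun N : ℕ => Real.exp (SurrogateSpatial.GBoundary θ κ R N) * a *
        (N * (1 - (SurrogateSpatial.boundaryDeriv κ 1 R).toReal)) ^ (-s) /
        (R ^ N * Real.Gamma (-s) *
          (1 - (SurrogateSpatial.boundaryDeriv κ 1 R).toReal))) := by
  have hexp := SurrogateSpatial.HasSingularExpansion.of_isBigO hR.ne' (by linarith) hδ hexp
  obtain ⟨hA, hB⟩ := mainTheorem11_general hκ hNA hR hη hφ hφ' hgκ hgκ' hgθ hgθ' hgθR hs hsZ ha
    (b₀ := (SurrogateSpatial.boundaryDeriv κ 0 R).toReal)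
    (b₁ := (SurrogateSpatial.boundaryDeriv κ 1 R).toReal)
    hexp (Nat.lt_ceil.2 (by exact_mod_cast hs)) (by simp) (by simp)
    (SurrogateSpatial.eq_toReal_boundaryDeriv_zero hgθ hR hgθR.continuousAt)
  refine ⟨fun f β c δ' hβ hc hδ' hf hf_exp v₁ v₂ hv₁ _ hv₂ hv₂' ↦ ?_,
    hB (SurrogateSpatial.toReal_lt_one hsup)⟩
  have hf_exp := SurrogateSpatial.HasSingularExpansion.of_isBigO_of_one_add hR.ne' hβ hδ' hf_exp
  have hA := fun K hK (hKsub : K ⊆ Set.Icc v₁ v₂) ↦ hA f β c _ _ hf hf_exp (Nat.ceil_pos.2 hβ)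
    (by simp) K hK (fun v hv ↦ hv₁.trans_le (hKsub hv).1)
    fun v hv ↦ SurrogateSpatial.mul_lt_one_of_mem_Icc hv₂ hv₂' (hKsub hv)
  obtain ⟨hi, hii, hiii⟩ := hA _ isCompact_Icc subset_rfl
  exact ⟨hi, fun hβZ hβs ↦ hii hβZ hβ hβs hc.ne', fun hβs ↦ ⟨(hiii hβs).1,
    fun K hK hKsub ↦ ((hA K hK hKsub).2.2 hβs).2⟩⟩
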